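/- Let $H_n$ be a compact Lie group and $\rho_n\colon H_n\to O_n$ a homomorphism of Lie groups whose image is $O_n$ or $SO_n$. Let $K=\ker\rho_n$, let $SH_n=\rho_n^{-1}(SO_n)$, and let $\widetilde{SH}_n=\{(h,s)\in SH_n\times \mathrm{Spin}_n : \rho_n(h)=\pi(s)\}$ be the double cover of $SH_n$ pulled back from the spin double cover $\pi\colon \mathrm{Spin}_n\to SO_n$. Let $\mathfrak h_n,\mathfrak k,\mathfrak o_n$ be the Lie algebras of $H_n,K,O_n$. (1) There is an ideal $\mathfrak o_n'\subset\mathfrak h_n$ such that $\mathfrak h_n=\mathfrak o_n'\oplus\mathfrak k$ as a direct sum of ideals, and the differential of $\rho_n$ restricts to an isomorphism of Lie algebras $\mathfrak o_n'\to\mathfrak o_n$. (2) Suppose $n\ge 3$. There is a canonical homomorphism $\varphi\colon \mathrm{Spin}_n\to H_n$: it is the unique continuous homomorphism such that $\rho_n\circ\varphi=\pi$ and $\varphi(s)k=k\varphi(s)$ for all $s\in\mathrm{Spin}_n$, $k\in K$. The map $(s,k)\mapsto(\varphi(s)k,\,s)$ is an isomorphism of Lie groups $\mathrm{Spin}_n\times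 K\cong\widetilde{SH}_n$. Moreover there is an element $k_0$ of the center of $K$ with $k_0^2=1$ such that $\varphi(-1)=k_0$ and such that $(s,k)\mapsto\varphi(s)k$ induces an isomorphism of Lie groups $$\bigl(\mathrm{Spin}_n\times K\bigr)\big/\langle(-1,k_0)\rangle\;\cong\; SH_n,$$ where $\langle(-1,k_0)\rangle$ is the cyclic group generated by $(-1,k_0)$. -/

import Mathlib

open scoped Manifold ContDiff

/-- A smooth real Lie group has the regularity under which Mathlib puts the Lie bracket on its
tangent space at the identity. -/
instance CptExt.lieGroupMinSmoothness {E M H : Type*} [NormedAddCommGroup E] [NormedSpace ℝ E]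
    [TopologicalSpace M] {I : ModelWithCorners ℝ E M} [TopologicalSpace H] [ChartedSpace M H]
    [Group H] [LieGroup I ∞ H] : LieGroup I (minSmoothness ℝ 3) H := by
  rw [minSmoothness_of_isRCLikeNormedField]
  infer_instance

namespace CptExt

noncomputable section

/-! ### Orthogonal and spin groups -/

/-- The orthogonal group `O_n` of real `n × n` matrices. -/
abbrev O (n : ℕ) : Type := Matrix.orthogonalGroup (Fin n) ℝ

/-- The special orthogonal group, as the subgroup of `O_n` of matrices of determinant `1`. -/
def SO (n : ℕ) : Subgroup (O n) where
  carrier := {A | (A : Matrix (Fin n) (Fin n) ℝ).det = 1}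
  one_mem' := by simp
  mul_mem' := by
    intro A B hA hB
    simp only [Set.mem_ofPred_eq] at hA hB ⊢
    simp [hA, hB]
  inv_mem' := by
    intro A hA
    simp only [Set.mem_ofPred_eq] at hA ⊢
    rw [Matrix.UnitaryGroup.inv_val, Matrix.star_eq_conjTranspose, Matrix.det_conjTranspose, hA]
    simp

/-- The quadratic form `x₁² + ⋯ + xₙ²` on `ℝⁿ`. -/
abbrev stdForm (n : ℕ) : QuadraticForm ℝ (Fin n → ℝ) :=
  QuadraticMap.weightedSumSquares ℝ (fun _ : Fin n => (1 : ℝ))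

/-- The Clifford algebra of Euclidean `ℝⁿ`. -/
abbrev Cliff (n : ℕ) : Type := CliffordAlgebra (stdForm n)

/-- The canonical vector space topology of the (finite-dimensional) Clifford algebra. -/
instance (n : ℕ) : TopologicalSpace (Cliff n) := moduleTopology ℝ (Cliff n)

/-- The group `Spin_n`, with the topology of a subspace of the Clifford algebra. -/
abbrev Spin (n : ℕ) : Type := spinGroup (stdForm n)

/-- The inclusion of vectors into the Clifford algebra. -/
abbrev vec (n : ℕ) : (Fin n → ℝ) →ₗ[ℝ] Cliff n := CliffordAlgebra.ι (stdForm n)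

theorem stdForm_apply {n : ℕ} (v : Fin n → ℝ) : stdForm n v = v ⬝ᵥ v := by
  simp [dotProduct]

theorem vec_injective (n : ℕ) : Function.Injective (vec n) := by
  rw [injective_iff_map_eq_zero]
  intro v hv
  have h := CliffordAlgebra.ι_sq_scalar (stdForm n) v
  rw [show CliffordAlgebra.ι (stdForm n) v = 0 from hv, zero_mul, eq_comm,
    map_eq_zero_iff _ (FaithfulSMul.algebraMap_injective ℝ (Cliff n)), stdForm_apply] at h
  exact dotProduct_self_eq_zero.1 h

theorem exists_conj_vec {n : ℕ} (s : Spin n) (v : Fin n → ℝ) :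
    ∃ w, vec n w = (s : Cliff n) * vec n v * ((s⁻¹ : Spin n) : Cliff n) := by
  obtain ⟨w, hw⟩ := spinGroup.conjAct_smul_ι_mem_range_ι
    (x := spinGroup.toUnits s) (Q := stdForm n) s.2 v
  exact ⟨w, hw⟩

theorem exists_rotation {n : ℕ} (s : Spin n) :
    ∃ A : O n, ∀ v, vec n ((A : Matrix (Fin n) (Fin n) ℝ).mulVec v) =
      (s : Cliff n) * vec n v * ((s⁻¹ : Spin n) : Cliff n) := by
  choose f hf using exists_conj_vec s
  let L : (Fin n → ℝ) →ₗ[ℝ] (Fin n → ℝ) :=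
    { toFun := f
      map_add' := fun x y => vec_injective n (by simp [hf, mul_add, add_mul])
      map_smul' := fun c x => vec_injective n (by simp [hf]) }
  have hL : ∀ v, (LinearMap.toMatrix' L).mulVec v = f v := fun v => by
    rw [LinearMap.toMatrix'_mulVec]; rfl
  have hs : ((s⁻¹ : Spin n) : Cliff n) * (s : Cliff n) = 1 := by
    rw [← Submonoid.coe_mul, inv_mul_cancel, Submonoid.coe_one]
  have hs' : (s : Cliff n) * ((s⁻¹ : Spin n) : Cliff n) = 1 := by
    rw [← Submonoid.coe_mul, mul_inv_cancel, Submonoid.coe_one]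
  have hQ : ∀ v, stdForm n (f v) = stdForm n v := by
    intro v
    apply FaithfulSMul.algebraMap_injective ℝ (Cliff n)
    rw [← CliffordAlgebra.ι_sq_scalar, ← CliffordAlgebra.ι_sq_scalar]
    have e := hf v
    rw [show CliffordAlgebra.ι (stdForm n) (f v) = _ from e]
    calc _ = (s : Cliff n) * vec n v * (((s⁻¹ : Spin n) : Cliff n) * (s : Cliff n)) * vec n v *
          ((s⁻¹ : Spin n) : Cliff n) := by simp only [mul_assoc]
      _ = (s : Cliff n) * (vec n v * vec n v) * ((s⁻¹ : Spin n) : Cliff n) := by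
          rw [hs]; simp only [mul_assoc, one_mul]
      _ = _ := by
          rw [show vec n v * vec n v = _ from CliffordAlgebra.ι_sq_scalar (stdForm n) v,
            ← Algebra.commutes, mul_assoc, hs', mul_one]
  have hB : ∀ v w, f v ⬝ᵥ f w = v ⬝ᵥ w := by
    intro v w
    have h1 := hQ (v + w)
    have h2 := hQ v
    have h3 := hQ w
    have h4 : f (v + w) = f v + f w := L.map_add v w
    simp only [stdForm_apply, h4, add_dotProduct, dotProduct_add] at h1 h2 h3
    rw [dotProduct_comm (f w) (f v), dotProduct_comm w v] at h1
    linarith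
  refine ⟨⟨LinearMap.toMatrix' L, ?_⟩, fun v => ?_⟩
  · rw [Matrix.mem_orthogonalGroup_iff']
    ext i j
    have := hB (Pi.single i 1) (Pi.single j 1)
    rw [← hL, ← hL] at this
    simp only [Matrix.mulVec_single_one] at this
    rw [Matrix.mul_apply, Matrix.one_apply]
    simpa [dotProduct, Pi.single_apply, eq_comm] using this
  · change vec n ((LinearMap.toMatrix' L).mulVec v) = _
    rw [hL, hf]

theorem O_ext {n : ℕ} {A B : O n} (h : ∀ v, vec n ((A : Matrix (Fin n) (Fin n) ℝ).mulVec v) =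
    vec n ((B : Matrix (Fin n) (Fin n) ℝ).mulVec v)) : A = B := by
  apply Subtype.ext
  exact Matrix.mulVec_injective (funext fun v => vec_injective n (h v))

/-- The covering `Spin_n → O_n` (with image `SO_n`): the vector representation, in which `s` sends
the vector `v` to `s v s⁻¹`. See `spinCover_spec`. -/
def spinCover (n : ℕ) : Spin n →* O n where
  toFun s := Classical.choose (exists_rotation s)
  map_one' := O_ext fun v => by
    rw [Classical.choose_spec (exists_rotation (1 : Spin n))]; simp
  map_mul' s t := O_ext fun v => by
    rw [Classical.choose_spec (exists_rotation (s * t)), Matrix.UnitaryGroup.mul_val,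
      ← Matrix.mulVec_mulVec, Classical.choose_spec (exists_rotation s),
      Classical.choose_spec (exists_rotation t), mul_inv_rev]
    simp only [Submonoid.coe_mul, mul_assoc]

theorem spinCover_spec {n : ℕ} (s : Spin n) (v : Fin n → ℝ) :
    vec n ((spinCover n s : Matrix (Fin n) (Fin n) ℝ).mulVec v) =
      (s : Cliff n) * vec n v * ((s⁻¹ : Spin n) : Cliff n) :=
  Classical.choose_spec (exists_rotation s) v

theorem neg_one_mem_spinGroup {n : ℕ} (hn : 0 < n) : (-1 : Cliff n) ∈ spinGroup (stdForm n) := by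
  let e : Cliff n := vec n (Pi.single ⟨0, hn⟩ 1)
  have he : e * e = 1 := by
    have := CliffordAlgebra.ι_sq_scalar (stdForm n) (Pi.single ⟨0, hn⟩ 1)
    rw [stdForm_apply, single_dotProduct, Pi.single_eq_same, one_mul, map_one] at this
    exact this
  let u : (Cliff n)ˣ := ⟨e, e, he, he⟩
  let u' : (Cliff n)ˣ := ⟨-e, -e, by simpa using he, by simpa using he⟩
  refine ⟨⟨?_, ?_⟩, ?_⟩
  · refine Submonoid.mem_map.2 ⟨u * u', ?_, ?_⟩
    · refine mul_mem (Subgroup.subset_closure ⟨_, rfl⟩)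
        (Subgroup.subset_closure ⟨-(Pi.single ⟨0, hn⟩ 1), ?_⟩)
      simp [u', e]
    · simp [u, u', he]
  · rw [SetLike.mem_coe, Unitary.mem_iff]
    simp
  · change (-1 : Cliff n) ∈ CliffordAlgebra.even (stdForm n)
    exact neg_mem (one_mem _)

/-- The central element `-1` of `Spin_n`, `n ≥ 1`. -/
def spinNegOne {n : ℕ} (hn : 0 < n) : Spin n := ⟨-1, neg_one_mem_spinGroup hn⟩

/-! ### Homomorphisms from a Lie group to `O_n` -/

section LieGroup

variable {d n : ℕ} {H : Type*} [TopologicalSpace H] [ChartedSpace (EuclideanSpace ℝ (Fin d)) H]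
  [Group H]

/-- Smoothness of a homomorphism to `O_n`: all matrix entries are smooth functions. -/
def IsSmoothHom (d : ℕ) {n : ℕ} {H : Type*} [TopologicalSpace H]
    [ChartedSpace (EuclideanSpace ℝ (Fin d)) H] [Group H] (ρ : H →* O n) : Prop :=
  ∀ i j, ContMDiff (𝓡 d) 𝓘(ℝ, ℝ) ∞ (fun h => (ρ h : Matrix (Fin n) (Fin n) ℝ) i j)

/-- The derivative at the identity of a homomorphism to `O_n`, as a matrix-valued function on
the Lie algebra, computed entry by entry. -/
def differential (ρ : H →* O n) (v : GroupLieAlgebra (𝓡 d) H) : Matrix (Fin n) (Fin n) ℝ :=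
  Matrix.of fun i j =>
    mfderiv (𝓡 d) 𝓘(ℝ, ℝ) (fun h => (ρ h : Matrix (Fin n) (Fin n) ℝ) i j) 1 v

/-- The Lie algebra of a closed subgroup `K` of `H`: the `v` with `exp (t v) ∈ K` for all real `t`.
Here `t ↦ exp (t v)` is the integral curve through `1` of the left-invariant vector field
that is `v` at the identity. -/
def subgroupLieAlgebra (d : ℕ) {H : Type*} [TopologicalSpace H]
    [ChartedSpace (EuclideanSpace ℝ (Fin d)) H] [Group H] (K : Subgroup H) :
    Set (GroupLieAlgebra (𝓡 d) H) :=
  {v | ∃ γ : ℝ → H, γ 0 = 1 ∧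
    IsMIntegralCurve (I := 𝓡 d) γ (mulInvariantVectorField (I := 𝓡 d) v) ∧ ∀ t, γ t ∈ K}

end LieGroup

/-! ### The groups built from `ρ : H → O_n`; the group `K` is the kernel `ρ.ker` -/

section Groups

variable {n : ℕ} {H : Type*} [Group H]

/-- `SH = ρ⁻¹(SO_n)`. -/
def SH (ρ : H →* O n) : Subgroup H := (SO n).comap ρ

/-- The double cover of `SH` pulled back from the spin double cover: pairs `(h, s)` in
`SH × Spin_n` with the same image in `SO_n`. -/
def SHCover (ρ : H →* O n) : Subgroup (SH ρ × Spin n) where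
  carrier := {x | ρ (x.1 : H) = spinCover n x.2}
  one_mem' := by simp
  mul_mem' := by
    intro x y hx hy
    simp only [Set.mem_ofPred_eq] at hx hy ⊢
    simp [hx, hy]
  inv_mem' := by
    intro x hx
    simp only [Set.mem_ofPred_eq] at hx ⊢
    simp [hx]

/-- The cyclic subgroup `⟨(-1, k₀)⟩` of `Spin_n × K`, for a central element `k₀` of `K`. -/
def diagSubgroup (hn : 0 < n) {K : Type*} [Group K] (k₀ : Subgroup.center K) :
    Subgroup (Spin n × K) :=
  Subgroup.zpowers (spinNegOne hn, (k₀ : K))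

instance (hn : 0 < n) {K : Type*} [Group K] (k₀ : Subgroup.center K) :
    (diagSubgroup hn k₀).Normal := by
  suffices h : diagSubgroup hn k₀ ≤ Subgroup.center (Spin n × K) from
    ⟨fun x hx g => by rwa [Subgroup.mem_center_iff.1 (h hx) g, mul_inv_cancel_right]⟩
  rw [diagSubgroup, Subgroup.zpowers_le, Subgroup.mem_center_iff]
  rintro ⟨s, k⟩
  refine Prod.ext (Subtype.ext ?_) (Subgroup.mem_center_iff.1 k₀.2 k)
  change (s : Cliff n) * (-1) = (-1) * (s : Cliff n)
  simp

/-- `φ : Spin_n → H` is a continuous lift of the covering `Spin_n → SO_n` through `ρ` whose image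
commutes with `K = ker ρ`. -/
structure IsCanonicalLift [TopologicalSpace H] (ρ : H →* O n) (φ : Spin n →* H) : Prop where
  continuous : Continuous φ
  lift : ∀ s, ρ (φ s) = spinCover n s
  commute : ∀ s, ∀ k ∈ ρ.ker, φ s * k = k * φ s

end Groups

end

end CptExt

/-! Part (1). Averaging an inner product over Haar measure makes the Lie algebra of the compact
group an orthogonal representation under `Ad`, so the kernel of the differential of `ρ` has an
`Ad`-invariant complement. As the bracket is the derivative of `Ad` (`mfderiv_Ad`), invariant
subspaces are ideals. The complement is isomorphic to the skew matrices once the differential is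
known to be onto them (`exists_dmap_eq`). That follows from the image of `ρ` by compactness: a
matrix function on `H` with zero derivative takes finitely many values, whereas the curves `exp (t
Z)` lie in the image of `ρ` and cannot move inside a finite set.

Part (2). Inverting the differential on the complement and exponentiating lifts every one-parameter
group of rotations to `H`, equivariantly under conjugation (`RotationLift`). The spin group is
generated by products `a b` of unit vectors, and `a b` covers the rotation by twice the angle
between `a` and `b`; so the lifted rotation at that time is the candidate for `φ (a b)` (`pair`). It
is well defined because, for `n ≥ 3`, the lifted full turn does not depend on the choice of the
second vector spanning the plane and is its own inverse. The relation `(a b)(b c) = a c` holds in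
`H` too (`pair_mul`), by a symmetry argument for isosceles triangles.

Rather than showing that these relations present the spin group, the proof constructs the graph of
`φ`: the subgroup of `H × Spin n` generated by the elements `(pair a b, a b)`. The general results
on `ReflectionPairing` apply to it and to the spin group alike: the kernel of the map to `O n` has
at most the two expected elements, the image contains the special orthogonal group, and the group is
compact. So the graph projects bijectively and homeomorphically to the spin group. Uniqueness of `φ`
holds because the spin group is perfect (`spin_hom_trivial`), and the two isomorphisms follow
formally from `φ` and the kernel `{1, -1}` of the spin covering. -/

open scoped Topology
open Filter

/-! ### The derivative of conjugation as a Lie bracket, in coordinates -/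

section Calculus
variable {E : Type*} [NormedAddCommGroup E] [NormedSpace ℝ E]

/-- Partial derivatives in the second variable are differentiable functions of the first. -/
theorem hasFDerivAt_fderiv_snd {F : E × E → E} {p : E × E} (hF : ContDiffAt ℝ 2 F p) (w : E) :
    HasFDerivAt (fun x => fderiv ℝ (fun y => F (x, y)) p.2 w)
      ((ContinuousLinearMap.apply ℝ E ((0 : E), w)).comp
        ((fderiv ℝ (fderiv ℝ F) p).comp (ContinuousLinearMap.inl ℝ E E))) p.1 := by
  have h1 : ∀ᶠ q in 𝓝 p, DifferentiableAt ℝ F q :=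
    (hF.eventually (by simp)).mono fun q hq => hq.differentiableAt (by simp)
  have h2 : ∀ᶠ x in 𝓝 p.1, DifferentiableAt ℝ F (x, p.2) :=
    (by fun_prop : ContinuousAt (fun x => (x, p.2)) p.1).eventually h1
  have h3 : HasFDerivAt (fderiv ℝ F) (fderiv ℝ (fderiv ℝ F) p) p :=
    ((hF.fderiv_right (m := 1) (by norm_num)).differentiableAt (by simp)).hasFDerivAt
  have h4 : HasFDerivAt (fun x : E => (x, p.2)) (ContinuousLinearMap.inl ℝ E E) p.1 :=
    hasFDerivAt_prodMk_left p.1 p.2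
  have h5 := (ContinuousLinearMap.apply ℝ E ((0 : E), w)).hasFDerivAt.comp p.1
    (HasFDerivAt.comp (g := fderiv ℝ F) p.1 h3 h4)
  refine h5.congr_of_eventuallyEq (h2.mono fun x hx => ?_)
  have := hx.hasFDerivAt.comp p.2 (hasFDerivAt_prodMk_right x p.2)
  simp only [Function.comp_def] at this ⊢
  rw [this.fderiv]
  simp

/-- If `M` is a local multiplication with unit `e` and `C (x, y) = x y x⁻¹`, then the derivative of
`x ↦ ∂C/∂y (x, e) w` at `e` is the Lie bracket of left invariant vector fields. -/
theorem fderiv_conj_eq_lieBracket {M C : E × E → E} {e : E}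
    (hM : ContDiffAt ℝ 2 M (e, e)) (hC : ContDiffAt ℝ 2 C (e, e))
    (hM1 : ∀ᶠ x in 𝓝 e, M (x, e) = x) (hM2 : ∀ᶠ y in 𝓝 e, M (e, y) = y)
    (hC1 : ∀ᶠ x in 𝓝 e, C (x, e) = e) (hC2 : ∀ᶠ y in 𝓝 e, C (e, y) = y)
    (hMC : ∀ᶠ p in 𝓝 (e, e), M (C p, p.1) = M p) (w : E) :
    DifferentiableAt ℝ (fun x => fderiv ℝ (fun y => C (x, y)) e w) e ∧
    ∀ v, fderiv ℝ (fun x => fderiv ℝ (fun y => C (x, y)) e w) e v =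
      VectorField.lieBracket ℝ (fun x => fderiv ℝ (fun y => M (x, y)) e v)
        (fun x => fderiv ℝ (fun y => M (x, y)) e w) e := by
  have hA := hasFDerivAt_fderiv_snd hC w
  refine ⟨hA.differentiableAt, fun v => ?_⟩
  have hX := fun u => hasFDerivAt_fderiv_snd hM u
  have hid : ∀ {G : E → E}, (∀ᶠ y in 𝓝 e, G y = y) → fderiv ℝ G e = ContinuousLinearMap.id ℝ E :=
    fun h => by
      exact (Filter.EventuallyEq.fderiv_eq (f₁ := _) (f := id) h).trans fderiv_id
  have hAe : fderiv ℝ (fun y => C (e, y)) e w = w := by rw [hid hC2]; rfl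
  have hXe : ∀ u, fderiv ℝ (fun y => M (e, y)) e u = u := fun u => by rw [hid hM2]; rfl
  have hCe : C (e, e) = e := hC1.self_of_nhds
  -- derivative in `y` of the identity `M (C (x, y), x) = M (x, y)`
  have hMd : ∀ᶠ q in 𝓝 (e, e), DifferentiableAt ℝ M q :=
    (hM.eventually (by simp)).mono fun q hq => hq.differentiableAt (by simp)
  have hCd : ∀ᶠ q in 𝓝 (e, e), DifferentiableAt ℝ C q :=
    (hC.eventually (by simp)).mono fun q hq => hq.differentiableAt (by simp)
  have hc1 : ContinuousAt (fun x => (x, e)) e := by fun_prop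
  have hc2 : ContinuousAt (fun x => (e, x)) e := by fun_prop
  have key : ∀ᶠ x in 𝓝 e, fderiv ℝ M (e, x) (fderiv ℝ (fun y => C (x, y)) e w, 0) =
      fderiv ℝ (fun y => M (x, y)) e w := by
    filter_upwards [hc1.eventually hMC.eventually_nhds, hc2.eventually hMd,
      hc1.eventually hCd, hC1] with x hx hxM hxC hxC1
    have h1 : (fun y => M (x, y)) =ᶠ[𝓝 e] fun y => M (C (x, y), x) := by
      have : ContinuousAt (fun y => (x, y)) e := by fun_prop
      exact (this.eventually hx).mono fun y hy => hy.symm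
    rw [h1.fderiv_eq]
    have h2 : HasFDerivAt (fun y => C (x, y)) (fderiv ℝ (fun y => C (x, y)) e) e :=
      (hxC.comp e (by fun_prop)).hasFDerivAt
    have h3 := HasFDerivAt.comp (g := M) (f := fun y => (C (x, y), x)) e
      (by simpa [hxC1] using hxM.hasFDerivAt) (h2.prodMk (hasFDerivAt_const x e))
    simp only [Function.comp_def] at h3
    rw [h3.fderiv]
    simp
  have hD : HasFDerivAt (fderiv ℝ M) (fderiv ℝ (fderiv ℝ M) (e, e)) (e, e) :=
    ((hM.fderiv_right (m := 1) (by norm_num)).differentiableAt (by simp)).hasFDerivAt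
  -- Differentiate `key` in the direction `v`. The left side gives `D²M (0, v) (w, 0)` plus the
  -- wanted derivative of the conjugation term, the right side gives `D²M (v, 0) (0, w)`.
  have h1 := (hD.comp e (hasFDerivAt_prodMk_right (𝕜 := ℝ) e e)).clm_apply
    (hA.prodMk (hasFDerivAt_const (0 : E) e))
  have h2 := (h1.congr_of_eventuallyEq (f₁ := fun x => fderiv ℝ (fun y => M (x, y)) e w)
    (key.mono fun x hx => by simpa using hx.symm)).unique (hX w)
  have h3 := congrArg (fun L => L v) h2
  have hfst : ∀ u, fderiv ℝ M (e, e) (u, 0) = u := fun u => by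
    have h := (HasFDerivAt.comp (g := M) (f := fun x => (x, e)) e hMd.self_of_nhds.hasFDerivAt
      (hasFDerivAt_prodMk_left (𝕜 := ℝ) e e)).fderiv
    have h' := congrArg (fun L => L u) h
    simp only [Function.comp_def] at h'
    rw [hid hM1] at h'
    simpa using h'.symm
  simp [hfst, hAe] at h3
  rw [VectorField.lieBracket, hXe, hXe, (hX w).fderiv, (hX v).fderiv, hA.fderiv]
  -- Symmetry of the second derivative turns the mixed term into the second half of the Lie bracket.
  have hsymm : fderiv ℝ (fderiv ℝ M) (e, e) (0, v) (w, 0) =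
      fderiv ℝ (fderiv ℝ M) (e, e) (w, 0) (0, v) :=
    (hM.isSymmSndFDerivAt (by simp)).eq _ _
  simp
  rw [← h3, hsymm]
  abel
end Calculus

/-! ### The adjoint action and its derivative -/

namespace CptExt
section AdjointAction
variable {d : ℕ} {H : Type*} [TopologicalSpace H] [ChartedSpace (EuclideanSpace ℝ (Fin d)) H]
  [Group H]

/-- The model vector space of a `d`-dimensional manifold. -/
abbrev Model (d : ℕ) : Type := EuclideanSpace ℝ (Fin d)

variable (d) in
/-- The adjoint action of a Lie group on its tangent space at the identity. -/
noncomputable def Ad (g : H) : Model d →L[ℝ] Model d :=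
  mfderiv (𝓡 d) (𝓡 d) (fun x : H => g * x * g⁻¹) 1

variable [LieGroup (𝓡 d) ∞ H]

variable (d H) in
/-- The group multiplication in the preferred chart at the identity. -/
noncomputable def chartMul (p : Model d × Model d) : Model d :=
  extChartAt (𝓡 d) (1 : H) ((extChartAt (𝓡 d) (1 : H)).symm p.1 *
    (extChartAt (𝓡 d) (1 : H)).symm p.2)

variable (d H) in
/-- The conjugation action in the preferred chart at the identity. -/
noncomputable def chartConj (p : Model d × Model d) : Model d :=
  extChartAt (𝓡 d) (1 : H) ((extChartAt (𝓡 d) (1 : H)).symm p.1 *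
    (extChartAt (𝓡 d) (1 : H)).symm p.2 * ((extChartAt (𝓡 d) (1 : H)).symm p.1)⁻¹)

variable (d H) in
theorem contMDiffAt_chart_symm_fst :
    ContMDiffAt 𝓘(ℝ, Model d × Model d) (𝓡 d) ∞
      (fun p : Model d × Model d => (extChartAt (𝓡 d) (1 : H)).symm p.1)
      (extChartAt (𝓡 d) (1 : H) 1, extChartAt (𝓡 d) (1 : H) 1) := by
  have h : ContMDiffAt 𝓘(ℝ, Model d) (𝓡 d) ∞ (extChartAt (𝓡 d) (1 : H)).symm
      (extChartAt (𝓡 d) (1 : H) 1) :=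
    (contMDiffOn_extChartAt_symm (1 : H)).contMDiffAt (extChartAt_target_mem_nhds (1 : H))
  exact ContMDiffAt.comp (I' := 𝓘(ℝ, Model d))
    (extChartAt (𝓡 d) (1 : H) 1, extChartAt (𝓡 d) (1 : H) 1) h
    (contDiff_fst.contMDiff.contMDiffAt)

variable (d H) in
theorem contMDiffAt_chart_symm_snd :
    ContMDiffAt 𝓘(ℝ, Model d × Model d) (𝓡 d) ∞
      (fun p : Model d × Model d => (extChartAt (𝓡 d) (1 : H)).symm p.2)
      (extChartAt (𝓡 d) (1 : H) 1, extChartAt (𝓡 d) (1 : H) 1) := by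
  have h : ContMDiffAt 𝓘(ℝ, Model d) (𝓡 d) ∞ (extChartAt (𝓡 d) (1 : H)).symm
      (extChartAt (𝓡 d) (1 : H) 1) :=
    (contMDiffOn_extChartAt_symm (1 : H)).contMDiffAt (extChartAt_target_mem_nhds (1 : H))
  exact ContMDiffAt.comp (I' := 𝓘(ℝ, Model d))
    (extChartAt (𝓡 d) (1 : H) 1, extChartAt (𝓡 d) (1 : H) 1) h
    (contDiff_snd.contMDiff.contMDiffAt)

variable (d H) in
theorem contDiffAt_chartMul : ContDiffAt ℝ 2 (chartMul d H)
    (extChartAt (𝓡 d) (1 : H) 1, extChartAt (𝓡 d) (1 : H) 1) := by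
  have h := (contMDiffAt_chart_symm_fst d H).mul (contMDiffAt_chart_symm_snd d H)
  have h1 : ContMDiffAt (𝓡 d) 𝓘(ℝ, Model d) ∞ (extChartAt (𝓡 d) (1 : H)) 1 :=
    contMDiffAt_extChartAt
  have h2 := ContMDiffAt.comp_of_eq (x := (extChartAt (𝓡 d) (1 : H) 1, extChartAt (𝓡 d) (1 : H) 1))
    h1 h (by simp)
  exact h2.contDiffAt.of_le (WithTop.coe_le_coe.2 le_top)

variable (d H) in
theorem contDiffAt_chartConj : ContDiffAt ℝ 2 (chartConj d H)
    (extChartAt (𝓡 d) (1 : H) 1, extChartAt (𝓡 d) (1 : H) 1) := by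
  have h := ((contMDiffAt_chart_symm_fst d H).mul (contMDiffAt_chart_symm_snd d H)).mul
    (contMDiffAt_chart_symm_fst d H).inv
  have h1 : ContMDiffAt (𝓡 d) 𝓘(ℝ, Model d) ∞ (extChartAt (𝓡 d) (1 : H)) 1 :=
    contMDiffAt_extChartAt
  have h2 := ContMDiffAt.comp_of_eq (x := (extChartAt (𝓡 d) (1 : H) 1, extChartAt (𝓡 d) (1 : H) 1))
    h1 h (by simp)
  exact h2.contDiffAt.of_le (WithTop.coe_le_coe.2 le_top)

theorem mdifferentiable_mul_left (g : H) : MDifferentiable (𝓡 d) (𝓡 d) (g * ·) :=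
  (contMDiff_mul_left (I := 𝓡 d) (n := ∞)).mdifferentiable (by simp)

theorem mdifferentiable_mul_right (g : H) : MDifferentiable (𝓡 d) (𝓡 d) (· * g) :=
  (contMDiff_mul_right (I := 𝓡 d) (n := ∞)).mdifferentiable (by simp)

theorem mdifferentiable_conj (g : H) : MDifferentiable (𝓡 d) (𝓡 d) (fun x => g * x * g⁻¹) :=
  (mdifferentiable_mul_right g⁻¹).comp (mdifferentiable_mul_left g)

/-- Conjugation fixes the identity, so `mfderiv` at `1` reads source and target in the same chart.
This is why `x` need not lie in the target of the chart. -/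
theorem Ad_eq_fderiv_chartConj {x : Model d} :
    Ad d ((extChartAt (𝓡 d) (1 : H)).symm x) =
      fderiv ℝ (fun y => chartConj d H (x, y)) (extChartAt (𝓡 d) (1 : H) 1) := by
  refine (MDifferentiableAt.mfderiv (mdifferentiable_conj _ 1)).trans ?_
  have h : Set.range (𝓡 d) = Set.univ := ModelWithCorners.range_eq_univ _
  rw [h, fderivWithin_univ]
  simp only [writtenInExtChartAt, mul_one, mul_inv_cancel]
  rfl

/-- Pulling back along the inverse chart amounts to applying the differential of the chart, and the
chart after left translation is `chartMul` in its second variable. -/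
theorem fderiv_chartMul {x : Model d}
    (hx : x ∈ (extChartAt (𝓡 d) (1 : H)).target)
    (v : GroupLieAlgebra (𝓡 d) H) :
    VectorField.mpullbackWithin 𝓘(ℝ, Model d) (𝓡 d) (extChartAt (𝓡 d) (1 : H)).symm
      (mulInvariantVectorField v) (Set.range (𝓡 d)) x =
      fderiv ℝ (fun y => chartMul d H (x, y)) (extChartAt (𝓡 d) (1 : H) 1) v := by
  have : IsManifold (𝓡 d) 1 H := IsManifold.of_le (n := ∞) (by simp)
  have hc : MDifferentiableAt (𝓡 d) 𝓘(ℝ, Model d) (extChartAt (𝓡 d) (1 : H))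
      ((extChartAt (𝓡 d) (1 : H)).symm x) :=
    mdifferentiableAt_extChartAt (by
      simpa using (extChartAt (𝓡 d) (1 : H)).map_target hx)
  have h1 : mfderiv (𝓡 d) 𝓘(ℝ, Model d)
      (extChartAt (𝓡 d) (1 : H) ∘ ((extChartAt (𝓡 d) (1 : H)).symm x * ·)) 1 =
      fderiv ℝ (fun y => chartMul d H (x, y)) (extChartAt (𝓡 d) (1 : H) 1) := by
    refine (MDifferentiableAt.mfderiv (MDifferentiableAt.comp_of_eq (1 : H) hc
      (mdifferentiable_mul_left _ 1) (mul_one _))).trans ?_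
    have h : Set.range (𝓡 d) = Set.univ := ModelWithCorners.range_eq_univ _
    rw [h, fderivWithin_univ]
    rfl
  rw [← h1, mfderiv_comp_of_eq hc (mdifferentiable_mul_left _ 1) (mul_one _),
    VectorField.mpullbackWithin_apply, ContinuousLinearMap.inverse_eq
    (mfderivWithin_extChartAt_symm_comp_mfderiv_extChartAt hx)
    (mfderiv_extChartAt_comp_mfderivWithin_extChartAt_symm hx)]
  -- The point `x * 1` equals `x` only propositionally, so the two differentials have different
  -- types. Quantifying over the base point allows substitution; the same device recurs below.
  have h2 : ∀ (y : H) (_ : y = (extChartAt (𝓡 d) (1 : H)).symm x) (u : Model d),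
      (mfderiv (𝓡 d) 𝓘(ℝ, Model d) (extChartAt (𝓡 d) (1 : H)) y : Model d →L[ℝ] Model d) u =
      (mfderiv (𝓡 d) 𝓘(ℝ, Model d) (extChartAt (𝓡 d) (1 : H))
        ((extChartAt (𝓡 d) (1 : H)).symm x) : Model d →L[ℝ] Model d) u := by
    rintro _ rfl _; rfl
  exact (h2 _ (mul_one _) _).symm

/-- A Lie bracket depends only on germs, and near the center of the chart the pulled back invariant
fields are given by `fderiv_chartMul`. -/
theorem bracket_eq_lieBracket (v w : GroupLieAlgebra (𝓡 d) H) :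
    (⁅v, w⁆ : GroupLieAlgebra (𝓡 d) H) = VectorField.lieBracket ℝ
      (fun x => fderiv ℝ (fun y => chartMul d H (x, y)) (extChartAt (𝓡 d) (1 : H) 1) v)
      (fun x => fderiv ℝ (fun y => chartMul d H (x, y)) (extChartAt (𝓡 d) (1 : H) 1) w)
      (extChartAt (𝓡 d) (1 : H) 1) := by
  have : IsManifold (𝓡 d) 1 H := IsManifold.of_le (n := ∞) (by simp)
  rw [GroupLieAlgebra.bracket_def, VectorField.mlieBracket,
    VectorField.mlieBracketWithin_apply, mfderiv_extChartAt_self]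
  refine (congrArg (fun L : Model d →L[ℝ] Model d => L _) ContinuousLinearMap.inverse_id).trans ?_
  rw [ContinuousLinearMap.id_apply]
  have h : Set.range (𝓡 d) = Set.univ := ModelWithCorners.range_eq_univ _
  simp only [Set.preimage_univ, Set.univ_inter]
  have e : ∀ u : GroupLieAlgebra (𝓡 d) H,
      VectorField.mpullbackWithin 𝓘(ℝ, Model d) (𝓡 d) (extChartAt (𝓡 d) (1 : H)).symm
      (mulInvariantVectorField u) (Set.range (𝓡 d)) =ᶠ[𝓝 (extChartAt (𝓡 d) (1 : H) 1)]
      fun x => fderiv ℝ (fun y => chartMul d H (x, y)) (extChartAt (𝓡 d) (1 : H) 1) u :=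
    fun u => mem_of_superset (extChartAt_target_mem_nhds (I := 𝓡 d) (1 : H))
      fun x hx => fderiv_chartMul hx u
  have e' := (e v).lieBracket_vectorField_eq (𝕜 := ℝ) (e w)
  rw [h] at e' ⊢
  exact (congrFun VectorField.lieBracketWithin_univ _).trans e'

/-- The hypotheses of `fderiv_conj_eq_lieBracket` are group identities, valid near the center of the
chart. This is the bridge by which facts about conjugation in `H` become facts about brackets. -/
theorem mfderiv_Ad (v w : GroupLieAlgebra (𝓡 d) H) :
    MDifferentiableAt (𝓡 d) 𝓘(ℝ, Model d) (fun g : H => Ad d g w) 1 ∧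
      mfderiv (𝓡 d) 𝓘(ℝ, Model d) (fun g : H => Ad d g w) 1 v =
        (⁅v, w⁆ : GroupLieAlgebra (𝓡 d) H) := by
  have : IsManifold (𝓡 d) 1 H := IsManifold.of_le (n := ∞) (by simp)
  have hG : IsTopologicalGroup H := topologicalGroup_of_lieGroup (𝓡 d) ∞
  set c := extChartAt (𝓡 d) (1 : H) with hc
  have hr : ∀ᶠ x in 𝓝 (c 1), c (c.symm x) = x :=
    mem_of_superset (extChartAt_target_mem_nhds (I := 𝓡 d) (1 : H)) fun x hx => c.right_inv hx
  have hc1 : c.symm (c 1) = 1 := extChartAt_to_inv (I := 𝓡 d) (1 : H)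
  have hcs : ContinuousAt (fun p : Model d × Model d => c.symm p.1 * c.symm p.2 * (c.symm p.1)⁻¹)
      (c 1, c 1) :=
    ((((contMDiffAt_chart_symm_fst d H).mul (contMDiffAt_chart_symm_snd d H)).mul
      (contMDiffAt_chart_symm_fst d H).inv)).continuousAt
  have hsrc : ∀ᶠ p in 𝓝 (c 1, c 1), c.symm p.1 * c.symm p.2 * (c.symm p.1)⁻¹ ∈ c.source := by
    refine hcs.eventually (p := fun y => y ∈ c.source) ?_
    simp only [hc1, mul_one, inv_one]
    exact extChartAt_source_mem_nhds (I := 𝓡 d) (1 : H)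
  have key := fderiv_conj_eq_lieBracket (contDiffAt_chartMul d H) (contDiffAt_chartConj d H)
    (hr.mono fun x hx => by simp only [chartMul, ← hc, hc1, mul_one, hx])
    (hr.mono fun x hx => by simp only [chartMul, ← hc, hc1, one_mul, hx])
    (hr.mono fun x hx => by simp only [chartConj, ← hc, hc1, mul_one, mul_inv_cancel])
    (hr.mono fun x hx => by simp only [chartConj, ← hc, hc1, one_mul, inv_one, mul_one, hx])
    (hsrc.mono fun p hp => by
      simp only [chartMul, chartConj, ← hc]
      rw [c.left_inv hp]; group) w
  have hAd : (fun x => fderiv ℝ (fun y => chartConj d H (x, y)) (c 1) w) =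
      fun x => Ad d (c.symm x) w := by
    funext x
    rw [Ad_eq_fderiv_chartConj]
  rw [← hc, hAd] at key
  have hd : MDifferentiableAt (𝓡 d) 𝓘(ℝ, Model d) (fun g : H => Ad d g w) 1 := by
    have h1 : MDifferentiableAt (𝓡 d) 𝓘(ℝ, Model d) (fun g : H => Ad d (c.symm (c g)) w) 1 :=
      MDifferentiableAt.comp (I' := 𝓘(ℝ, Model d)) (1 : H)
        (g := fun x => Ad d (c.symm x) w) (f := c) key.1.mdifferentiableAt
        (mdifferentiableAt_extChartAt (by simp))
    refine h1.congr_of_eventuallyEq ?_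
    filter_upwards [extChartAt_source_mem_nhds (I := 𝓡 d) (1 : H)] with g hg
    rw [c.left_inv hg]
  refine ⟨hd, ?_⟩
  rw [bracket_eq_lieBracket, ← key.2 v]
  refine congrArg (fun L : Model d →L[ℝ] Model d => L v) ?_
  refine (MDifferentiableAt.mfderiv hd).trans ?_
  have h : Set.range (𝓡 d) = Set.univ := ModelWithCorners.range_eq_univ _
  rw [h, fderivWithin_univ]
  rfl
end AdjointAction
end CptExt

/-! ### Curves with constant left velocity and one-parameter subgroups -/

namespace CptExt
section LeftDerivative
variable {d : ℕ} {H : Type*} [TopologicalSpace H] [ChartedSpace (EuclideanSpace ℝ (Fin d)) H]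
  [Group H]

/-- The curve `γ` has at time `t` the velocity that is the left translate of `v`. -/
def HasLeftDeriv (d : ℕ) {H : Type*} [TopologicalSpace H]
    [ChartedSpace (EuclideanSpace ℝ (Fin d)) H] [Group H]
    (γ : ℝ → H) (v : Model d) (t : ℝ) : Prop :=
  HasMFDerivAt 𝓘(ℝ, ℝ) (𝓡 d) γ t ((1 : ℝ →L[ℝ] ℝ).smulRight
    (mulInvariantVectorField (I := 𝓡 d) (G := H) v (γ t)))

theorem HasLeftDeriv.of_hasMFDerivAt {γ : ℝ → H} {v : Model d} {t : ℝ} {L : ℝ →L[ℝ] Model d}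
    (h : HasMFDerivAt 𝓘(ℝ, ℝ) (𝓡 d) γ t L)
    (hL : L 1 = mulInvariantVectorField (I := 𝓡 d) (G := H) v (γ t)) :
    HasLeftDeriv d γ v t := by
  refine h.congr_mfderiv (ContinuousLinearMap.ext_ring (M₁ := Model d) (hL.trans ?_))
  exact (one_smul ℝ (mulInvariantVectorField (I := 𝓡 d) (G := H) v (γ t) : Model d)).symm

theorem HasLeftDeriv.congr {γ δ : ℝ → H} {v : Model d} {t : ℝ} (h : HasLeftDeriv d γ v t)
    (e : δ =ᶠ[𝓝 t] γ) : HasLeftDeriv d δ v t := by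
  have h' := HasMFDerivAt.congr_of_eventuallyEq h e
  unfold HasLeftDeriv
  rw [e.self_of_nhds]
  exact h'

theorem HasLeftDeriv.comp {γ : ℝ → H} {v : Model d} {t a : ℝ} {α : ℝ → ℝ}
    (h : HasLeftDeriv d γ v (α t)) (hα : HasDerivAt α a t) :
    HasLeftDeriv d (fun s => γ (α s)) (a • v) t := by
  have h' := HasMFDerivAt.comp t h hα.hasFDerivAt.hasMFDerivAt
  refine HasLeftDeriv.of_hasMFDerivAt h' ?_
  refine Eq.trans (b := a • (mulInvariantVectorField (I := 𝓡 d) (G := H) v (γ (α t)) : Model d)) ?_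
    (ContinuousLinearMap.map_smul (mfderiv (𝓡 d) (𝓡 d) (γ (α t) * ·) 1 : Model d →L[ℝ] Model d)
      a v).symm
  exact congrArg (fun c : ℝ => c • (mulInvariantVectorField (I := 𝓡 d) (G := H) v (γ (α t)) : Model d))
    (one_smul ℝ a)

theorem HasLeftDeriv.continuousAt {γ : ℝ → H} {v : Model d} {t : ℝ} (h : HasLeftDeriv d γ v t) :
    ContinuousAt γ t := HasMFDerivAt.continuousAt h

/-- Postcomposition with a differentiable function to a vector space. -/
theorem HasLeftDeriv.hasDerivAt {F : Type*} [NormedAddCommGroup F] [NormedSpace ℝ F]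
    {γ : ℝ → H} {v : Model d} {t : ℝ} (h : HasLeftDeriv d γ v t) {f : H → F}
    (hf : MDifferentiableAt (𝓡 d) 𝓘(ℝ, F) f (γ t)) :
    HasDerivAt (fun s => f (γ s))
      ((mfderiv (𝓡 d) 𝓘(ℝ, F) f (γ t) : Model d →L[ℝ] F)
        (mulInvariantVectorField (I := 𝓡 d) (G := H) v (γ t))) t := by
  obtain ⟨A, hA⟩ : ∃ A : Model d →L[ℝ] F, A = mfderiv (𝓡 d) 𝓘(ℝ, F) f (γ t) := ⟨_, rfl⟩
  obtain ⟨V, hV⟩ : ∃ V : Model d, V = mulInvariantVectorField (I := 𝓡 d) (G := H) v (γ t) :=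
    ⟨_, rfl⟩
  have h' : HasFDerivAt (fun s => f (γ s)) (A.comp ((1 : ℝ →L[ℝ] ℝ).smulRight V)) t := by
    rw [hA, hV]
    exact (HasMFDerivAt.comp t hf.hasMFDerivAt h).hasFDerivAt
  rw [← hA, ← hV]
  exact h'.hasDerivAt.congr_deriv (by simp; rfl)

theorem mulInvariantVectorField_one_apply (v : GroupLieAlgebra (𝓡 d) H) :
    (mulInvariantVectorField (I := 𝓡 d) (G := H) v 1 : Model d) = v := by
  have e : ((1 : H) * · : H → H) = id := by funext x; simp
  have h : (mfderiv (𝓡 d) (𝓡 d) ((1 : H) * ·) 1 : Model d →L[ℝ] Model d) =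
      ContinuousLinearMap.id ℝ (Model d) := by
    have : ∀ f : H → H, f = id → (mfderiv (𝓡 d) (𝓡 d) f 1 : Model d →L[ℝ] Model d) =
        ContinuousLinearMap.id ℝ (Model d) := by rintro _ rfl; exact mfderiv_id
    exact this _ e
  exact congrArg (fun L : Model d →L[ℝ] Model d => L v) h

theorem Ad_one (v : Model d) : Ad d (1 : H) v = v := by
  have e : (fun x : H => 1 * x * 1⁻¹) = id := by funext x; simp
  have : ∀ f : H → H, f = id → (mfderiv (𝓡 d) (𝓡 d) f 1 : Model d →L[ℝ] Model d) =
      ContinuousLinearMap.id ℝ (Model d) := by rintro _ rfl; exact mfderiv_id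
  exact congrArg (fun L : Model d →L[ℝ] Model d => L v) (this _ e)

theorem hasLeftDeriv_const (g : H) (t : ℝ) : HasLeftDeriv d (fun _ : ℝ => g) 0 t :=
  HasLeftDeriv.of_hasMFDerivAt (hasMFDerivAt_const g t)
    (ContinuousLinearMap.map_zero (mfderiv (𝓡 d) (𝓡 d) (g * ·) 1 : Model d →L[ℝ] Model d)).symm

variable [LieGroup (𝓡 d) ∞ H]

theorem mfderiv_mul_left_mulInvariantVectorField (g h : H) (v : Model d) :
    (mfderiv (𝓡 d) (𝓡 d) (g * ·) h : Model d →L[ℝ] Model d)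
      (mulInvariantVectorField (I := 𝓡 d) (G := H) v h) =
      mulInvariantVectorField (I := 𝓡 d) (G := H) v (g * h) := by
  have e : ((g * h) * · : H → H) = (g * ·) ∘ (h * ·) := by funext x; simp [mul_assoc]
  have h1 := mfderiv_comp_of_eq (x := (1 : H)) (y := h) (mdifferentiable_mul_left (d := d) g h)
    (mdifferentiable_mul_left (d := d) h 1) (mul_one h)
  rw [← e] at h1
  have h2 : ∀ (y : H) (_ : y = h) (u : Model d),
      (mfderiv (𝓡 d) (𝓡 d) (g * ·) y : Model d →L[ℝ] Model d) u =
      (mfderiv (𝓡 d) (𝓡 d) (g * ·) h : Model d →L[ℝ] Model d) u := by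
    rintro _ rfl _; rfl
  refine (h2 _ (mul_one h) _).symm.trans ?_
  exact (congrArg (fun L : Model d →L[ℝ] Model d => L v) h1).symm

/-- From `g y h = (g h)(h⁻¹ y h)`: right translation by `h` acts on left velocities through `Ad
h⁻¹`. -/
theorem mfderiv_mul_right_mulInvariantVectorField (g h : H) (v : Model d) :
    (mfderiv (𝓡 d) (𝓡 d) (· * h) g : Model d →L[ℝ] Model d)
      (mulInvariantVectorField (I := 𝓡 d) (G := H) v g) =
      mulInvariantVectorField (I := 𝓡 d) (G := H) (Ad d h⁻¹ v) (g * h) := by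
  have e : (· * h : H → H) ∘ (g * ·) = ((g * h) * · : H → H) ∘ (fun x => h⁻¹ * x * h⁻¹⁻¹) := by
    funext x; simp [mul_assoc]
  have h1 := mfderiv_comp_of_eq (x := (1 : H)) (y := g) (mdifferentiable_mul_right (d := d) h g)
    (mdifferentiable_mul_left (d := d) g 1) (mul_one g)
  have h1' := mfderiv_comp_of_eq (x := (1 : H)) (y := 1) (mdifferentiable_mul_left (d := d) (g * h) 1)
    (mdifferentiable_conj (d := d) h⁻¹ 1) (by simp)
  rw [e] at h1
  have h2 : ∀ (y : H) (_ : y = g) (u : Model d),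
      (mfderiv (𝓡 d) (𝓡 d) (· * h) y : Model d →L[ℝ] Model d) u =
      (mfderiv (𝓡 d) (𝓡 d) (· * h) g : Model d →L[ℝ] Model d) u := by
    rintro _ rfl _; rfl
  have h3 : ∀ (y : H) (_ : y = 1) (u : Model d),
      (mfderiv (𝓡 d) (𝓡 d) ((g * h) * ·) y : Model d →L[ℝ] Model d) u =
      (mfderiv (𝓡 d) (𝓡 d) ((g * h) * ·) 1 : Model d →L[ℝ] Model d) u := by
    rintro _ rfl _; rfl
  refine (h2 _ (mul_one g) _).symm.trans ?_
  refine (congrArg (fun L : Model d →L[ℝ] Model d => L v) h1).symm.trans ?_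
  refine (congrArg (fun L : Model d →L[ℝ] Model d => L v) h1').trans ?_
  exact h3 _ (by simp) _

/-- The Leibniz rule in the left trivialization. Only the velocity of the left factor is twisted,
since it alone has to be moved past the other factor. -/
theorem HasLeftDeriv.mul {γ δ : ℝ → H} {v w : Model d} {t : ℝ} (hγ : HasLeftDeriv d γ v t)
    (hδ : HasLeftDeriv d δ w t) :
    HasLeftDeriv d (fun s => γ s * δ s) (Ad d (δ t)⁻¹ v + w) t := by
  have hm : MDifferentiableAt ((𝓡 d).prod (𝓡 d)) (𝓡 d) (fun p : H × H => p.1 * p.2) (γ t, δ t) :=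
    (contMDiff_mul (𝓡 d) ∞).mdifferentiable (by simp) _
  have h := HasMFDerivAt.comp (g := fun p : H × H => p.1 * p.2) (f := fun s => (γ s, δ s)) t
    hm.hasMFDerivAt (HasMFDerivAt.prodMk hγ hδ)
  refine HasLeftDeriv.of_hasMFDerivAt h ?_
  have h1 := mfderiv_prod_eq_add_apply (I := 𝓡 d) (I' := 𝓡 d) (p := (γ t, δ t))
    (v := ((mulInvariantVectorField (I := 𝓡 d) (G := H) v (γ t) : Model d),
    (mulInvariantVectorField (I := 𝓡 d) (G := H) w (δ t) : Model d))) hm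
  have hone : ∀ u : Model d, ((1 : ℝ →L[ℝ] ℝ).smulRight u) 1 = u := fun u => one_smul ℝ u
  refine (congrArg (mfderiv ((𝓡 d).prod (𝓡 d)) (𝓡 d) (fun p : H × H => p.1 * p.2) (γ t, δ t) :
    Model d × Model d →L[ℝ] Model d) (congrArg₂ Prod.mk
    (hone (mulInvariantVectorField (I := 𝓡 d) (G := H) v (γ t)))
    (hone (mulInvariantVectorField (I := 𝓡 d) (G := H) w (δ t))))).trans ?_
  refine h1.trans ?_
  refine (congrArg₂ (· + · : Model d → Model d → Model d)
    (mfderiv_mul_right_mulInvariantVectorField (γ t) (δ t) v)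
    (mfderiv_mul_left_mulInvariantVectorField (γ t) (δ t) w)).trans ?_
  exact (map_add (mfderiv (𝓡 d) (𝓡 d) (γ t * δ t * ·) 1 : Model d →L[ℝ] Model d) _ _).symm

theorem Ad_mul (g h : H) (v : Model d) : Ad d (g * h) v = Ad d g (Ad d h v) := by
  have e : (fun x => g * h * x * (g * h)⁻¹) =
      (fun x : H => g * x * g⁻¹) ∘ (fun x => h * x * h⁻¹) := by
    funext x; simp [mul_assoc]
  have h1 := mfderiv_comp_of_eq (x := (1 : H)) (y := 1) (mdifferentiable_conj (d := d) g 1)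
    (mdifferentiable_conj (d := d) h 1) (by simp)
  rw [← e] at h1
  have h3 : ∀ (y : H) (_ : y = 1) (u : Model d),
      (mfderiv (𝓡 d) (𝓡 d) (fun x : H => g * x * g⁻¹) y : Model d →L[ℝ] Model d) u =
      Ad d g u := by
    rintro _ rfl _; rfl
  refine (congrArg (fun L : Model d →L[ℝ] Model d => L v) h1).trans ?_
  exact h3 _ (by simp) _

/-- `mfderiv_Ad` gives continuity at the identity; multiplicativity of `Ad` transports it to `g`. -/
theorem continuous_Ad (v : Model d) : Continuous fun g : H => Ad d g v := by
  have hG : IsTopologicalGroup H := topologicalGroup_of_lieGroup (𝓡 d) ∞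
  rw [continuous_iff_continuousAt]
  intro g
  have h1 : ContinuousAt (fun x : H => Ad d x v) (g⁻¹ * g) := by
    rw [inv_mul_cancel]
    exact (mfderiv_Ad (d := d) (H := H) v v).1.continuousAt
  have h2 : ContinuousAt (fun x : H => Ad d g (Ad d (g⁻¹ * x) v)) g :=
    (Ad d g).continuous.continuousAt.comp
      (ContinuousAt.comp (f := fun x => g⁻¹ * x) h1 (by fun_prop))
  simpa [← Ad_mul] using h2

/-- The derivative of the adjoint action along a curve through the identity. -/
theorem HasLeftDeriv.hasDerivAt_Ad {γ : ℝ → H} {v : GroupLieAlgebra (𝓡 d) H} {t : ℝ}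
    (h : HasLeftDeriv d γ v t) (ht : γ t = 1) (w : GroupLieAlgebra (𝓡 d) H) :
    HasDerivAt (fun s => Ad d (γ s) w) (⁅v, w⁆ : GroupLieAlgebra (𝓡 d) H) t := by
  have h1 := mfderiv_Ad v w
  refine (h.hasDerivAt (f := fun g => Ad d g w) (by rw [ht]; exact h1.1)).congr_deriv ?_
  rw [← h1.2]
  have h2 : ∀ y : H, y = 1 →
      (mfderiv (𝓡 d) 𝓘(ℝ, Model d) (fun g : H => Ad d g w) y : Model d →L[ℝ] Model d)
      (mulInvariantVectorField (I := 𝓡 d) (G := H) v y) =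
      (mfderiv (𝓡 d) 𝓘(ℝ, Model d) (fun g : H => Ad d g w) 1 : Model d →L[ℝ] Model d) v := by
    rintro _ rfl
    exact congrArg (mfderiv (𝓡 d) 𝓘(ℝ, Model d) (fun g : H => Ad d g w) 1 :
      Model d →L[ℝ] Model d) (mulInvariantVectorField_one_apply v)
  exact h2 _ ht

theorem contMDiff_mulInvariantVectorField_one (v : GroupLieAlgebra (𝓡 d) H) :
    ContMDiff (𝓡 d) (𝓡 d).tangent 1
      (fun g : H => (mulInvariantVectorField v g : TangentBundle (𝓡 d) H)) :=
  (contMDiff_mulInvariantVectorField v).of_le (by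
    rw [minSmoothness_of_isRCLikeNormedField]; norm_num)

theorem HasLeftDeriv.const_mul {γ : ℝ → H} {v : Model d} {t : ℝ} (h : HasLeftDeriv d γ v t)
    (g : H) : HasLeftDeriv d (fun s => g * γ s) v t := by
  simpa using (hasLeftDeriv_const (d := d) g t).mul h

theorem HasLeftDeriv.mul_const {γ : ℝ → H} {v : Model d} {t : ℝ} (h : HasLeftDeriv d γ v t)
    (g : H) : HasLeftDeriv d (fun s => γ s * g) (Ad d g⁻¹ v) t := by
  simpa using h.mul (hasLeftDeriv_const (d := d) g t)

variable [T2Space H]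

/-- Two curves with the same (constant) left velocity that meet are equal. -/
theorem eq_of_hasLeftDeriv {γ δ : ℝ → H} {v : Model d} (hγ : ∀ t, HasLeftDeriv d γ v t)
    (hδ : ∀ t, HasLeftDeriv d δ v t) {t₀ : ℝ} (h : γ t₀ = δ t₀) : γ = δ :=
  have : IsManifold (𝓡 d) 1 H := IsManifold.of_le (n := ∞) (by simp)
  isMIntegralCurve_Ioo_eq_of_contMDiff_boundaryless (I := 𝓡 d) (t₀ := t₀)
    (contMDiff_mulInvariantVectorField_one v) hγ hδ h

theorem exists_oneParameter (v : Model d) :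
    ∃ γ : ℝ → H, γ 0 = 1 ∧ ∀ t, HasLeftDeriv d γ v t := by
  have : IsManifold (𝓡 d) 1 H := IsManifold.of_le (n := ∞) (by simp)
  obtain ⟨γ, hγ0, hγ⟩ := exists_isMIntegralCurveAt_of_contMDiffAt_boundaryless (I := 𝓡 d) (t₀ := 0)
    (contMDiff_mulInvariantVectorField_one (d := d) (H := H) v).contMDiffAt (x₀ := (1 : H))
  obtain ⟨ε, hε, h⟩ := Metric.eventually_nhds_iff_ball.1 hγ
  -- Left translates of one local solution start at every point and all live for the same time `ε`,
  -- so the field is complete.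
  refine exists_isMIntegralCurve_of_isMIntegralCurveOn (I := 𝓡 d)
    (contMDiff_mulInvariantVectorField_one v) hε (fun x => ?_) 1
  refine ⟨fun t => x * γ t, by simp [hγ0], fun t ht => ?_⟩
  have h' : HasLeftDeriv d γ v t := h t (by simpa [Real.ball_eq_Ioo] using ht)
  exact HasMFDerivAt.hasMFDerivWithinAt (h'.const_mul x)

variable (H) in
/-- The one-parameter subgroup `t ↦ exp (t v)`. -/
noncomputable def oneParam (v : Model d) : ℝ → H := (exists_oneParameter v).choose

theorem oneParam_zero (v : Model d) : oneParam H v 0 = 1 := (exists_oneParameter v).choose_spec.1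

theorem hasLeftDeriv_oneParam (v : Model d) (t : ℝ) : HasLeftDeriv d (oneParam H v) v t :=
  (exists_oneParameter v).choose_spec.2 t

theorem continuous_oneParam (v : Model d) : Continuous (oneParam H v) :=
  continuous_iff_continuousAt.2 fun t => (hasLeftDeriv_oneParam v t).continuousAt

/-- Here and in the next two identities both sides have the same constant left velocity and agree at
time zero, so `eq_of_hasLeftDeriv` applies. -/
theorem oneParam_add (v : Model d) (s t : ℝ) :
    oneParam H v (s + t) = oneParam H v s * oneParam H v t := by
  have h := eq_of_hasLeftDeriv (d := d) (γ := fun t => oneParam H v (s + t))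
    (δ := fun t => oneParam H v s * oneParam H v t) (v := v) (fun t => by
      simpa using (hasLeftDeriv_oneParam (H := H) v (s + t)).comp ((hasDerivAt_id t).const_add s))
    (fun t => (hasLeftDeriv_oneParam v t).const_mul _) (t₀ := 0) (by simp [oneParam_zero])
  exact congrFun h t

theorem oneParam_smul (v : Model d) (c t : ℝ) : oneParam H (c • v) t = oneParam H v (c * t) := by
  have h := eq_of_hasLeftDeriv (d := d) (γ := oneParam H (c • v))
    (δ := fun t => oneParam H v (c * t)) (v := c • v) (hasLeftDeriv_oneParam _)
    (fun t => (hasLeftDeriv_oneParam v (c * t)).comp (by simpa using (hasDerivAt_id t).const_mul c))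
    (t₀ := 0) (by simp [oneParam_zero])
  exact congrFun h t

theorem conj_oneParam (g : H) (v : Model d) (t : ℝ) :
    g * oneParam H v t * g⁻¹ = oneParam H (Ad d g v) t := by
  have h := eq_of_hasLeftDeriv (d := d) (γ := fun t => g * oneParam H v t * g⁻¹)
    (δ := oneParam H (Ad d g v)) (v := Ad d g v)
    (fun t => by simpa using ((hasLeftDeriv_oneParam v t).const_mul g).mul_const g⁻¹)
    (hasLeftDeriv_oneParam _) (t₀ := 0) (by simp [oneParam_zero])
  exact congrFun h t

end LeftDerivative
end CptExt

/-! ### The differential of `ρ` and the Lie algebra of its kernel -/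

open scoped Matrix.Norms.Operator

namespace CptExt
section Differential

theorem hasDerivAt_matrix {n : Type*} [Fintype n] [DecidableEq n] {A : ℝ → Matrix n n ℝ}
    {B : Matrix n n ℝ} {t : ℝ} :
    HasDerivAt A B t ↔ ∀ i j, HasDerivAt (fun s => A s i j) (B i j) t :=
  Iff.trans hasDerivAt_pi (forall_congr' fun _ => hasDerivAt_pi)

theorem hasDerivAt_transpose {n : Type*} [Fintype n] [DecidableEq n] {A : ℝ → Matrix n n ℝ}
    {B : Matrix n n ℝ} {t : ℝ} (h : HasDerivAt A B t) :
    HasDerivAt (fun s => (A s).transpose) B.transpose t :=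
  hasDerivAt_matrix.2 fun i j => hasDerivAt_matrix.1 h j i

variable {d n : ℕ} {H : Type*} [Group H]

/-- The matrix of `ρ h`. -/
abbrev mat (ρ : H →* O n) (h : H) : Matrix (Fin n) (Fin n) ℝ := (ρ h : Matrix (Fin n) (Fin n) ℝ)

theorem mat_mul (ρ : H →* O n) (g h : H) : mat ρ (g * h) = mat ρ g * mat ρ h := by
  simp [mat]

theorem mat_one (ρ : H →* O n) : mat ρ 1 = 1 := by
  simp [mat]

theorem mat_mul_transpose (ρ : H →* O n) (g : H) : mat ρ g * (mat ρ g).transpose = 1 :=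
  (Matrix.mem_orthogonalGroup_iff (Fin n) ℝ).1 (ρ g).2

theorem mat_transpose_mul (ρ : H →* O n) (g : H) : (mat ρ g).transpose * mat ρ g = 1 :=
  (Matrix.mem_orthogonalGroup_iff' (Fin n) ℝ).1 (ρ g).2

theorem mat_inv (ρ : H →* O n) (g : H) : mat ρ g⁻¹ = (mat ρ g).transpose := by
  simp [mat, Matrix.star_eq_conjTranspose]

variable [TopologicalSpace H] [ChartedSpace (EuclideanSpace ℝ (Fin d)) H]

/-- The differential at the identity as a linear map. -/
noncomputable def dmap (ρ : H →* O n) : Model d →ₗ[ℝ] Matrix (Fin n) (Fin n) ℝ where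
  toFun v := differential (d := d) ρ v
  map_add' v w := by
    ext i j
    exact map_add (mfderiv (𝓡 d) 𝓘(ℝ, ℝ) (fun h => mat ρ h i j) 1 : Model d →L[ℝ] ℝ) v w
  map_smul' c v := by
    ext i j
    exact map_smul (mfderiv (𝓡 d) 𝓘(ℝ, ℝ) (fun h => mat ρ h i j) 1 : Model d →L[ℝ] ℝ) c v

variable {ρ : H →* O n}

theorem IsSmoothHom.mdifferentiable (hρ : IsSmoothHom d ρ) (i j : Fin n) :
    MDifferentiable (𝓡 d) 𝓘(ℝ, ℝ) (fun h => mat ρ h i j) :=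
  (hρ i j).mdifferentiable (by simp)

theorem IsSmoothHom.continuous (hρ : IsSmoothHom d ρ) : Continuous ρ :=
  Continuous.subtype_mk (continuous_pi fun i => continuous_pi fun j => (hρ i j).continuous) _

variable [LieGroup (𝓡 d) ∞ H]

/-- Translating the curve back to the identity splits off the constant factor `mat ρ (γ t)`, so the
derivative at `1` is enough. -/
theorem IsSmoothHom.hasDerivAt (hρ : IsSmoothHom d ρ) {γ : ℝ → H} {v : Model d} {t : ℝ}
    (h : HasLeftDeriv d γ v t) :
    HasDerivAt (fun s => mat ρ (γ s)) (mat ρ (γ t) * dmap (d := d) ρ v) t := by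
  have h1 := h.const_mul (γ t)⁻¹
  have h2 : HasDerivAt (fun s => mat ρ ((γ t)⁻¹ * γ s)) (dmap (d := d) ρ v) t := by
    refine hasDerivAt_matrix.2 fun i j => ?_
    refine (h1.hasDerivAt (hρ.mdifferentiable i j _)).congr_deriv ?_
    have h3 : ∀ y : H, y = 1 →
      (mfderiv (𝓡 d) 𝓘(ℝ, ℝ) (fun h => mat ρ h i j) y : Model d →L[ℝ] ℝ)
      (mulInvariantVectorField (I := 𝓡 d) (G := H) v y) = dmap (d := d) ρ v i j := by
      rintro _ rfl
      exact congrArg (mfderiv (𝓡 d) 𝓘(ℝ, ℝ) (fun h => mat ρ h i j) 1 :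
        Model d →L[ℝ] ℝ) (mulInvariantVectorField_one_apply v)
    exact h3 _ (inv_mul_cancel _)
  have h4 := h2.const_mul (mat ρ (γ t))
  have e : (fun s => mat ρ (γ s)) = fun s => mat ρ (γ t) * mat ρ ((γ t)⁻¹ * γ s) := by
    funext s; rw [← mat_mul, mul_inv_cancel_left]
  rw [e]
  exact h4

/-- Velocities of curves in the kernel are in the kernel of the differential. -/
theorem dmap_eq_zero_of_const (hρ : IsSmoothHom d ρ) {γ : ℝ → H} {v : Model d} {t : ℝ}
    (h : HasLeftDeriv d γ v t) (hγ : ∀ s, ρ (γ s) = ρ (γ t)) : dmap (d := d) ρ v = 0 := by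
  have h1 := hρ.hasDerivAt h
  simp only [mat, hγ] at h1
  have h2 := congrArg ((mat ρ (γ t)).transpose * ·) (h1.unique (hasDerivAt_const t _))
  simpa [← mul_assoc, mat_transpose_mul] using h2

variable [T2Space H]

theorem dmap_Ad (hρ : IsSmoothHom d ρ) (g : H) (v : Model d) :
    dmap (d := d) ρ (Ad d g v) = mat ρ g * dmap (d := d) ρ v * (mat ρ g).transpose := by
  have h1 := hρ.hasDerivAt (hasLeftDeriv_oneParam (H := H) v 0)
  have h2 := hρ.hasDerivAt (hasLeftDeriv_oneParam (H := H) (Ad d g v) 0)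
  have h3 := (h1.const_mul (mat ρ g)).mul_const (mat ρ g).transpose
  simp only [← mat_inv, ← mat_mul, ← mul_assoc, conj_oneParam] at h3
  rw [mat_inv] at h3
  simpa [oneParam_zero, mat_one, mul_assoc] using h2.unique h3

theorem dmap_skew (hρ : IsSmoothHom d ρ) (v : Model d) :
    (dmap (d := d) ρ v).transpose = - dmap (d := d) ρ v := by
  have h1 := hρ.hasDerivAt (hasLeftDeriv_oneParam (H := H) v 0)
  have h2 := h1.mul (hasDerivAt_transpose h1)
  have h3 : (fun s => mat ρ (oneParam H v s)) * (fun s => (mat ρ (oneParam H v s)).transpose) =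
    fun _ => 1 := funext fun s => mat_mul_transpose ρ _
  rw [h3] at h2
  have h4 := h2.unique (hasDerivAt_const 0 (1 : Matrix (Fin n) (Fin n) ℝ))
  simp [oneParam_zero, mat_one] at h4
  exact eq_neg_of_add_eq_zero_right h4

/-- Differentiate `dmap_Ad` along the one-parameter group of `v`: the left side yields the bracket,
the right side the commutator, since the image of `v` is skew. -/
theorem dmap_lie (hρ : IsSmoothHom d ρ) (v w : GroupLieAlgebra (𝓡 d) H) :
    dmap (d := d) ρ (⁅v, w⁆ : GroupLieAlgebra (𝓡 d) H) =
      dmap (d := d) ρ v * dmap (d := d) ρ w - dmap (d := d) ρ w * dmap (d := d) ρ v := by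
  have h0 := hasLeftDeriv_oneParam (H := H) v 0
  have h1 := hρ.hasDerivAt h0
  have h2 := (h1.mul_const (dmap (d := d) ρ w)).mul (hasDerivAt_transpose h1)
  have h3 : (fun s => mat ρ (oneParam H v s) * dmap (d := d) ρ w) *
      (fun s => (mat ρ (oneParam H v s)).transpose) =
      fun s => dmap (d := d) ρ (Ad d (oneParam H v s) w) := funext fun s => (dmap_Ad hρ _ _).symm
  rw [h3] at h2
  have h4 := (LinearMap.toContinuousLinearMap (dmap (d := d) ρ)).hasFDerivAt.comp_hasDerivAt 0
    (h0.hasDerivAt_Ad (oneParam_zero v) w)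
  have h5 := h4.unique h2
  have h6 : oneParam H v 0 = 1 := oneParam_zero v
  have h7 := dmap_skew hρ v
  rw [h6, mat_one, Matrix.transpose_one, one_mul, one_mul, mul_one, h7] at h5
  refine h5.trans ?_
  rw [mul_neg, sub_eq_add_neg]

theorem map_oneParam_eq_one (hρ : IsSmoothHom d ρ) {v : Model d} (hv : dmap (d := d) ρ v = 0)
    (t : ℝ) : ρ (oneParam H v t) = 1 := by
  have h : ∀ s, HasDerivAt (fun s => mat ρ (oneParam H v s)) 0 s := fun s => by
    simpa [hv] using hρ.hasDerivAt (hasLeftDeriv_oneParam (H := H) v s)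
  have h1 := is_const_of_deriv_eq_zero (fun s => (h s).differentiableAt) (fun s => (h s).deriv) t 0
  rw [oneParam_zero, mat_one] at h1
  exact Subtype.ext h1

/-- A curve inside the kernel has constant image, so the differential kills its velocity.
Conversely, if `v` is killed then `ρ` has zero derivative along the one-parameter group of `v`. -/
theorem mem_subgroupLieAlgebra_ker (hρ : IsSmoothHom d ρ) (v : GroupLieAlgebra (𝓡 d) H) :
    v ∈ subgroupLieAlgebra d ρ.ker ↔ dmap (d := d) ρ v = 0 := by
  constructor
  · rintro ⟨γ, h0, h1, h2⟩
    have h1' : HasLeftDeriv d γ v 0 := h1 0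
    exact dmap_eq_zero_of_const hρ h1' fun s => by
      rw [MonoidHom.mem_ker.1 (h2 s), MonoidHom.mem_ker.1 (h2 0)]
  · intro h
    exact ⟨oneParam H v, oneParam_zero v, hasLeftDeriv_oneParam v,
      fun t => MonoidHom.mem_ker.2 (map_oneParam_eq_one hρ h t)⟩
end Differential
end CptExt

/-! ### Skew matrices and locally constant functions -/

namespace CptExt

/-- A subspace has a complement that is orthogonal to it for a given definite form. -/
theorem isCompl_orthogonal_of_definite {V : Type*} [AddCommGroup V] [Module ℝ V]
    [FiniteDimensional ℝ V] (B : LinearMap.BilinForm ℝ V) (hB : B.IsRefl)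
    (hdef : ∀ v, B v v = 0 → v = 0) (W : Submodule ℝ V) : IsCompl W (B.orthogonal W) := by
  refine LinearMap.BilinForm.isCompl_orthogonal_of_restrict_nondegenerate hB
    ⟨fun x hx => ?_, fun x hx => ?_⟩
  · exact Subtype.ext (hdef _ (hx x))
  · exact Subtype.ext (hdef _ (hx x))

/-- The form `tr (X Yᵀ)` on matrices. -/
def traceForm (n : ℕ) : LinearMap.BilinForm ℝ (Matrix (Fin n) (Fin n) ℝ) :=
  LinearMap.mk₂ ℝ (fun X Y => (X * Y.transpose).trace) (by simp [add_mul]) (by simp)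
    (by simp [mul_add]) (by simp)

theorem traceForm_apply {n : ℕ} (X Y : Matrix (Fin n) (Fin n) ℝ) :
    traceForm n X Y = (X * Y.transpose).trace := rfl

theorem traceForm_comm {n : ℕ} (X Y : Matrix (Fin n) (Fin n) ℝ) :
    traceForm n X Y = traceForm n Y X := by
  rw [traceForm_apply, traceForm_apply, ← Matrix.trace_transpose, Matrix.transpose_mul,
    Matrix.transpose_transpose]

theorem traceForm_definite {n : ℕ} {X : Matrix (Fin n) (Fin n) ℝ} (h : traceForm n X X = 0) :
    X = 0 := by
  rw [traceForm_apply] at h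
  have := Matrix.trace_mul_conjTranspose_self_eq_zero_iff (A := X)
  simpa [Matrix.conjTranspose] using this.1 h

/-- For distinct `i, j, k`, the `(i, k)` entry of the commutator with the elementary rotation in the
`j, k` plane is `X i j` up to sign. The third index is where `n ≥ 3` enters. -/
theorem eq_zero_of_commute_skew {n : ℕ} (hn : 3 ≤ n) {X : Matrix (Fin n) (Fin n) ℝ}
    (hX : X.transpose = -X)
    (h : ∀ Z : Matrix (Fin n) (Fin n) ℝ, Z.transpose = -Z → Z * X = X * Z) : X = 0 := by
  ext i j
  by_cases hij : i = j
  · subst hij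
    have := congrFun (congrFun hX i) i
    simp at this ⊢
    linarith
  obtain ⟨k, hki, hkj⟩ : ∃ k : Fin n, k ≠ i ∧ k ≠ j := by
    have : ({i, j} : Finset (Fin n)).card < (Finset.univ : Finset (Fin n)).card := by
      rw [Finset.card_univ, Fintype.card_fin]
      exact lt_of_le_of_lt Finset.card_le_two (by omega)
    obtain ⟨k, -, hk⟩ := Finset.exists_mem_notMem_of_card_lt_card this
    simp at hk
    exact ⟨k, hk.1, hk.2⟩
  have h1 := congrFun (congrFun (h (Matrix.single j k 1 - Matrix.single k j 1) (by simp)) i) k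
  simp [Matrix.mul_apply, Matrix.single_apply, Ne.symm hij, hki, Ne.symm hkj] at h1
  simpa using h1.symm

theorem exp_skew_mem {n : ℕ} {Z : Matrix (Fin n) (Fin n) ℝ} (hZ : Z.transpose = -Z) :
    NormedSpace.exp Z ∈ Matrix.orthogonalGroup (Fin n) ℝ := by
  rw [Matrix.mem_orthogonalGroup_iff, ← Matrix.exp_transpose, hZ, ← Matrix.exp_add_of_commute _ _ (Commute.neg_right (Commute.refl Z)), add_neg_cancel,
    NormedSpace.exp_zero]

/-- The matrix is the square of the orthogonal matrix `exp (Z / 2)`, whose determinant squares to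
one. -/
theorem det_exp_skew {n : ℕ} {Z : Matrix (Fin n) (Fin n) ℝ} (hZ : Z.transpose = -Z) :
    (NormedSpace.exp Z).det = 1 := by
  have h2 : ((2 : ℝ)⁻¹ • Z).transpose = -((2 : ℝ)⁻¹ • Z) := by
    rw [Matrix.transpose_smul, hZ, smul_neg]
  have h : NormedSpace.exp Z = NormedSpace.exp ((2 : ℝ)⁻¹ • Z) * NormedSpace.exp ((2 : ℝ)⁻¹ • Z) := by
    rw [← Matrix.exp_add_of_commute _ _ (Commute.refl _), ← add_smul]
    norm_num
  have h3 := congrArg Matrix.det ((Matrix.mem_orthogonalGroup_iff (Fin n) ℝ).1 (exp_skew_mem h2))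
  rw [Matrix.det_mul, Matrix.det_transpose, Matrix.det_one] at h3
  rw [h, Matrix.det_mul]
  simpa using h3

section
variable {d n : ℕ} {H : Type*} [Group H] [TopologicalSpace H]
  [ChartedSpace (EuclideanSpace ℝ (Fin d)) H] [LieGroup (𝓡 d) ∞ H] {ρ : H →* O n}

theorem exists_mulInvariantVectorField_eq (x : H) (w : Model d) :
    ∃ v : Model d, (mulInvariantVectorField (I := 𝓡 d) (G := H) v x : Model d) = w := by
  let L : Model d →L[ℝ] Model d := mfderiv (𝓡 d) (𝓡 d) (x * ·) (1 : H)
  have hL : Function.Injective L.toLinearMap := by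
    intro v w h
    have h1 := mfderiv_mul_left_mulInvariantVectorField (d := d) x⁻¹ x v
    have h2 := mfderiv_mul_left_mulInvariantVectorField (d := d) x⁻¹ x w
    have h3 := h1.symm.trans ((congrArg (mfderiv (𝓡 d) (𝓡 d) (x⁻¹ * ·) x :
      Model d →L[ℝ] Model d) h).trans h2)
    have h4 : ∀ y : H, y = 1 → ∀ v : Model d,
        (mulInvariantVectorField (I := 𝓡 d) (G := H) v y : Model d) = v := by
      rintro _ rfl v
      exact mulInvariantVectorField_one_apply v
    exact (h4 _ (inv_mul_cancel x) v).symm.trans (h3.trans (h4 _ (inv_mul_cancel x) w))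
  exact LinearMap.injective_iff_surjective.1 hL w

/-- A function with zero derivative along all curves is locally constant. -/
theorem isLocallyConstant_of_hasLeftDeriv {f : H → ℝ} (hf : MDifferentiable (𝓡 d) 𝓘(ℝ, ℝ) f)
    (h : ∀ (γ : ℝ → H) (v : Model d) (t : ℝ), HasLeftDeriv d γ v t →
      HasDerivAt (fun s => f (γ s)) 0 t) : IsLocallyConstant f := by
  have : IsManifold (𝓡 d) 1 H := IsManifold.of_le (n := ∞) (by simp)
  rw [IsLocallyConstant.iff_eventually_eq]
  intro g
  set c := extChartAt (𝓡 d) g with hc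
  obtain ⟨r, hr, hball⟩ := Metric.isOpen_iff.1 (isOpen_extChartAt_target (I := 𝓡 d) g) (c g)
    (mem_extChartAt_target g)
  have hsymm : ∀ y ∈ Metric.ball (c g) r, MDifferentiableAt 𝓘(ℝ, Model d) (𝓡 d) c.symm y :=
    fun y hy => (mdifferentiableOn_extChartAt_symm (I := 𝓡 d) (x := g)).mdifferentiableAt
      ((isOpen_extChartAt_target (I := 𝓡 d) g).mem_nhds (hball hy))
  have hd : ∀ y ∈ Metric.ball (c g) r, DifferentiableAt ℝ (fun y => f (c.symm y)) y :=
    fun y hy => (MDifferentiableAt.comp (I' := 𝓡 d) y (hf _) (hsymm y hy)).differentiableAt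
  have hz : ∀ y ∈ Metric.ball (c g) r, fderiv ℝ (fun y => f (c.symm y)) y = 0 := by
    intro y hy
    ext u
    have hl : HasDerivAt (fun s : ℝ => y + s • u) u 0 := by
      simpa using ((hasDerivAt_id (0 : ℝ)).smul_const u).const_add y
    have hy0 : y + (0 : ℝ) • u = y := by simp
    have h1 : HasDerivAt (fun s : ℝ => f (c.symm (y + s • u)))
        (fderiv ℝ (fun y => f (c.symm y)) y u) 0 :=
      HasFDerivAt.comp_hasDerivAt (l := fun y => f (c.symm y)) 0
        (by rw [hy0]; exact (hd y hy).hasFDerivAt) hl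
    have h2 : MDifferentiableAt 𝓘(ℝ, ℝ) (𝓡 d) (fun s : ℝ => c.symm (y + s • u)) 0 :=
      MDifferentiableAt.comp (I' := 𝓘(ℝ, Model d)) (0 : ℝ) (g := c.symm)
        (f := fun s : ℝ => y + s • u) (by rw [hy0]; exact hsymm y hy)
        hl.differentiableAt.mdifferentiableAt
    obtain ⟨A, hA⟩ : ∃ A : ℝ →L[ℝ] Model d, A =
      mfderiv 𝓘(ℝ, ℝ) (𝓡 d) (fun s : ℝ => c.symm (y + s • u)) 0 := ⟨_, rfl⟩
    -- Every tangent vector is a left velocity, so the hypothesis applies to straight lines in the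
    -- chart.
    obtain ⟨v, hv⟩ := exists_mulInvariantVectorField_eq (d := d) (c.symm (y + (0 : ℝ) • u)) (A 1)
    have h3 : HasLeftDeriv d (fun s : ℝ => c.symm (y + s • u)) v 0 :=
      HasLeftDeriv.of_hasMFDerivAt (L := A) (by rw [hA]; exact h2.hasMFDerivAt) hv.symm
    exact h1.unique (h _ v 0 h3)
  have hconst : ∀ y ∈ Metric.ball (c g) r, f (c.symm y) = f g := by
    intro y hy
    have h1 := (convex_ball (c g) r).is_const_of_fderivWithin_eq_zero (𝕜 := ℝ)
      (f := fun y => f (c.symm y)) (fun y hy => (hd y hy).differentiableWithinAt)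
      (fun y hy => by rw [fderivWithin_of_isOpen Metric.isOpen_ball hy]; exact hz y hy) hy
      (Metric.mem_ball_self hr)
    rw [h1, c.left_inv (mem_extChartAt_source g)]
  have hcont : ContinuousAt c g := continuousAt_extChartAt (I := 𝓡 d) g
  filter_upwards [hcont.eventually (Metric.ball_mem_nhds (c g) hr),
    extChartAt_source_mem_nhds (I := 𝓡 d) g] with x hx hxs
  rw [← hconst _ hx, c.left_inv hxs]
end
end CptExt

/-! ### The differential maps onto the skew matrices -/

namespace CptExt

theorem continuous_real_const_of_finite {X : Type*} [TopologicalSpace X] [T1Space X] {f : ℝ → X}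
    (hf : Continuous f) {S : Set X} (hS : S.Finite) (h : ∀ t, f t ∈ S) (s t : ℝ) : f s = f t := by
  have : Finite S := hS
  exact congrArg Subtype.val (PreconnectedSpace.constant (f := fun t => (⟨f t, h t⟩ : S))
    inferInstance (hf.subtype_mk h) (x := s) (y := t))

/-- The derivative of a curve in a closed subspace lies in the subspace. -/
theorem mem_of_hasDerivAt {F : Type*} [NormedAddCommGroup F] [NormedSpace ℝ F]
    [FiniteDimensional ℝ F] (W : Submodule ℝ F) {f : ℝ → F} {f' : F} {t : ℝ}
    (hf : HasDerivAt f f' t) (h : ∀ s, f s ∈ W) : f' ∈ W :=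
  W.closed_of_finiteDimensional.mem_of_tendsto (hasDerivAt_iff_tendsto_slope.1 hf)
    (Eventually.of_forall fun s => W.smul_mem _ (W.sub_mem (h s) (h t)))

section
variable {d n : ℕ} {H : Type*} [Group H] {ρ : H →* O n}

theorem SO_le_range (himage : ρ.range = ⊤ ∨ ρ.range = SO n) : SO n ≤ ρ.range := by
  rcases himage with h | h <;> rw [h]
  exact le_top

theorem exists_mat_eq_exp (h : SO n ≤ ρ.range) {Z : Matrix (Fin n) (Fin n) ℝ}
    (hZ : Z.transpose = -Z) : ∃ g, mat ρ g = NormedSpace.exp Z := by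
  obtain ⟨g, hg⟩ := h (show (⟨_, exp_skew_mem hZ⟩ : O n) ∈ SO n from det_exp_skew hZ)
  exact ⟨g, congrArg Subtype.val hg⟩

theorem smul_skew {Z : Matrix (Fin n) (Fin n) ℝ} (hZ : Z.transpose = -Z) (t : ℝ) :
    (t • Z).transpose = -(t • Z) := by rw [Matrix.transpose_smul, hZ, smul_neg]

theorem hasDerivAt_exp_smul (Z : Matrix (Fin n) (Fin n) ℝ) :
    HasDerivAt (fun t : ℝ => NormedSpace.exp (t • Z)) Z 0 := by
  exact (hasDerivAt_exp_smul_const (𝕂 := ℝ) Z (0 : ℝ)).congr_deriv (by simp)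

variable [TopologicalSpace H] [ChartedSpace (EuclideanSpace ℝ (Fin d)) H] [LieGroup (𝓡 d) ∞ H]
  [CompactSpace H]

/-- A matrix entry function with zero derivative along all curves has finite range. -/
theorem finite_range_of_hasDerivAt_zero {F : H → Matrix (Fin n) (Fin n) ℝ}
    (hF : ∀ i j, MDifferentiable (𝓡 d) 𝓘(ℝ, ℝ) fun h => F h i j)
    (h : ∀ (γ : ℝ → H) (v : Model d) (t : ℝ), HasLeftDeriv d γ v t →
      HasDerivAt (fun s => F (γ s)) 0 t) : (Set.range F).Finite := by
  have h1 : IsLocallyConstant F := by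
    rw [IsLocallyConstant.iff_eventually_eq]
    intro g
    have h2 : ∀ i j, ∀ᶠ y in 𝓝 g, F y i j = F g i j := fun i j =>
      (IsLocallyConstant.iff_eventually_eq _).1 (isLocallyConstant_of_hasLeftDeriv (hF i j)
        fun γ v t hγ => hasDerivAt_matrix.1 (h γ v t hγ) i j) g
    filter_upwards [eventually_all.2 fun i => eventually_all.2 (h2 i)] with y hy
    ext i j
    exact hy i j
  -- Compactness of `H` enters here.
  exact h1.range_finite

variable [T2Space H]

/-- First `X` commutes with the range of the differential, by invariance of the trace form. Then `h
↦ ρ(h) X ρ(h)ᵀ` has zero derivative, hence finitely many values. The conjugates of `X` by `exp (t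
Z)` are among these values, so they are constant in `t`, and the derivative at zero gives the
commutator. -/
theorem commute_of_orthogonal_range (hρ : IsSmoothHom d ρ) (h : SO n ≤ ρ.range)
    {X : Matrix (Fin n) (Fin n) ℝ} (hX : X.transpose = -X)
    (hXV : ∀ v, traceForm n X (dmap (d := d) ρ v) = 0)
    {Z : Matrix (Fin n) (Fin n) ℝ} (hZ : Z.transpose = -Z) : Z * X = X * Z := by
  -- the range of the differential is an ideal
  have hid : ∀ (Z : Matrix (Fin n) (Fin n) ℝ) (v : Model d), Z.transpose = -Z →
      ∃ w, dmap (d := d) ρ w = Z * dmap (d := d) ρ v - dmap (d := d) ρ v * Z := by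
    intro Z v hZ
    have h1 : HasDerivAt (fun t : ℝ => NormedSpace.exp (t • Z) * dmap (d := d) ρ v *
        (NormedSpace.exp (t • Z)).transpose) (Z * dmap (d := d) ρ v - dmap (d := d) ρ v * Z) 0 := by
      have := ((hasDerivAt_exp_smul Z).mul_const (dmap (d := d) ρ v)).mul
        (hasDerivAt_transpose (hasDerivAt_exp_smul Z))
      refine this.congr_deriv ?_
      simp [hZ, sub_eq_add_neg]
    exact mem_of_hasDerivAt (LinearMap.range (dmap (d := d) ρ)) h1 fun t => by
      obtain ⟨g, hg⟩ := exists_mat_eq_exp h (smul_skew hZ t)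
      exact ⟨Ad d g v, by rw [dmap_Ad hρ, hg]⟩
  have hcomm : ∀ v, dmap (d := d) ρ v * X = X * dmap (d := d) ρ v := by
    intro v
    set U := dmap (d := d) ρ v with hU
    have hUs : U.transpose = -U := dmap_skew hρ v
    set C := X * U - U * X with hC
    have hCs : C.transpose = -C := by
      simp only [hC, Matrix.transpose_sub, Matrix.transpose_mul, hX, hUs]
      noncomm_ring
    -- Invariance of the trace form moves the bracket with `U` across: `⟨[X, U], C⟩` is up to sign
    -- `⟨X, [C, U]⟩`, and `[C, U]` lies in the range, to which `X` is orthogonal.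
    have h1 : traceForm n C C = 0 := by
      obtain ⟨w, hw⟩ := hid C v hCs
      have := hXV w
      rw [hw, traceForm_apply] at this
      rw [traceForm_apply, hCs]
      simp only [Matrix.transpose_sub, Matrix.transpose_mul, hCs, ← hU, hUs] at this
      have e1 : (X * (-U * -C)).trace = (X * U * C).trace := by rw [← mul_assoc]; simp
      have e2 : (X * (-C * -U)).trace = (U * X * C).trace := by
        rw [neg_mul_neg, ← mul_assoc, Matrix.trace_mul_cycle]
      rw [mul_sub, Matrix.trace_sub, e1, e2] at this
      rw [mul_neg, Matrix.trace_neg, neg_eq_zero]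
      conv_lhs => rw [hC]
      rw [← hC, sub_mul, Matrix.trace_sub]
      exact this
    have := traceForm_definite h1
    exact (sub_eq_zero.1 this).symm
  have hfin := finite_range_of_hasDerivAt_zero (d := d)
    (F := fun h : H => mat ρ h * X * (mat ρ h).transpose) (by
      intro i j
      simp only [Matrix.mul_apply, Matrix.transpose_apply]
      have hsum : ∀ f : Fin n → H → ℝ, (∀ k, ContMDiff (𝓡 d) 𝓘(ℝ, ℝ) ∞ (f k)) →
          ContMDiff (𝓡 d) 𝓘(ℝ, ℝ) ∞ fun h => ∑ k, f k h :=
        fun f hf => contMDiff_finsetSum fun k _ => hf k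
      exact (hsum _ fun k => (hsum _ fun l => (hρ i l).mul contMDiff_const).mul
        (hρ j k)).mdifferentiable (by simp)) (by
      intro γ v t hγ
      have h1 := hρ.hasDerivAt hγ
      refine ((h1.mul_const X).mul (hasDerivAt_transpose h1)).congr_deriv ?_
      have := hcomm v
      rw [Matrix.transpose_mul, dmap_skew hρ]
      simp only [mul_assoc]
      rw [← mul_assoc (dmap (d := d) ρ v), this]
      noncomm_ring)
  have hcont : Continuous fun t : ℝ => NormedSpace.exp (t • Z) * X *
      (NormedSpace.exp (t • Z)).transpose := by
    have : Continuous fun t : ℝ => NormedSpace.exp (t • Z) :=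
      (NormedSpace.exp_continuous (𝔸 := Matrix (Fin n) (Fin n) ℝ)).comp (by fun_prop)
    exact (this.mul continuous_const).mul this.matrix_transpose
  have hconst := continuous_real_const_of_finite hcont hfin fun t => by
    obtain ⟨g, hg⟩ := exists_mat_eq_exp h (smul_skew hZ t)
    exact ⟨g, by simp only [hg]⟩
  have h1 : HasDerivAt (fun t : ℝ => NormedSpace.exp (t • Z) * X *
      (NormedSpace.exp (t • Z)).transpose) (Z * X - X * Z) 0 := by
    have := ((hasDerivAt_exp_smul Z).mul_const X).mul
      (hasDerivAt_transpose (hasDerivAt_exp_smul Z))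
    refine this.congr_deriv ?_
    simp [hZ, sub_eq_add_neg]
  have h2 : HasDerivAt (fun t : ℝ => NormedSpace.exp (t • Z) * X *
      (NormedSpace.exp (t • Z)).transpose) 0 0 :=
    (hasDerivAt_const 0 _).congr_of_eventuallyEq (Eventually.of_forall fun t => hconst t 0)
  exact sub_eq_zero.1 (h1.unique h2)
end
end CptExt

open MeasureTheory

namespace CptExt

section
variable {d n : ℕ} {H : Type*} [Group H] {ρ : H →* O n}
  [TopologicalSpace H] [ChartedSpace (EuclideanSpace ℝ (Fin d)) H] [LieGroup (𝓡 d) ∞ H]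
  [CompactSpace H]

/-- Otherwise `ρ` would have finite image, which could not contain the nonconstant curve `exp (t
Z)`. -/
theorem exists_dmap_ne_zero (hρ : IsSmoothHom d ρ) (h : SO n ≤ ρ.range)
    {Z : Matrix (Fin n) (Fin n) ℝ} (hZ : Z.transpose = -Z) (hZ0 : Z ≠ 0) :
    ∃ v, dmap (d := d) ρ v ≠ 0 := by
  by_contra! hz
  have hfin := finite_range_of_hasDerivAt_zero (d := d) (F := fun h : H => mat ρ h)
    hρ.mdifferentiable (fun γ v t hγ => (hρ.hasDerivAt hγ).congr_deriv (by rw [hz, mul_zero]))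
  have hcont : Continuous fun t : ℝ => NormedSpace.exp (t • Z) :=
    (NormedSpace.exp_continuous (𝔸 := Matrix (Fin n) (Fin n) ℝ)).comp (by fun_prop)
  have hconst := continuous_real_const_of_finite hcont hfin fun t =>
    exists_mat_eq_exp h (smul_skew hZ t)
  exact hZ0 ((hasDerivAt_exp_smul Z).unique
    ((hasDerivAt_const 0 _).congr_of_eventuallyEq (Eventually.of_forall fun t => hconst t 0)))

variable [T2Space H]

/-- For `n ≥ 3` the part of `Y` orthogonal to the range commutes with all skew matrices, so it
vanishes. For `n ≤ 2` the skew matrices form at most a line, and one nonzero value suffices. -/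
theorem exists_dmap_eq (hρ : IsSmoothHom d ρ) (h : SO n ≤ ρ.range)
    {Y : Matrix (Fin n) (Fin n) ℝ} (hY : Y.transpose = -Y) : ∃ v, dmap (d := d) ρ v = Y := by
  by_cases hY0 : Y = 0
  · exact ⟨0, by rw [map_zero, hY0]⟩
  rcases le_or_gt 3 n with hn | hn
  · have hc := isCompl_orthogonal_of_definite (traceForm n)
      (fun X Y h => by rw [traceForm_comm, h]) (fun _ => traceForm_definite)
      (LinearMap.range (dmap (d := d) ρ))
    obtain ⟨_, ⟨v, rfl⟩, Y₂, hY₂, hs⟩ := Submodule.mem_sup.1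
      (show Y ∈ LinearMap.range (dmap (d := d) ρ) ⊔ _ by rw [hc.sup_eq_top]; trivial)
    have hsk : Y₂.transpose = -Y₂ := by
      rw [eq_sub_of_add_eq' hs, Matrix.transpose_sub, hY, dmap_skew hρ]
      abel
    have : Y₂ = 0 := eq_zero_of_commute_skew hn hsk fun Z hZ =>
      commute_of_orthogonal_range hρ h hsk (fun v => by
        rw [traceForm_comm]
        exact hY₂ _ ⟨v, rfl⟩) hZ
    exact ⟨v, by rw [← hs, this, add_zero]⟩
  · obtain ⟨v, hv⟩ := exists_dmap_ne_zero hρ h hY hY0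
    have key : ∀ X Y : Matrix (Fin n) (Fin n) ℝ, X.transpose = -X → Y.transpose = -Y → X ≠ 0 →
        ∃ c : ℝ, c • X = Y := by
      intro X Y hX hY hX0
      have e1 := fun i j => congrFun (congrFun hX i) j
      have e2 := fun i j => congrFun (congrFun hY i) j
      simp only [Matrix.transpose_apply, Matrix.neg_apply] at e1 e2
      have d1 : ∀ i, X i i = 0 := fun i => by linarith [e1 i i]
      have d2 : ∀ i, Y i i = 0 := fun i => by linarith [e2 i i]
      interval_cases n
      · exact (hX0 (Subsingleton.elim _ _)).elim
      · exact (hX0 (by ext i j; rw [Subsingleton.elim j i]; exact d1 i)).elim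
      · have : X 0 1 ≠ 0 := by
          intro h0
          apply hX0
          ext i j
          fin_cases i <;> fin_cases j <;> simp [d1, h0, e1 0 1]
        refine ⟨Y 0 1 / X 0 1, ?_⟩
        ext i j
        fin_cases i <;> fin_cases j <;> simp [d1, d2, e1 0 1, e2 0 1, this]
    obtain ⟨c, hc⟩ := key _ _ (dmap_skew hρ v) hY hv
    exact ⟨c • v, by rw [map_smul, hc]⟩
end

/-! ### An invariant inner product and the decomposition into ideals -/

section
variable {d n : ℕ} (d) (H : Type*) [Group H] [TopologicalSpace H]
  [ChartedSpace (EuclideanSpace ℝ (Fin d)) H] [LieGroup (𝓡 d) ∞ H] [CompactSpace H] [T2Space H]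

/-- The Lie algebra of a compact Lie group has an inner product invariant under `Ad`. -/
theorem exists_Ad_invariant_form : ∃ B : LinearMap.BilinForm ℝ (Model d), B.IsRefl ∧
    (∀ v, B v v = 0 → v = 0) ∧ ∀ (g : H) v w, B (Ad d g v) (Ad d g w) = B v w := by
  have := topologicalGroup_of_lieGroup (𝓡 d) ∞ (G := H)
  let _ : MeasurableSpace H := borel H
  have : BorelSpace H := ⟨rfl⟩
  let μ : Measure H := Measure.haar
  -- The inverse in `Ad d g⁻¹` makes left invariance of Haar measure the invariance that is needed.
  have hcont : ∀ v w : Model d, Continuous fun g : H => inner ℝ (Ad d g⁻¹ v) (Ad d g⁻¹ w) :=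
    fun v w => ((continuous_Ad v).comp continuous_inv).inner ((continuous_Ad w).comp continuous_inv)
  have hint : ∀ v w : Model d, Integrable (fun g : H => inner ℝ (Ad d g⁻¹ v) (Ad d g⁻¹ w)) μ :=
    fun v w => (hcont v w).integrable_of_hasCompactSupport (HasCompactSupport.of_compactSpace _)
  refine ⟨LinearMap.mk₂ ℝ (fun v w => ∫ g, inner ℝ (Ad d g⁻¹ v) (Ad d g⁻¹ w) ∂μ) ?_ ?_ ?_ ?_,
    ?_, ?_, ?_⟩
  · intro v v' w
    rw [← integral_add (hint _ _) (hint _ _)]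
    simp only [map_add, inner_add_left]
  · intro c v w
    rw [smul_eq_mul, ← integral_const_mul]
    simp only [map_smul, inner_smul_left, RCLike.conj_to_real]
  · intro v w w'
    rw [← integral_add (hint _ _) (hint _ _)]
    simp only [map_add, inner_add_right]
  · intro c v w
    rw [smul_eq_mul, ← integral_const_mul]
    simp only [map_smul, inner_smul_right]
  · intro v w h
    rw [← h]
    simp only [LinearMap.mk₂_apply, real_inner_comm]
  · intro v h
    by_contra hv
    -- The integrand is continuous and nonnegative, and positive at the identity.
    refine (ne_of_gt ((hcont v v).integral_pos_of_hasCompactSupport_nonneg_nonzero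
      (HasCompactSupport.of_compactSpace _) (fun _ => real_inner_self_nonneg) (x := 1) ?_)) h
    rw [inv_one, Ad_one]
    exact fun h => hv (inner_self_eq_zero.1 h)
  · intro g v w
    simp only [LinearMap.mk₂_apply]
    rw [← integral_mul_left_eq_self (fun h : H => inner ℝ (Ad d h⁻¹ v) (Ad d h⁻¹ w)) g⁻¹]
    simp only [mul_inv_rev, inv_inv, Ad_mul]

variable {H}

/-- A subspace invariant under `Ad` is an ideal. -/
def lieIdealOfInvariant (W : Submodule ℝ (Model d)) (hW : ∀ (g : H), ∀ w ∈ W, Ad d g w ∈ W) :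
    LieIdeal ℝ (GroupLieAlgebra (𝓡 d) H) where
  carrier := (W : Set (Model d))
  add_mem' := W.add_mem
  zero_mem' := W.zero_mem
  smul_mem' c _ := W.smul_mem c
  -- The bracket is the derivative at zero of `Ad (exp (t v)) w`, a curve in the closed subspace
  -- `W`.
  lie_mem {v w} hw := mem_of_hasDerivAt W
    ((hasLeftDeriv_oneParam (H := H) v 0).hasDerivAt_Ad (oneParam_zero (H := H) v) w)
    fun _ => hW _ w hw

end

section
variable {d n : ℕ} {H : Type*} [Group H] {ρ : H →* O n}
  [TopologicalSpace H] [ChartedSpace (EuclideanSpace ℝ (Fin d)) H] [LieGroup (𝓡 d) ∞ H]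
  [T2Space H]

theorem dmap_Ad_mem_ker (hρ : IsSmoothHom d ρ) (g : H) {v : Model d}
    (hv : v ∈ LinearMap.ker (dmap (d := d) ρ)) : Ad d g v ∈ LinearMap.ker (dmap (d := d) ρ) := by
  rw [LinearMap.mem_ker] at hv ⊢
  rw [dmap_Ad hρ, hv, mul_zero, zero_mul]

variable [CompactSpace H]

/-- The kernel of the differential has an `Ad`-invariant complement. -/
theorem exists_invariant_isCompl (hρ : IsSmoothHom d ρ) :
    ∃ W : Submodule ℝ (Model d), (∀ (g : H), ∀ w ∈ W, Ad d g w ∈ W) ∧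
      IsCompl W (LinearMap.ker (dmap (d := d) ρ)) := by
  obtain ⟨B, hB, hdef, hinv⟩ := exists_Ad_invariant_form d H
  refine ⟨B.orthogonal (LinearMap.ker (dmap (d := d) ρ)), fun g w hw k hk => ?_,
    (isCompl_orthogonal_of_definite B hB hdef _).symm⟩
  have h1 : k = Ad d g (Ad d g⁻¹ k) := by rw [← Ad_mul, mul_inv_cancel, Ad_one]
  change B k (Ad d g w) = 0
  rw [h1, hinv]
  refine hw _ ?_
  exact dmap_Ad_mem_ker hρ _ hk

/-- Kernel and complement are both `Ad`-invariant, hence ideals. On the complement the differential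
is injective by disjointness from the kernel, and it stays surjective because dropping the kernel
component changes no value. -/
theorem exists_ideal_decomposition (hρ : IsSmoothHom d ρ) (h : SO n ≤ ρ.range) :
    ∃ 𝔬' 𝔨 : LieIdeal ℝ (GroupLieAlgebra (𝓡 d) H),
      (𝔨 : Set (GroupLieAlgebra (𝓡 d) H)) = subgroupLieAlgebra d ρ.ker ∧
      IsCompl 𝔬' 𝔨 ∧
      ∃ e : 𝔬' ≃ₗ⁅ℝ⁆ LieAlgebra.Orthogonal.so (Fin n) ℝ,
        ∀ v : 𝔬', (e v : Matrix (Fin n) (Fin n) ℝ) =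
          differential ρ (v : GroupLieAlgebra (𝓡 d) H) := by
  obtain ⟨W, hW, hc⟩ := exists_invariant_isCompl hρ
  let 𝔬' := lieIdealOfInvariant d (H := H) W hW
  let 𝔨 := lieIdealOfInvariant d (H := H) (LinearMap.ker (dmap (d := d) ρ))
    fun g _ => dmap_Ad_mem_ker hρ g
  have hmem : ∀ v : Model d, dmap (d := d) ρ v ∈ LieAlgebra.Orthogonal.so (Fin n) ℝ := fun v =>
    (LieAlgebra.Orthogonal.mem_so _ _ _).2 (dmap_skew hρ v)
  let f : 𝔬' →ₗ⁅ℝ⁆ LieAlgebra.Orthogonal.so (Fin n) ℝ :=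
    { toFun := fun v => ⟨dmap (d := d) ρ v.1, hmem v.1⟩
      map_add' := fun v w => Subtype.ext (map_add (dmap (d := d) ρ) v.1 w.1)
      map_smul' := fun c v => Subtype.ext (map_smul (dmap (d := d) ρ) c v.1)
      map_lie' := fun {v w} => Subtype.ext (dmap_lie hρ v.1 w.1) }
  have hinj : Function.Injective f := by
    rw [injective_iff_map_eq_zero]
    intro v hv
    exact Subtype.ext ((Submodule.disjoint_def.1 hc.disjoint) v.1 v.2 (congrArg Subtype.val hv))
  have hsurj : Function.Surjective f := by
    intro Y
    obtain ⟨v, hv⟩ := exists_dmap_eq hρ h ((LieAlgebra.Orthogonal.mem_so _ _ _).1 Y.2)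
    obtain ⟨w, hw, k, hk, hwk⟩ := Submodule.mem_sup.1
      (show v ∈ W ⊔ LinearMap.ker (dmap (d := d) ρ) by rw [hc.sup_eq_top]; trivial)
    refine ⟨⟨w, hw⟩, Subtype.ext (Eq.trans ?_ hv)⟩
    rw [← hwk, map_add, LinearMap.mem_ker.1 hk, add_zero]
    rfl
  refine ⟨𝔬', 𝔨, ?_, ?_, LieEquiv.ofBijective f ⟨hinj, hsurj⟩, fun v => rfl⟩
  · ext v
    exact (mem_subgroupLieAlgebra_ker hρ v).symm
  · rw [← LieSubmodule.isCompl_toSubmodule]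
    exact hc
end
end CptExt

/-! ### Lifting one-parameter groups of rotations -/

namespace CptExt

/-- A lift of the one-parameter groups of rotations of `ℝⁿ` through `ρ`, equivariant under
conjugation by `H`. -/
structure RotationLift {n : ℕ} {H : Type*} [Group H] [TopologicalSpace H] (ρ : H →* O n) where
  toFun : Matrix (Fin n) (Fin n) ℝ → ℝ → H
  continuous : ∀ X, Continuous (toFun X)
  add : ∀ X s t, toFun X (s + t) = toFun X s * toFun X t
  neg : ∀ X t, X.transpose = -X → toFun (-X) t = toFun X (-t)
  conj : ∀ g X t, X.transpose = -X →
    g * toFun X t * g⁻¹ = toFun (mat ρ g * X * (mat ρ g).transpose) t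
  map : ∀ X t, X.transpose = -X → X * X * X = -X →
    mat ρ (toFun X t) = 1 + Real.sin t • X + (1 - Real.cos t) • (X * X)

variable {d n : ℕ} {H : Type*} [Group H] {ρ : H →* O n}
  [TopologicalSpace H] [ChartedSpace (EuclideanSpace ℝ (Fin d)) H] [LieGroup (𝓡 d) ∞ H]
  [T2Space H]

/-- Rodrigues' formula. By `X³ = -X`, the product of `mat ρ (oneParam H v t)` with the formula at
`-t` has zero derivative, and the formulas at `t` and `-t` are inverse to each other. -/
theorem mat_oneParam_of_cube (hρ : IsSmoothHom d ρ) {v : Model d} {X : Matrix (Fin n) (Fin n) ℝ}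
    (hv : dmap (d := d) ρ v = X) (hX3 : X * X * X = -X) (t : ℝ) :
    mat ρ (oneParam H v t) = 1 + Real.sin t • X + (1 - Real.cos t) • (X * X) := by
  have hP : ∀ t, HasDerivAt (fun t : ℝ => 1 - Real.sin t • X + (1 - Real.cos t) • (X * X))
      (-Real.cos t • X + Real.sin t • (X * X)) t := fun t => by
    have := (((Real.hasDerivAt_sin t).smul_const X).const_sub 1).add
      (((Real.hasDerivAt_cos t).const_sub 1).smul_const (X * X))
    exact this.congr_deriv (by rw [neg_neg, neg_smul])
  have h1 : ∀ t, HasDerivAt (fun t => mat ρ (oneParam H v t) *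
      (1 - Real.sin t • X + (1 - Real.cos t) • (X * X))) 0 t := fun t => by
    refine ((hρ.hasDerivAt (hasLeftDeriv_oneParam (H := H) v t)).mul (hP t)).congr_deriv ?_
    have h0 : X * (1 - Real.sin t • X + (1 - Real.cos t) • (X * X)) +
        (-Real.cos t • X + Real.sin t • (X * X)) = 0 := by
      simp only [mul_add, mul_sub, mul_smul_comm, mul_one, ← mul_assoc, hX3]
      module
    rw [hv, mul_assoc, ← mul_add, h0, mul_zero]
  have h2 : mat ρ (oneParam H v t) * (1 - Real.sin t • X + (1 - Real.cos t) • (X * X)) = 1 := by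
    have := is_const_of_deriv_eq_zero (fun t => (h1 t).differentiableAt) (fun t => (h1 t).deriv) t 0
    simpa [oneParam_zero, mat_one] using this
  have h3 : (1 - Real.sin t • X + (1 - Real.cos t) • (X * X)) *
      (1 + Real.sin t • X + (1 - Real.cos t) • (X * X)) = 1 := by
    simp only [mul_add, add_mul, sub_mul, mul_smul_comm, smul_mul_assoc, mul_one, one_mul,
      ← mul_assoc, hX3, neg_mul]
    have := Real.sin_sq_add_cos_sq t
    match_scalars <;> first | ring1 | linear_combination -this
  calc _ = mat ρ (oneParam H v t) * ((1 - Real.sin t • X + (1 - Real.cos t) • (X * X)) *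
        (1 + Real.sin t • X + (1 - Real.cos t) • (X * X))) := by rw [h3, mul_one]
    _ = _ := by rw [← mul_assoc, h2, one_mul]

variable [CompactSpace H]

/-- A skew matrix has exactly one preimage in the invariant complement `W`. Uniqueness makes the
preimage odd in `X` and turns conjugation of `X` by `ρ(g)` into `Ad g`; one-parameter groups carry
this over to `H`. -/
theorem exists_rotationLift (hρ : IsSmoothHom d ρ) (h : SO n ≤ ρ.range) :
    Nonempty (RotationLift ρ) := by
  obtain ⟨W, hW, hc⟩ := exists_invariant_isCompl hρ
  -- Stated for all matrices so that the choice is a total function; nothing is required of it when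
  -- `X` is not skew.
  have hex : ∀ X : Matrix (Fin n) (Fin n) ℝ, ∃ v : Model d, X.transpose = -X →
      v ∈ W ∧ dmap (d := d) ρ v = X := by
    intro X
    by_cases hX : X.transpose = -X
    · obtain ⟨v, hv⟩ := exists_dmap_eq hρ h hX
      obtain ⟨w, hw, k, hk, hwk⟩ := Submodule.mem_sup.1
        (show v ∈ W ⊔ LinearMap.ker (dmap (d := d) ρ) by rw [hc.sup_eq_top]; trivial)
      refine ⟨w, fun _ => ⟨hw, ?_⟩⟩
      rw [← hv, ← hwk, map_add, LinearMap.mem_ker.1 hk, add_zero]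
    · exact ⟨0, fun h => (hX h).elim⟩
  choose hat hhat using hex
  have huniq : ∀ {v w : Model d}, v ∈ W → w ∈ W → dmap (d := d) ρ v = dmap (d := d) ρ w → v = w :=
    fun hv hw h => sub_eq_zero.1 (Submodule.disjoint_def.1 hc.disjoint _ (W.sub_mem hv hw)
      (by rw [LinearMap.mem_ker, map_sub, h, sub_self]))
  have hneg : ∀ {X : Matrix (Fin n) (Fin n) ℝ}, X.transpose = -X → (-X).transpose = - -X :=
    fun hX => by rw [Matrix.transpose_neg, hX]
  refine ⟨⟨fun X => oneParam H (hat X), fun X => continuous_oneParam _,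
    fun X => oneParam_add _, fun X t hX => ?_, fun g X t hX => ?_, fun X t hX hX3 =>
      mat_oneParam_of_cube hρ (hhat X hX).2 hX3 t⟩⟩
  · have : hat (-X) = (-1 : ℝ) • hat X := huniq (hhat _ (hneg hX)).1 (W.smul_mem _ (hhat X hX).1)
      (by rw [map_smul, (hhat _ (hneg hX)).2, (hhat X hX).2, neg_one_smul])
    rw [this, oneParam_smul, neg_one_mul]
  · have hX' : (mat ρ g * X * (mat ρ g).transpose).transpose =
        -(mat ρ g * X * (mat ρ g).transpose) := by
      rw [Matrix.transpose_mul, Matrix.transpose_mul, Matrix.transpose_transpose, hX]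
      noncomm_ring
    have : Ad d g (hat X) = hat (mat ρ g * X * (mat ρ g).transpose) :=
      huniq (hW _ _ (hhat X hX).1) (hhat _ hX').1
        (by rw [dmap_Ad hρ, (hhat X hX).2, (hhat _ hX').2])
    rw [conj_oneParam, this]
end CptExt

/-! ### Orthonormal pairs, reflections and plane rotations -/

open Real

namespace CptExt

/-- Orthonormal pairs of vectors in `ℝⁿ`. -/
structure IsOrthoPair {n : ℕ} (u v : Fin n → ℝ) : Prop where
  left : u ⬝ᵥ u = 1
  right : v ⬝ᵥ v = 1
  orth : u ⬝ᵥ v = 0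

/-- The unit circle through `u` and `v`. -/
noncomputable def circ {n : ℕ} (u v : Fin n → ℝ) (x : ℝ) : Fin n → ℝ := cos x • u + sin x • v

/-- The infinitesimal rotation `u ∧ v`. -/
def wedge {n : ℕ} (u v : Fin n → ℝ) : Matrix (Fin n) (Fin n) ℝ :=
  Matrix.vecMulVec u v - Matrix.vecMulVec v u

/-- The reflection in the hyperplane orthogonal to the unit vector `a`. -/
def hyperRefl {n : ℕ} (a : Fin n → ℝ) : Matrix (Fin n) (Fin n) ℝ :=
  1 - (2 : ℝ) • Matrix.vecMulVec a a

variable {n : ℕ} {u v : Fin n → ℝ}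

theorem exists_cos_sin {x y : ℝ} (h : x ^ 2 + y ^ 2 = 1) : ∃ θ, cos θ = x ∧ sin θ = y := by
  have hn : ‖(⟨x, y⟩ : ℂ)‖ = 1 := by
    rw [Complex.norm_def, Complex.normSq_apply, ← sq, ← sq, h, sqrt_one]
  have h0 : (⟨x, y⟩ : ℂ) ≠ 0 := norm_ne_zero_iff.1 (by rw [hn]; exact one_ne_zero)
  exact ⟨Complex.arg ⟨x, y⟩, by rw [Complex.cos_arg h0, hn, div_one],
    by rw [Complex.sin_arg, hn, div_one]⟩

theorem IsOrthoPair.symm (h : IsOrthoPair u v) : IsOrthoPair v u :=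
  ⟨h.right, h.left, by rw [dotProduct_comm, h.orth]⟩

theorem IsOrthoPair.neg_right (h : IsOrthoPair u v) : IsOrthoPair u (-v) :=
  ⟨h.left, by simp [h.right], by simp [h.orth]⟩

theorem circ_zero (u v : Fin n → ℝ) : circ u v 0 = u := by simp [circ]

theorem circ_add_pi (u v : Fin n → ℝ) (x : ℝ) : circ u v (x + π) = -circ u v x := by
  simp only [circ, cos_add_pi, sin_add_pi]
  module

theorem circ_circ (u v : Fin n → ℝ) (x y : ℝ) :
    circ (circ u v x) (circ u v (x + π / 2)) y = circ u v (x + y) := by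
  simp only [circ, cos_add_pi_div_two, sin_add_pi_div_two]
  simp only [cos_add, sin_add]
  module

theorem IsOrthoPair.dot_circ (h : IsOrthoPair u v) (x y : ℝ) :
    circ u v x ⬝ᵥ circ u v y = cos (x - y) := by
  have := h.symm.orth
  simp only [circ, dotProduct_add, add_dotProduct, dotProduct_smul, smul_dotProduct, h.left,
    h.right, h.orth, this, smul_eq_mul, cos_sub]
  ring

theorem IsOrthoPair.unit_circ (h : IsOrthoPair u v) (x : ℝ) : circ u v x ⬝ᵥ circ u v x = 1 := by
  rw [h.dot_circ, sub_self, cos_zero]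

theorem IsOrthoPair.circ (h : IsOrthoPair u v) (x : ℝ) :
    IsOrthoPair (circ u v x) (circ u v (x + π / 2)) :=
  ⟨h.unit_circ _, h.unit_circ _, by rw [h.dot_circ, sub_add_cancel_left, cos_neg, cos_pi_div_two]⟩

theorem wedge_swap (u v : Fin n → ℝ) : wedge v u = -wedge u v := by simp [wedge]

theorem wedge_neg_right (u v : Fin n → ℝ) : wedge u (-v) = -wedge u v := by
  simp [wedge, Matrix.vecMulVec_neg, Matrix.neg_vecMulVec]
  abel

theorem wedge_skew (u v : Fin n → ℝ) : (wedge u v).transpose = -wedge u v := by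
  simp [wedge, Matrix.transpose_sub, Matrix.transpose_vecMulVec]

/-- The infinitesimal rotation depends only on the oriented plane, so the orthonormal pair may be
turned within it. -/
theorem wedge_circ (u v : Fin n → ℝ) (x : ℝ) :
    wedge (circ u v x) (circ u v (x + π / 2)) = wedge u v := by
  simp only [circ, cos_add_pi_div_two, sin_add_pi_div_two, wedge, Matrix.vecMulVec_add,
    Matrix.add_vecMulVec, Matrix.smul_vecMulVec, Matrix.vecMulVec_smul]
  have := sin_sq_add_cos_sq x
  match_scalars <;> first | ring1 | linear_combination this | linear_combination -this

theorem conj_wedge (A : Matrix (Fin n) (Fin n) ℝ) (u v : Fin n → ℝ) :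
    A * wedge u v * A.transpose = wedge (A.mulVec u) (A.mulVec v) := by
  simp only [wedge, mul_sub, sub_mul, Matrix.mul_vecMulVec, Matrix.vecMulVec_mul,
    Matrix.vecMul_transpose]

theorem IsOrthoPair.wedge_sq (h : IsOrthoPair u v) :
    wedge u v * wedge u v = -(Matrix.vecMulVec u u + Matrix.vecMulVec v v) := by
  simp only [wedge, mul_sub, sub_mul, Matrix.vecMulVec_mul_vecMulVec, h.left, h.right, h.orth,
    h.symm.orth, one_smul, zero_smul]
  simp
  abel

theorem IsOrthoPair.wedge_cube (h : IsOrthoPair u v) :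
    wedge u v * wedge u v * wedge u v = -wedge u v := by
  rw [h.wedge_sq]
  simp only [wedge, mul_sub, neg_mul, add_mul, Matrix.vecMulVec_mul_vecMulVec, h.left, h.right,
    h.orth, h.symm.orth, one_smul, zero_smul]
  simp
  abel

/-- Two reflections whose normals enclose the angle `x` compose to a rotation by `2 x`. The factor
two in the times given to `rot` comes from here. -/
theorem IsOrthoPair.hyperRefl_mul_circ (h : IsOrthoPair u v) (x : ℝ) :
    hyperRefl u * hyperRefl (CptExt.circ u v x) =
      1 + sin (2 * x) • wedge u v + (1 - cos (2 * x)) • (wedge u v * wedge u v) := by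
  rw [h.wedge_sq]
  have hd : u ⬝ᵥ CptExt.circ u v x = cos x := by
    have := h.dot_circ 0 x
    rwa [circ_zero, zero_sub, cos_neg] at this
  simp only [hyperRefl, mul_sub, sub_mul, one_mul, mul_one, smul_mul_assoc, mul_smul_comm,
    Matrix.vecMulVec_mul_vecMulVec, hd]
  simp only [CptExt.circ, wedge, Matrix.vecMulVec_add, Matrix.add_vecMulVec, Matrix.smul_vecMulVec,
    Matrix.vecMulVec_smul, sin_two_mul, cos_two_mul]
  have := sin_sq_add_cos_sq x
  match_scalars <;> first
    | ring1
    | linear_combination this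
    | linear_combination -2 * this

/-- Note the orientation: `wedge u v` sends `u` to `-v`, so positive times turn `u` away from `v`.
-/
theorem IsOrthoPair.rotation_left (h : IsOrthoPair u v) (t : ℝ) :
    (1 + sin t • wedge u v + (1 - cos t) • (wedge u v * wedge u v)).mulVec u =
      cos t • u - sin t • v := by
  rw [h.wedge_sq]
  simp only [wedge, Matrix.add_mulVec, Matrix.one_mulVec, Matrix.smul_mulVec, Matrix.sub_mulVec,
    Matrix.neg_mulVec, Matrix.vecMulVec_mulVec, h.left, h.symm.orth, op_smul_eq_smul]
  module

theorem IsOrthoPair.rotation_of_orth (h : IsOrthoPair u v) {w : Fin n → ℝ} (hu : u ⬝ᵥ w = 0)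
    (hv : v ⬝ᵥ w = 0) (t : ℝ) :
    (1 + sin t • wedge u v + (1 - cos t) • (wedge u v * wedge u v)).mulVec w = w := by
  rw [h.wedge_sq]
  simp [wedge, Matrix.add_mulVec, Matrix.smul_mulVec, Matrix.sub_mulVec, Matrix.neg_mulVec,
    Matrix.vecMulVec_mulVec, hu, hv]

theorem hyperRefl_mulVec (a w : Fin n → ℝ) : (hyperRefl a).mulVec w = w - (2 * (a ⬝ᵥ w)) • a := by
  simp only [hyperRefl, Matrix.sub_mulVec, Matrix.one_mulVec, Matrix.smul_mulVec,
    Matrix.vecMulVec_mulVec, op_smul_eq_smul, smul_smul]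

theorem exists_unit_smul {w : Fin n → ℝ} (h : w ≠ 0) :
    ∃ c : ℝ, 0 < c ∧ (c • w) ⬝ᵥ (c • w) = 1 ∧ c⁻¹ * c⁻¹ = w ⬝ᵥ w := by
  have h0 : 0 < w ⬝ᵥ w := lt_of_le_of_ne (Finset.sum_nonneg fun i _ => mul_self_nonneg _)
    (fun h1 => h (dotProduct_self_eq_zero.1 h1.symm))
  refine ⟨(sqrt (w ⬝ᵥ w))⁻¹, by positivity, ?_, by rw [inv_inv, mul_self_sqrt h0.le]⟩
  simp only [dotProduct_smul, smul_dotProduct, smul_eq_mul]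
  have := mul_self_sqrt h0.le
  field_simp
  linarith

theorem exists_circ_orth (u v a : Fin n → ℝ) : ∃ x, circ u v x ⬝ᵥ a = 0 := by
  by_cases h : u ⬝ᵥ a = 0
  · exact ⟨0, by rw [circ_zero, h]⟩
  · have h0 : 0 < (u ⬝ᵥ a) ^ 2 + (v ⬝ᵥ a) ^ 2 := by positivity
    have h1 := sq_sqrt h0.le
    have h2 : sqrt ((u ⬝ᵥ a) ^ 2 + (v ⬝ᵥ a) ^ 2) ≠ 0 := (sqrt_pos.2 h0).ne'
    obtain ⟨x, hc, hs⟩ := exists_cos_sin (x := (v ⬝ᵥ a) / sqrt ((u ⬝ᵥ a) ^ 2 + (v ⬝ᵥ a) ^ 2))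
      (y := -(u ⬝ᵥ a) / sqrt ((u ⬝ᵥ a) ^ 2 + (v ⬝ᵥ a) ^ 2)) (by
        rw [div_pow, div_pow, h1]
        field_simp
        ring)
    refine ⟨x, ?_⟩
    simp only [circ, add_dotProduct, smul_dotProduct, hc, hs, smul_eq_mul]
    ring

/-- Polar coordinates about a unit vector, within a subspace of dimension at least two. -/
theorem exists_polar (h : IsOrthoPair u v) (U : Submodule ℝ (Fin n → ℝ)) (hu : u ∈ U) (hv : v ∈ U)
    {a b : Fin n → ℝ} (ha : a ⬝ᵥ a = 1) (hb : b ⬝ᵥ b = 1) (haU : a ∈ U) (hbU : b ∈ U) :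
    ∃ w ∈ U, IsOrthoPair a w ∧ ∃ θ, b = circ a w θ := by
  -- If `b = ±a` the direction `w` is arbitrary, and the pair `u, v` supplies one in `U`. Otherwise
  -- `w` is the normalized component of `b` orthogonal to `a`.
  by_cases hw : b - (a ⬝ᵥ b) • a = 0
  · have hb' : b = (a ⬝ᵥ b) • a := sub_eq_zero.1 hw
    obtain ⟨x, hx⟩ := exists_circ_orth u v a
    refine ⟨circ u v x, U.add_mem (U.smul_mem _ hu) (U.smul_mem _ hv),
      ⟨ha, h.unit_circ x, by rw [dotProduct_comm, hx]⟩, ?_⟩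
    obtain ⟨θ, hc, hs⟩ := exists_cos_sin (x := a ⬝ᵥ b) (y := 0) (by
      rw [hb', dotProduct_smul, smul_dotProduct, ha] at hb
      simp only [smul_eq_mul] at hb
      linarith)
    exact ⟨θ, by rw [circ, hc, hs, zero_smul, add_zero, ← hb']⟩
  · obtain ⟨c, hc, hc1, hc2⟩ := exists_unit_smul hw
    refine ⟨c • (b - (a ⬝ᵥ b) • a), U.smul_mem _ (U.sub_mem hbU (U.smul_mem _ haU)),
      ⟨ha, hc1, by simp [dotProduct_sub, ha]⟩, ?_⟩
    obtain ⟨θ, h1, h2⟩ := exists_cos_sin (x := a ⬝ᵥ b) (y := c⁻¹) (by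
      have h3 := dotProduct_comm a b
      rw [sq c⁻¹, hc2]
      simp only [dotProduct_sub, sub_dotProduct, dotProduct_smul, smul_dotProduct, ha, hb,
        smul_eq_mul, h3]
      ring)
    refine ⟨θ, ?_⟩
    rw [circ, h1, h2, smul_smul, inv_mul_cancel₀ hc.ne', one_smul]
    abel

theorem exists_unit_orth (hn : 3 ≤ n) (a b : Fin n → ℝ) :
    ∃ w : Fin n → ℝ, w ⬝ᵥ w = 1 ∧ a ⬝ᵥ w = 0 ∧ b ⬝ᵥ w = 0 := by
  obtain ⟨w, hw, hw0⟩ := Submodule.exists_mem_ne_zero_of_ne_bot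
    (LinearMap.ker_ne_bot_of_finrank_lt (f := (Matrix.of ![a, b]).mulVecLin)
      (by simp only [Module.finrank_fin_fun]; omega))
  obtain ⟨c, hc, hc1, -⟩ := exists_unit_smul hw0
  have h0 := congrFun (LinearMap.mem_ker.1 hw) 0
  have h1 := congrFun (LinearMap.mem_ker.1 hw) 1
  simp only [Matrix.mulVecLin_apply, Matrix.mulVec, Matrix.of_apply, Matrix.cons_val_zero,
    Matrix.cons_val_one, Pi.zero_apply] at h0 h1
  exact ⟨c • w, hc1, by rw [dotProduct_smul, h0, smul_zero], by rw [dotProduct_smul, h1, smul_zero]⟩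

theorem exists_circ_eq (hn : 3 ≤ n) {a b : Fin n → ℝ} (ha : a ⬝ᵥ a = 1) (hb : b ⬝ᵥ b = 1) :
    ∃ v θ, IsOrthoPair a v ∧ b = circ a v θ := by
  obtain ⟨w, h1, h2, -⟩ := exists_unit_orth hn a a
  obtain ⟨v, -, hv, θ, h⟩ := exists_polar ⟨ha, h1, h2⟩ ⊤ trivial trivial ha hb trivial trivial
  exact ⟨v, θ, hv, h⟩
end CptExt

/-! ### Lifts to `H` of products of two reflections -/

namespace CptExt

variable {n : ℕ} {H : Type*} [Group H] {ρ : H →* O n}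

theorem mat_dot (g : H) (a b : Fin n → ℝ) :
    (mat ρ g).mulVec a ⬝ᵥ (mat ρ g).mulVec b = a ⬝ᵥ b := by
  rw [Matrix.dotProduct_mulVec, Matrix.vecMul_mulVec, mat_transpose_mul, Matrix.vecMul_one]

variable [TopologicalSpace H]

namespace RotationLift

variable (L : RotationLift ρ)

/-- The lift of the rotations in the plane of `u` and `v`. -/
def rot (u v : Fin n → ℝ) (t : ℝ) : H := L.toFun (wedge u v) t

theorem continuous_rot (u v : Fin n → ℝ) : Continuous (L.rot u v) := L.continuous _

theorem rot_add (u v : Fin n → ℝ) (s t : ℝ) : L.rot u v (s + t) = L.rot u v s * L.rot u v t :=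
  L.add _ s t

theorem rot_zero (u v : Fin n → ℝ) : L.rot u v 0 = 1 := by
  have := L.rot_add u v 0 0
  rwa [add_zero, left_eq_mul] at this

theorem rot_neg (u v : Fin n → ℝ) (t : ℝ) : L.rot u v (-t) = (L.rot u v t)⁻¹ := by
  rw [eq_inv_iff_mul_eq_one, ← rot_add, neg_add_cancel, rot_zero]

theorem rot_int_mul (u v : Fin n → ℝ) (t : ℝ) (m : ℤ) : L.rot u v (m * t) = L.rot u v t ^ m := by
  let F : Multiplicative ℝ →* H :=
    { toFun := fun t => L.rot u v t.toAdd
      map_one' := L.rot_zero u v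
      map_mul' := fun s t => L.rot_add u v _ _ }
  have := map_zpow F (Multiplicative.ofAdd t) m
  rwa [← ofAdd_zsmul, zsmul_eq_mul] at this

theorem rot_swap (u v : Fin n → ℝ) (t : ℝ) : L.rot v u t = L.rot u v (-t) := by
  rw [rot, rot, wedge_swap, L.neg _ _ (wedge_skew u v)]

theorem rot_neg_right (u v : Fin n → ℝ) (t : ℝ) : L.rot u (-v) t = L.rot u v (-t) := by
  rw [rot, rot, wedge_neg_right, L.neg _ _ (wedge_skew u v)]

theorem rot_circ (u v : Fin n → ℝ) (x t : ℝ) :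
    L.rot (circ u v x) (circ u v (x + π / 2)) t = L.rot u v t := by
  rw [rot, rot, wedge_circ]

theorem conj_rot (g : H) (u v : Fin n → ℝ) (t : ℝ) :
    g * L.rot u v t * g⁻¹ = L.rot ((mat ρ g).mulVec u) ((mat ρ g).mulVec v) t := by
  rw [rot, rot, L.conj _ _ _ (wedge_skew u v), conj_wedge]

theorem mat_rot {u v : Fin n → ℝ} (h : IsOrthoPair u v) (t : ℝ) : mat ρ (L.rot u v t) =
    1 + sin t • wedge u v + (1 - cos t) • (wedge u v * wedge u v) :=
  L.map _ _ (wedge_skew u v) h.wedge_cube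

/-- Equivariance under conjugation, applied to an element that `ρ` maps to `1`. -/
theorem commute_rot (u v : Fin n → ℝ) (t : ℝ) {k : H} (hk : k ∈ ρ.ker) :
    Commute (L.rot u v t) k := by
  have h := L.conj_rot k u v t
  rw [show mat ρ k = 1 from congrArg Subtype.val (MonoidHom.mem_ker.1 hk), Matrix.one_mulVec,
    Matrix.one_mulVec, mul_inv_eq_iff_eq_mul] at h
  exact h.symm

theorem rot_two_pi_mem {u v : Fin n → ℝ} (h : IsOrthoPair u v) : L.rot u v (2 * π) ∈ ρ.ker := by
  rw [MonoidHom.mem_ker]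
  apply Subtype.ext
  change mat ρ _ = 1
  rw [L.mat_rot h, sin_two_pi, cos_two_pi]
  simp

/-- A full turn lies in the kernel, so it commutes with all lifted rotations, while conjugation by
these moves its plane. -/
theorem rot_two_pi_rotate {u v u' v' : Fin n → ℝ} (h : IsOrthoPair u v) (t : ℝ) :
    L.rot ((mat ρ (L.rot u' v' t)).mulVec u) ((mat ρ (L.rot u' v' t)).mulVec v) (2 * π) =
      L.rot u v (2 * π) := by
  rw [← conj_rot, (L.commute_rot u' v' t (L.rot_two_pi_mem h)).eq, mul_inv_cancel_right]

/-- For `n ≥ 3` the hyperplane orthogonal to `u` has dimension at least two, so a rotation fixing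
`u` carries `v` to `v'`; the full turn does not notice. -/
theorem rot_two_pi_eq_right (hn : 3 ≤ n) {u v v' : Fin n → ℝ} (h : IsOrthoPair u v)
    (h' : IsOrthoPair u v') : L.rot u v (2 * π) = L.rot u v' (2 * π) := by
  obtain ⟨w₁, h1, h2, h3⟩ := exists_unit_orth hn u v
  let U : Submodule ℝ (Fin n → ℝ) := LinearMap.ker (dotProductBilin ℝ ℝ u)
  have hU : ∀ x, x ∈ U ↔ u ⬝ᵥ x = 0 := fun x => Iff.rfl
  obtain ⟨w, hwU, hw, θ, rfl⟩ := exists_polar ⟨h.right, h1, h3⟩ U ((hU _).2 h.orth) ((hU _).2 h2)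
    h.right h'.right ((hU _).2 h.orth) ((hU _).2 h'.orth)
  -- The time is `-θ` because of the orientation in `IsOrthoPair.rotation_left`.
  have := L.rot_two_pi_rotate (u' := v) (v' := w) h (-θ)
  rw [L.mat_rot hw, hw.rotation_left, hw.rotation_of_orth (by rw [dotProduct_comm, h.orth])
    (by rw [dotProduct_comm, (hU w).1 hwU]), cos_neg, sin_neg, neg_smul, sub_neg_eq_add] at this
  exact this.symm

/-- Replacing `v` by `-v` inverts the rotation but leaves the full turn unchanged. This reflects the
fundamental group of order two of the rotation group. -/
theorem rot_two_pi_inv (hn : 3 ≤ n) {u v : Fin n → ℝ} (h : IsOrthoPair u v) :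
    (L.rot u v (2 * π))⁻¹ = L.rot u v (2 * π) := by
  rw [L.rot_two_pi_eq_right hn h h.neg_right, rot_neg_right, rot_neg, inv_inv,
    ← L.rot_neg, ← rot_neg_right, L.rot_two_pi_eq_right hn h h.neg_right]

theorem rot_add_int_mul (hn : 3 ≤ n) {u v : Fin n → ℝ} (h : IsOrthoPair u v) (t : ℝ) (m : ℤ) :
    L.rot u v (t + 2 * (2 * m * π)) = L.rot u v t := by
  rw [rot_add, show 2 * (2 * (m : ℝ) * π) = ((2 * m : ℤ) : ℝ) * (2 * π) by push_cast; ring,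
    rot_int_mul, zpow_mul, zpow_two]
  nth_rw 1 [← L.rot_two_pi_inv hn h]
  rw [inv_mul_cancel, one_zpow, mul_one]

/-- This makes `pair` well defined. For `b ≠ ±a` the polar coordinates are unique up to `θ + 2 k π`,
which after doubling changes nothing, and up to replacing `(v, θ)` by `(-v, -θ)`. For `b = ±a` the
vector `v` is free, but only powers of a full turn occur. -/
theorem rot_eq_of_circ_eq (hn : 3 ≤ n) {a v v' : Fin n → ℝ} {x y : ℝ} (h : IsOrthoPair a v)
    (h' : IsOrthoPair a v') (he : circ a v x = circ a v' y) :
    L.rot a v (2 * x) = L.rot a v' (2 * y) := by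
  have hcos : cos x = cos y := by
    have := congrArg (a ⬝ᵥ ·) he
    simpa [circ, h.left, h.orth, h'.orth] using this
  have hsin : sin x • v = sin y • v' := by
    simpa [circ, hcos] using he
  have hz : ∀ m : ℤ, L.rot a v (2 * (m * π)) = L.rot a v' (2 * (m * π)) := fun m => by
    rw [show 2 * ((m : ℝ) * π) = (m : ℝ) * (2 * π) by ring, rot_int_mul, rot_int_mul,
      L.rot_two_pi_eq_right hn h h']
  by_cases hs : sin x = 0
  · have hs' : sin y = 0 := by
      have : cos y ^ 2 = 1 := by rw [← hcos, cos_sq', hs]; norm_num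
      rw [cos_sq'] at this
      nlinarith
    obtain ⟨m, rfl⟩ := sin_eq_zero_iff.1 hs
    rw [hz]
    rcases cos_eq_cos_iff.1 hcos with ⟨k, rfl | rfl⟩
    · rw [mul_add, add_comm, L.rot_add_int_mul hn h']
    · rw [sub_eq_neg_add, mul_add, L.rot_add_int_mul hn h',
        show 2 * -((m : ℝ) * π) = 2 * (m * π) + 2 * (2 * ((-m : ℤ) : ℝ) * π) by push_cast; ring,
        L.rot_add_int_mul hn h']
  · rcases cos_eq_cos_iff.1 hcos with ⟨k, rfl | rfl⟩
    · rw [add_comm, show 2 * (k : ℝ) * π = k * (2 * π) by ring, sin_add_int_mul_two_pi] at hsin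
      rw [smul_right_injective _ hs hsin, mul_add, add_comm, L.rot_add_int_mul hn h']
    · rw [sub_eq_neg_add, show 2 * (k : ℝ) * π = k * (2 * π) by ring, sin_add_int_mul_two_pi,
        sin_neg, neg_smul, ← smul_neg] at hsin
      rw [smul_right_injective _ hs hsin, sub_eq_neg_add, mul_add, L.rot_add_int_mul hn h',
        rot_neg_right, mul_neg]

theorem exists_pair (hn : 3 ≤ n) (a b : Fin n → ℝ) : ∃ x : H, ∀ v θ, IsOrthoPair a v →
    b = circ a v θ → x = L.rot a v (2 * θ) := by
  by_cases h : ∃ v θ, IsOrthoPair a v ∧ b = circ a v θ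
  · obtain ⟨v, θ, hv, hb⟩ := h
    exact ⟨L.rot a v (2 * θ), fun v' θ' hv' hb' => L.rot_eq_of_circ_eq hn hv hv' (hb ▸ hb')⟩
  -- A default value, which does not arise for unit vectors `a, b` by `exists_circ_eq`.
  · exact ⟨1, fun v θ hv hb => (h ⟨v, θ, hv, hb⟩).elim⟩

/-- The lift of the product of the reflections in `a` and `b`. -/
noncomputable def pair (hn : 3 ≤ n) (a b : Fin n → ℝ) : H := (L.exists_pair hn a b).choose

theorem pair_eq (hn : 3 ≤ n) {a v : Fin n → ℝ} (h : IsOrthoPair a v) (θ : ℝ) :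
    L.pair hn a (circ a v θ) = L.rot a v (2 * θ) :=
  (L.exists_pair hn a _).choose_spec v θ h rfl

theorem pair_circ (hn : 3 ≤ n) {u v : Fin n → ℝ} (h : IsOrthoPair u v) (x y : ℝ) :
    L.pair hn (circ u v x) (circ u v y) = L.rot u v (2 * (y - x)) := by
  have := L.pair_eq hn (h.circ x) (y - x)
  rwa [circ_circ, add_sub_cancel, rot_circ] at this

theorem pair_mul_circ (hn : 3 ≤ n) {u v : Fin n → ℝ} (h : IsOrthoPair u v) (x y z : ℝ) :
    L.pair hn (circ u v x) (circ u v y) * L.pair hn (circ u v y) (circ u v z) =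
      L.pair hn (circ u v x) (circ u v z) := by
  rw [L.pair_circ hn h, L.pair_circ hn h, L.pair_circ hn h, ← rot_add]
  ring_nf

theorem mat_pair (hn : 3 ≤ n) {a b : Fin n → ℝ} (ha : a ⬝ᵥ a = 1) (hb : b ⬝ᵥ b = 1) :
    mat ρ (L.pair hn a b) = hyperRefl a * hyperRefl b := by
  obtain ⟨v, θ, h, rfl⟩ := exists_circ_eq hn ha hb
  rw [L.pair_eq hn h, L.mat_rot h, h.hyperRefl_mul_circ]

theorem conj_pair (hn : 3 ≤ n) {a b : Fin n → ℝ} (ha : a ⬝ᵥ a = 1) (hb : b ⬝ᵥ b = 1) (g : H) :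
    g * L.pair hn a b * g⁻¹ = L.pair hn ((mat ρ g).mulVec a) ((mat ρ g).mulVec b) := by
  obtain ⟨v, θ, h, rfl⟩ := exists_circ_eq hn ha hb
  have h' : IsOrthoPair ((mat ρ g).mulVec a) ((mat ρ g).mulVec v) :=
    ⟨by rw [mat_dot, h.left], by rw [mat_dot, h.right], by rw [mat_dot, h.orth]⟩
  have := L.pair_eq hn h' θ
  rw [L.pair_eq hn h, conj_rot, ← this]
  simp only [circ, Matrix.mulVec_add, Matrix.mulVec_smul]

theorem pair_self (hn : 3 ≤ n) {a : Fin n → ℝ} (ha : a ⬝ᵥ a = 1) : L.pair hn a a = 1 := by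
  obtain ⟨v, θ, h, -⟩ := exists_circ_eq hn ha ha
  have := L.pair_circ hn h 0 0
  rwa [circ_zero, sub_self, mul_zero, rot_zero] at this

theorem pair_mul_swap (hn : 3 ≤ n) {a b : Fin n → ℝ} (ha : a ⬝ᵥ a = 1) (hb : b ⬝ᵥ b = 1) :
    L.pair hn a b * L.pair hn b a = 1 := by
  obtain ⟨v, θ, h, rfl⟩ := exists_circ_eq hn ha hb
  have := L.pair_mul_circ hn h 0 θ 0
  rwa [circ_zero, L.pair_self hn ha] at this

theorem commute_pair (hn : 3 ≤ n) {a b : Fin n → ℝ} (ha : a ⬝ᵥ a = 1) (hb : b ⬝ᵥ b = 1)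
    {k : H} (hk : k ∈ ρ.ker) : Commute (L.pair hn a b) k := by
  obtain ⟨v, θ, h, rfl⟩ := exists_circ_eq hn ha hb
  rw [L.pair_eq hn h]
  exact L.commute_rot a v _ hk

theorem pair_neg_neg (hn : 3 ≤ n) {a b : Fin n → ℝ} (ha : a ⬝ᵥ a = 1) (hb : b ⬝ᵥ b = 1) :
    L.pair hn (-a) (-b) = L.pair hn a b := by
  obtain ⟨v, θ, h, rfl⟩ := exists_circ_eq hn ha hb
  have h1 := L.pair_circ hn h (0 + π) (θ + π)
  have h2 := L.pair_circ hn h 0 θ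
  rw [circ_add_pi, circ_add_pi, circ_zero] at h1
  rw [circ_zero] at h2
  rw [h1, h2]
  ring_nf

/-- Let `m` be the midpoint of the arc from `b` to `c`. The defect `(a b)(b m)(m a)` lies in the
kernel, so it commutes with lifted rotations. The half turn `g` negates `m` and `a` and sends `b` to
`-c`; conjugation by it identifies the defect of `a, b, m` with that of `a, c, m`. As `m` is on the
arc, `(b m)(m c) = b c`, and the claim follows. -/
theorem pair_mul_of_isosceles (hn : 3 ≤ n) {a b c : Fin n → ℝ} (ha : a ⬝ᵥ a = 1) (hb : b ⬝ᵥ b = 1)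
    (hc : c ⬝ᵥ c = 1) (habc : a ⬝ᵥ b = a ⬝ᵥ c) :
    L.pair hn a b * L.pair hn b c = L.pair hn a c := by
  obtain ⟨w, θ, hw, rfl⟩ := exists_circ_eq hn hb hc
  set m := circ b w (θ / 2) with hm
  set u := circ b w (θ / 2 + π / 2) with hu
  have hmu : IsOrthoPair m u := hw.circ _
  have hb' : b = circ m u (-(θ / 2)) := by rw [hm, hu, circ_circ, add_neg_cancel, circ_zero]
  have hc' : circ b w θ = circ m u (θ / 2) := by rw [hm, hu, circ_circ, add_halves]
  by_cases hs : sin (θ / 2) = 0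
  · have : circ b w θ = b := by
      rw [hc', hb']
      simp only [circ, sin_neg, hs, cos_neg, neg_zero]
    rw [this, L.pair_self hn hb, mul_one]
  -- The hypothesis `habc` says that `a` lies in the mirror that exchanges `b` and `c`.
  have hau : u ⬝ᵥ a = 0 := by
    rw [hc', hb'] at habc
    simp only [circ, cos_neg, sin_neg, dotProduct_add, dotProduct_smul, smul_eq_mul] at habc
    rw [dotProduct_comm]
    have : sin (θ / 2) * (a ⬝ᵥ u) = 0 := by linarith
    exact (mul_eq_zero.1 this).resolve_left hs
  obtain ⟨w', h1, h2, h3⟩ := exists_unit_orth hn m u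
  let U : Submodule ℝ (Fin n → ℝ) := LinearMap.ker (dotProductBilin ℝ ℝ u)
  have hU : ∀ x, x ∈ U ↔ u ⬝ᵥ x = 0 := fun x => Iff.rfl
  obtain ⟨q, hqU, hq, α, hα⟩ := exists_polar (a := m) (b := a) ⟨hmu.left, h1, h2⟩ U
    ((hU _).2 hmu.symm.orth) ((hU _).2 h3) hmu.left ha ((hU _).2 hmu.symm.orth) ((hU _).2 hau)
  -- The plane of `m` and `q` contains `a` and is orthogonal to `u`, so `g` negates `m` and `a` and
  -- fixes `u`.
  set g := L.rot m q π with hg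
  have hgm : (mat ρ g).mulVec m = -m := by
    rw [hg, L.mat_rot hq, hq.rotation_left]
    simp
  have hgq : (mat ρ g).mulVec q = -q := by
    rw [hg, ← neg_neg π, ← rot_swap, L.mat_rot hq.symm, hq.symm.rotation_left]
    simp
  have hgu : (mat ρ g).mulVec u = u := by
    rw [hg, L.mat_rot hq, hq.rotation_of_orth hmu.orth (by rw [dotProduct_comm]; exact hqU)]
  have hga : (mat ρ g).mulVec a = -a := by
    rw [hα, circ, Matrix.mulVec_add, Matrix.mulVec_smul, Matrix.mulVec_smul, hgm, hgq]
    module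
  have hgb : (mat ρ g).mulVec b = -circ b w θ := by
    rw [hc', hb', circ, circ, Matrix.mulVec_add, Matrix.mulVec_smul, Matrix.mulVec_smul, hgm, hgu,
      cos_neg, sin_neg]
    module
  have hmm := hmu.left
  have hbc : L.pair hn b (circ b w θ) = L.pair hn b m * L.pair hn m (circ b w θ) := by
    have := L.pair_mul_circ hn hw 0 (θ / 2) θ
    rw [circ_zero] at this
    exact this.symm
  generalize circ b w θ = c at *
  clear_value m u g
  have hk : L.pair hn a b * L.pair hn b m * L.pair hn m a ∈ ρ.ker := by
    rw [MonoidHom.mem_ker]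
    apply Subtype.ext
    change mat ρ _ = 1
    have hr : ∀ {x : Fin n → ℝ}, x ⬝ᵥ x = 1 → hyperRefl x * hyperRefl x = 1 := fun {x} hx => by
      rw [← L.mat_pair hn hx hx, L.pair_self hn hx, mat_one]
    rw [mat_mul, mat_mul, L.mat_pair hn ha hb, L.mat_pair hn hb hmm, L.mat_pair hn hmm ha]
    calc _ = hyperRefl a * (hyperRefl b * hyperRefl b) * (hyperRefl m * hyperRefl m) *
          hyperRefl a := by simp only [mul_assoc]
      _ = 1 := by rw [hr hb, hr hmm, mul_one, mul_one, hr ha]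
  have hconj : g * (L.pair hn a b * L.pair hn b m * L.pair hn m a) * g⁻¹ =
      L.pair hn a c * L.pair hn c m * L.pair hn m a := by
    rw [← conj_mul, ← conj_mul, L.conj_pair hn ha hb, L.conj_pair hn hb hmm, L.conj_pair hn hmm ha,
      hga, hgb, hgm, L.pair_neg_neg hn ha hc, L.pair_neg_neg hn hc hmm, L.pair_neg_neg hn hmm ha]
  have hcomm : g * (L.pair hn a b * L.pair hn b m * L.pair hn m a) * g⁻¹ =
      L.pair hn a b * L.pair hn b m * L.pair hn m a := by
    rw [hg, (L.commute_rot m q π hk).eq, mul_inv_cancel_right]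
  have h := mul_right_cancel (hcomm.symm.trans hconj)
  rw [hbc, ← mul_assoc, h, mul_assoc, L.pair_mul_swap hn hc hmm, mul_one]

/-- The unit vector `o` is equidistant from `a`, `b` and `c`, so the relation reduces to three
isosceles triangles with apex `o`. -/
theorem pair_mul (hn : 3 ≤ n) {a b c : Fin n → ℝ} (ha : a ⬝ᵥ a = 1) (hb : b ⬝ᵥ b = 1)
    (hc : c ⬝ᵥ c = 1) : L.pair hn a b * L.pair hn b c = L.pair hn a c := by
  obtain ⟨o, ho, h1, h2⟩ := exists_unit_orth hn (a - b) (b - c)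
  rw [sub_dotProduct, sub_eq_zero, dotProduct_comm, dotProduct_comm b] at h1
  rw [sub_dotProduct, sub_eq_zero, dotProduct_comm, dotProduct_comm c] at h2
  refine mul_left_cancel (a := L.pair hn o a) ?_
  rw [← mul_assoc, L.pair_mul_of_isosceles hn ho ha hb h1, L.pair_mul_of_isosceles hn ho hb hc h2,
    L.pair_mul_of_isosceles hn ho ha hc (h1.trans h2)]

end RotationLift
end CptExt

/-! ### Groups generated by lifted products of two reflections -/

open scoped Pointwise

namespace CptExt

variable {n : ℕ} {G : Type*} [Group G]

/-- A group over `O_n` with lifts of the products of two reflections that behave as in the spin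
group. -/
structure ReflectionPairing (r : G →* O n) where
  pair : (Fin n → ℝ) → (Fin n → ℝ) → G
  mul : ∀ a b c, a ⬝ᵥ a = 1 → b ⬝ᵥ b = 1 → c ⬝ᵥ c = 1 → pair a b * pair b c = pair a c
  map : ∀ a b, a ⬝ᵥ a = 1 → b ⬝ᵥ b = 1 → mat r (pair a b) = hyperRefl a * hyperRefl b
  rotate : ∀ u v, IsOrthoPair u v → ∀ x y c,
    pair (circ u v (x + c)) (circ u v (y + c)) = pair (circ u v x) (circ u v y)

/-- The span of the first `m` coordinate vectors. -/
def coordSpan (n m : ℕ) : Submodule ℝ (Fin n → ℝ) where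
  carrier := {v | ∀ i : Fin n, m ≤ i → v i = 0}
  zero_mem' := fun _ _ => rfl
  add_mem' := fun ha hb i hi => by simp [ha i hi, hb i hi]
  smul_mem' := fun c a ha i hi => by simp [ha i hi]

/-- A standard basis vector of `ℝⁿ`. -/
abbrev basisVec (i : Fin n) : Fin n → ℝ := Pi.single i 1

theorem basisVec_dot (i : Fin n) : basisVec i ⬝ᵥ basisVec i = 1 := by simp

theorem basisVec_mem {m : ℕ} (i : Fin n) (h : (i : ℕ) < m) : basisVec i ∈ coordSpan n m :=
  fun j hj => Pi.single_eq_of_ne (by rintro rfl; omega) _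

theorem basisVec_orthoPair {i j : Fin n} (h : i ≠ j) : IsOrthoPair (basisVec i) (basisVec j) :=
  ⟨basisVec_dot i, basisVec_dot j, by simp [h]⟩

theorem dot_basisVec_eq_zero {m : ℕ} {v : Fin n → ℝ} (hv : v ∈ coordSpan n m) {i : Fin n}
    (hi : m ≤ i) : v ⬝ᵥ basisVec i = 0 := by simpa using hv i hi

theorem mem_coordSpan_of_dot {m : ℕ} {v : Fin n → ℝ} {i : Fin n} (hv : v ∈ coordSpan n (i + 1))
    (h : v ⬝ᵥ basisVec i = 0) (hi : (i : ℕ) = m) : v ∈ coordSpan n m := by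
  intro j hj
  rcases eq_or_ne j i with rfl | hne
  · simpa using h
  · exact hv j (by have := Fin.val_ne_of_ne hne; omega)

theorem coordSpan_mono {m k : ℕ} (h : m ≤ k) : coordSpan n m ≤ coordSpan n k :=
  fun _ hv i hi => hv i (h.trans hi)

theorem circ_mem {U : Submodule ℝ (Fin n → ℝ)} {u v : Fin n → ℝ} (hu : u ∈ U) (hv : v ∈ U) (x : ℝ) :
    circ u v x ∈ U := U.add_mem (U.smul_mem _ hu) (U.smul_mem _ hv)

namespace ReflectionPairing

variable {r : G →* O n} (P : ReflectionPairing r)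

theorem pair_self {a : Fin n → ℝ} (ha : a ⬝ᵥ a = 1) : P.pair a a = 1 := by
  have := P.mul a a a ha ha ha
  rwa [mul_eq_left] at this

theorem pair_inv {a b : Fin n → ℝ} (ha : a ⬝ᵥ a = 1) (hb : b ⬝ᵥ b = 1) :
    (P.pair a b)⁻¹ = P.pair b a := by
  rw [inv_eq_iff_mul_eq_one, P.mul _ _ _ ha hb ha, P.pair_self ha]

theorem pair_circ_eq {u v : Fin n → ℝ} (h : IsOrthoPair u v) {x y x' y' : ℝ} (hxy : y - x = y' - x') :
    P.pair (circ u v x) (circ u v y) = P.pair (circ u v x') (circ u v y') := by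
  rw [← P.rotate u v h x y (x' - x)]
  congr 2 <;> linarith

/-- The subgroup generated by the pairs of unit vectors in the span of the first `m` coordinate
vectors. -/
def subgroup (m : ℕ) : Subgroup G := Subgroup.closure
  {g | ∃ a ∈ coordSpan n m, ∃ b ∈ coordSpan n m, a ⬝ᵥ a = 1 ∧ b ⬝ᵥ b = 1 ∧ P.pair a b = g}

theorem pair_mem {m : ℕ} {a b : Fin n → ℝ} (ha : a ∈ coordSpan n m) (hb : b ∈ coordSpan n m)
    (ha1 : a ⬝ᵥ a = 1) (hb1 : b ⬝ᵥ b = 1) : P.pair a b ∈ P.subgroup m :=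
  Subgroup.subset_closure ⟨a, ha, b, hb, ha1, hb1, rfl⟩

theorem subgroup_mono {m k : ℕ} (h : m ≤ k) : P.subgroup m ≤ P.subgroup k :=
  Subgroup.closure_mono fun _ ⟨a, ha, b, hb, h'⟩ =>
    ⟨a, coordSpan_mono h ha, b, coordSpan_mono h hb, h'⟩

theorem map_mulVec_mem {m : ℕ} {g : G} (hg : g ∈ P.subgroup m) :
    ∀ v ∈ coordSpan n m, (mat r g).mulVec v ∈ coordSpan n m := by
  have key : ∀ a ∈ coordSpan n m, ∀ b ∈ coordSpan n m, a ⬝ᵥ a = 1 → b ⬝ᵥ b = 1 →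
      ∀ v ∈ coordSpan n m, (mat r (P.pair a b)).mulVec v ∈ coordSpan n m := by
    intro a ha b hb ha1 hb1 v hv
    rw [P.map a b ha1 hb1, ← Matrix.mulVec_mulVec, hyperRefl_mulVec, hyperRefl_mulVec]
    exact Submodule.sub_mem _ (Submodule.sub_mem _ hv (Submodule.smul_mem _ _ hb))
      (Submodule.smul_mem _ _ ha)
  induction hg using Subgroup.closure_induction_left with
  | one => intro v hv; rwa [mat_one, Matrix.one_mulVec]
  | mul_left x hx y _ ih =>
    obtain ⟨a, ha, b, hb, ha1, hb1, rfl⟩ := hx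
    intro v hv
    rw [mat_mul, ← Matrix.mulVec_mulVec]
    exact key a ha b hb ha1 hb1 _ (ih v hv)
  | inv_mul_cancel x hx y _ ih =>
    obtain ⟨a, ha, b, hb, ha1, hb1, rfl⟩ := hx
    intro v hv
    rw [mat_mul, ← Matrix.mulVec_mulVec, P.pair_inv ha1 hb1]
    exact key b hb a ha hb1 ha1 _ (ih v hv)

theorem map_mulVec_eq {m : ℕ} {g : G} (hg : g ∈ P.subgroup m) {w : Fin n → ℝ}
    (hw : ∀ a ∈ coordSpan n m, a ⬝ᵥ w = 0) : (mat r g).mulVec w = w := by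
  have key : ∀ a ∈ coordSpan n m, ∀ b ∈ coordSpan n m, a ⬝ᵥ a = 1 → b ⬝ᵥ b = 1 →
      (mat r (P.pair a b)).mulVec w = w := by
    intro a ha b hb ha1 hb1
    rw [P.map a b ha1 hb1, ← Matrix.mulVec_mulVec, hyperRefl_mulVec b, hw b hb, mul_zero, zero_smul,
      sub_zero, hyperRefl_mulVec, hw a ha, mul_zero, zero_smul, sub_zero]
  induction hg using Subgroup.closure_induction_left with
  | one => rw [mat_one, Matrix.one_mulVec]
  | mul_left x hx y _ ih =>
    obtain ⟨a, ha, b, hb, ha1, hb1, rfl⟩ := hx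
    rw [mat_mul, ← Matrix.mulVec_mulVec, ih, key a ha b hb ha1 hb1]
  | inv_mul_cancel x hx y _ ih =>
    obtain ⟨a, ha, b, hb, ha1, hb1, rfl⟩ := hx
    rw [mat_mul, ← Matrix.mulVec_mulVec, ih, P.pair_inv ha1 hb1, key b hb a ha hb1 ha1]

section
variable {m : ℕ}

theorem zero_ne_of_pos (hm0 : 0 < m) (hm : m < n) :
    (⟨0, hm0.trans hm⟩ : Fin n) ≠ ⟨m, hm⟩ := by
  intro h
  have := congrArg Fin.val h
  simp at this
  omega

/-- Sliding the pair along the great circle through `x` and the first basis vector moves that basis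
vector from one slot to the other. -/
theorem exists_pair_comm (hm0 : 0 < m) (hm : m < n) {x : Fin n → ℝ} (hx : x ∈ coordSpan n (m + 1))
    (hx1 : x ⬝ᵥ x = 1) : ∃ y ∈ coordSpan n (m + 1), y ⬝ᵥ y = 1 ∧
      P.pair x (basisVec ⟨0, hm0.trans hm⟩) = P.pair (basisVec ⟨0, hm0.trans hm⟩) y ∧
      P.pair (basisVec ⟨0, hm0.trans hm⟩) x = P.pair y (basisVec ⟨0, hm0.trans hm⟩) := by
  have h0 : basisVec (⟨0, hm0.trans hm⟩ : Fin n) ∈ coordSpan n (m + 1) :=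
    basisVec_mem _ (by simp)
  obtain ⟨w, hw, hp, θ, rfl⟩ := exists_polar (basisVec_orthoPair (zero_ne_of_pos hm0 hm))
    (coordSpan n (m + 1)) h0 (basisVec_mem _ (by simp)) (basisVec_dot ⟨0, hm0.trans hm⟩) hx1 h0 hx
  refine ⟨circ _ w (-θ), circ_mem h0 hw _, hp.unit_circ _, ?_, ?_⟩
  · have := P.pair_circ_eq hp (x := θ) (y := 0) (x' := 0) (y' := -θ) (by ring)
    rwa [circ_zero] at this
  · have := P.pair_circ_eq hp (x := 0) (y := θ) (x' := -θ) (y' := 0) (by ring)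
    rwa [circ_zero] at this

/-- A normal form. Elements of this shape include `1` and are stable under left multiplication by
the generators: `(p e)(x e) = (p e)(e y) = p y`, and `p y` slides along its circle until the second
vector loses its last coordinate. The rest is then absorbed into the smaller subgroup. -/
theorem exists_eq_pair_mul (hm0 : 0 < m) (hm : m < n) {g : G} (hg : g ∈ P.subgroup (m + 1)) :
    ∃ x ∈ coordSpan n (m + 1), x ⬝ᵥ x = 1 ∧ ∃ h ∈ P.subgroup m,
      g = P.pair x (basisVec ⟨0, hm0.trans hm⟩) * h := by
  set e : Fin n → ℝ := basisVec ⟨0, hm0.trans hm⟩ with he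
  have h0 : e ∈ coordSpan n m := basisVec_mem _ hm0
  have h0' : e ∈ coordSpan n (m + 1) := coordSpan_mono (Nat.le_succ m) h0
  have he1 : e ⬝ᵥ e = 1 := basisVec_dot _
  have step : ∀ p ∈ coordSpan n (m + 1), p ⬝ᵥ p = 1 → ∀ g : G,
      (∃ x ∈ coordSpan n (m + 1), x ⬝ᵥ x = 1 ∧ ∃ h ∈ P.subgroup m, g = P.pair x e * h) →
      ∃ x ∈ coordSpan n (m + 1), x ⬝ᵥ x = 1 ∧ ∃ h ∈ P.subgroup m,
        P.pair p e * g = P.pair x e * h := by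
    rintro p hp hp1 _ ⟨x, hx, hx1, h, hh, rfl⟩
    obtain ⟨y, hy, hy1, hxy, -⟩ := P.exists_pair_comm hm0 hm hx hx1
    obtain ⟨w, hw, hpw, θ, rfl⟩ := exists_polar (basisVec_orthoPair (zero_ne_of_pos hm0 hm))
      (coordSpan n (m + 1)) h0' (basisVec_mem _ (by simp)) hp1 hy1 hp hy
    -- Every great circle meets the hyperplane where the last coordinate vanishes.
    obtain ⟨c, hc⟩ := exists_circ_orth p w (basisVec ⟨m, hm⟩)
    have hcm : circ p w c ∈ coordSpan n m :=
      mem_coordSpan_of_dot (i := ⟨m, hm⟩) (circ_mem hp hw c) hc rfl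
    refine ⟨circ p w (c - θ), circ_mem hp hw _, hpw.unit_circ _, P.pair e (circ p w c) * h,
      mul_mem (P.pair_mem h0 hcm he1 (hpw.unit_circ _)) hh, ?_⟩
    have := P.pair_circ_eq hpw (x := 0) (y := θ) (x' := c - θ) (y' := c) (by ring)
    rw [circ_zero] at this
    rw [← mul_assoc, ← mul_assoc, P.mul _ _ _ (hpw.unit_circ _) he1 (hpw.unit_circ _), ← this,
      hxy, P.mul _ _ _ hp1 he1 hy1]
  have step' : ∀ p ∈ coordSpan n (m + 1), p ⬝ᵥ p = 1 → ∀ q ∈ coordSpan n (m + 1), q ⬝ᵥ q = 1 →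
      ∀ g : G, (∃ x ∈ coordSpan n (m + 1), x ⬝ᵥ x = 1 ∧ ∃ h ∈ P.subgroup m, g = P.pair x e * h) →
      ∃ x ∈ coordSpan n (m + 1), x ⬝ᵥ x = 1 ∧ ∃ h ∈ P.subgroup m,
        P.pair p q * g = P.pair x e * h := by
    intro p hp hp1 q hq hq1 g hg
    obtain ⟨y, hy, hy1, -, hqy⟩ := P.exists_pair_comm hm0 hm hq hq1
    rw [← P.mul _ _ _ hp1 he1 hq1, hqy, mul_assoc]
    exact step p hp hp1 _ (step y hy hy1 _ hg)
  induction hg using Subgroup.closure_induction_left with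
  | one => exact ⟨e, h0', he1, 1, one_mem _, by rw [P.pair_self he1, mul_one]⟩
  | mul_left x hx y _ ih =>
    obtain ⟨a, ha, b, hb, ha1, hb1, rfl⟩ := hx
    exact step' a ha ha1 b hb hb1 _ ih
  | inv_mul_cancel x hx y _ ih =>
    obtain ⟨a, ha, b, hb, ha1, hb1, rfl⟩ := hx
    rw [P.pair_inv ha1 hb1]
    exact step' b hb hb1 a ha ha1 _ ih

/-- In the normal form, `h` and the reflection in the first basis vector fix the last one, so the
reflection in `x` must fix it too, which forces `x` into the smaller span. -/
theorem mem_subgroup_of_fix (hm0 : 0 < m) (hm : m < n) {g : G} (hg : g ∈ P.subgroup (m + 1))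
    (hfix : (mat r g).mulVec (basisVec ⟨m, hm⟩) = basisVec ⟨m, hm⟩) : g ∈ P.subgroup m := by
  obtain ⟨x, hx, hx1, h, hh, rfl⟩ := P.exists_eq_pair_mul hm0 hm hg
  have h0 : basisVec (⟨0, hm0.trans hm⟩ : Fin n) ∈ coordSpan n m := basisVec_mem _ hm0
  refine mul_mem (P.pair_mem ?_ h0 hx1 (basisVec_dot _)) hh
  rw [mat_mul, ← Matrix.mulVec_mulVec,
    P.map_mulVec_eq hh fun a ha => dot_basisVec_eq_zero ha le_rfl, P.map _ _ hx1 (basisVec_dot _),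
    ← Matrix.mulVec_mulVec, hyperRefl_mulVec _ (basisVec ⟨m, hm⟩),
    dot_basisVec_eq_zero h0 le_rfl, mul_zero, zero_smul, sub_zero, hyperRefl_mulVec,
    sub_eq_self, smul_eq_zero] at hfix
  refine mem_coordSpan_of_dot (i := ⟨m, hm⟩) hx ?_ rfl
  rcases hfix with h | h
  · exact (mul_eq_zero.1 h).resolve_left two_ne_zero
  · rw [h, zero_dotProduct]

/-- The subgroup for `m + 1` acts transitively on the unit sphere. -/
theorem exists_map_basisVec (hm0 : 0 < m) (hm : m < n) {x : Fin n → ℝ}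
    (hx : x ∈ coordSpan n (m + 1)) (hx1 : x ⬝ᵥ x = 1) : ∃ g ∈ P.subgroup m, ∃ θ,
      (mat r (g * P.pair (circ (basisVec ⟨0, hm0.trans hm⟩) (basisVec ⟨m, hm⟩) θ)
        (basisVec ⟨0, hm0.trans hm⟩))).mulVec (basisVec ⟨m, hm⟩) = x := by
  have hp := basisVec_orthoPair (zero_ne_of_pos hm0 hm)
  have h0 : basisVec (⟨0, hm0.trans hm⟩ : Fin n) ∈ coordSpan n m := basisVec_mem _ hm0
  have hem : basisVec (⟨m, hm⟩ : Fin n) ∈ coordSpan n (m + 1) := basisVec_mem _ (by simp)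
  have horth : ∀ a ∈ coordSpan n m, a ⬝ᵥ basisVec ⟨m, hm⟩ = 0 :=
    fun a ha => dot_basisVec_eq_zero ha le_rfl
  generalize (basisVec ⟨0, hm0.trans hm⟩ : Fin n → ℝ) = e at *
  obtain ⟨y, hy, hyp, φ, rfl⟩ := exists_polar hp (coordSpan n (m + 1))
    (coordSpan_mono (Nat.le_succ m) h0) hem hp.right hx1 hem hx
  have hym : y ∈ coordSpan n m :=
    mem_coordSpan_of_dot (i := ⟨m, hm⟩) hy (by rw [dotProduct_comm, hyp.orth]) rfl
  have hA : ∀ θ, (mat r (P.pair (circ e (basisVec ⟨m, hm⟩) θ) e)).mulVec (basisVec ⟨m, hm⟩) =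
      circ (basisVec ⟨m, hm⟩) (-e) (2 * θ) := by
    intro θ
    rw [P.map _ _ (hp.unit_circ _) hp.left, ← Matrix.mulVec_mulVec, hyperRefl_mulVec e, hp.orth,
      mul_zero, zero_smul, sub_zero, hyperRefl_mulVec]
    simp only [circ, add_dotProduct, smul_dotProduct, hp.orth, hp.right, sin_two_mul, cos_two_mul,
      smul_eq_mul]
    have := sin_sq_add_cos_sq θ
    match_scalars <;> first | ring1 | linear_combination -2 * this
  by_cases hye : y = e
  · refine ⟨1, one_mem _, -φ / 2, ?_⟩
    rw [one_mul, hA, hye, mul_div_cancel₀ _ two_ne_zero]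
    simp only [circ, cos_neg, sin_neg, neg_smul, smul_neg, neg_neg]
  -- The plane rotation can only reach the right height. The element of the smaller subgroup then
  -- sends `-e` to `y`: reflect in `e`, then in the normalized difference `y - e`.
  · obtain ⟨c, hc, hc1, hc2⟩ := exists_unit_smul (sub_ne_zero.2 hye)
    have hpm : c • (y - e) ∈ coordSpan n m := Submodule.smul_mem _ _ (Submodule.sub_mem _ hym h0)
    have hg := P.pair_mem hpm h0 hc1 hp.left
    refine ⟨_, hg, φ / 2, ?_⟩
    rw [mat_mul, ← Matrix.mulVec_mulVec, hA, mul_div_cancel₀ _ two_ne_zero, circ, circ,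
      Matrix.mulVec_add, Matrix.mulVec_smul, Matrix.mulVec_smul, P.map_mulVec_eq hg horth]
    congr 2
    rw [P.map _ _ hc1 hp.left, ← Matrix.mulVec_mulVec, hyperRefl_mulVec e, hyperRefl_mulVec]
    have h3 : c * c * (2 - 2 * (y ⬝ᵥ e)) = 1 := by
      have : (y - e) ⬝ᵥ (y - e) = 2 - 2 * (y ⬝ᵥ e) := by
        simp only [sub_dotProduct, dotProduct_sub, hp.left, hyp.right, dotProduct_comm e y]
        ring
      rw [← this, ← hc2]
      field_simp
    simp only [sub_dotProduct, dotProduct_sub, dotProduct_neg, smul_dotProduct, dotProduct_smul,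
      hp.left, smul_eq_mul]
    match_scalars
    · linear_combination -h3
    · linear_combination h3

/-- Sliding by `π` shows that the pair of `e, -e` equals the pair of `-e, e`, which is its inverse.
-/
theorem pair_neg_sq (hn : 2 ≤ n) {e : Fin n → ℝ} (he : e ⬝ᵥ e = 1) :
    P.pair e (-e) * P.pair e (-e) = 1 := by
  have hp := basisVec_orthoPair (zero_ne_of_pos one_pos (show 1 < n by omega))
  obtain ⟨w, -, hw, -⟩ := exists_polar hp ⊤ trivial trivial he he trivial trivial
  have h1 := P.pair_circ_eq hw (x := 0) (y := π) (x' := π) (y' := 0 + π + π) (by ring)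
  rw [circ_add_pi, circ_add_pi, ← zero_add π, circ_add_pi, circ_zero, neg_neg] at h1
  nth_rw 2 [h1]
  rw [P.mul _ _ _ he (by simp [he]) he, P.pair_self he]

theorem eq_or_eq_of_mem_one (hn : 2 ≤ n) {g : G} (hg : g ∈ P.subgroup 1) :
    g = 1 ∨ g = P.pair (basisVec ⟨0, by omega⟩) (-basisVec ⟨0, by omega⟩) := by
  have hn0 : 0 < n := by omega
  change g = 1 ∨ g = P.pair (basisVec ⟨0, hn0⟩) (-basisVec ⟨0, hn0⟩)
  have hsq := P.pair_neg_sq hn (basisVec_dot ⟨0, hn0⟩)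
  have hneg : (-basisVec ⟨0, hn0⟩ : Fin n → ℝ) ⬝ᵥ -basisVec ⟨0, hn0⟩ = 1 := by
    rw [neg_dotProduct_neg, basisVec_dot]
  have hinv := P.pair_inv (basisVec_dot ⟨0, hn0⟩) hneg
  rw [← eq_inv_iff_mul_eq_one, hinv] at hsq
  have hV : ∀ a ∈ coordSpan n 1, a ⬝ᵥ a = 1 → a = basisVec ⟨0, hn0⟩ ∨ a = -basisVec ⟨0, hn0⟩ := by
    intro a ha ha1
    have h1 : a = a ⟨0, hn0⟩ • basisVec ⟨0, hn0⟩ := by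
      ext i
      rcases eq_or_ne i ⟨0, hn0⟩ with rfl | hi
      · simp
      · rw [ha i (by have := Fin.val_ne_of_ne hi; simp at this; omega)]
        simp [Pi.single_eq_of_ne hi]
    rw [h1] at ha1
    simp only [dotProduct_smul, smul_dotProduct, basisVec_dot, smul_eq_mul, mul_one] at ha1
    rcases mul_self_eq_one_iff.1 ha1 with h | h
    · left; rw [h1, h, one_smul]
    · right; rw [h1, h, neg_one_smul]
  have key : ∀ a ∈ coordSpan n 1, ∀ b ∈ coordSpan n 1, a ⬝ᵥ a = 1 → b ⬝ᵥ b = 1 →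
      P.pair a b = 1 ∨ P.pair a b = P.pair (basisVec ⟨0, hn0⟩) (-basisVec ⟨0, hn0⟩) := by
    intro a ha b hb ha1 hb1
    rcases hV a ha ha1 with rfl | rfl <;> rcases hV b hb hb1 with rfl | rfl
    · exact Or.inl (P.pair_self (basisVec_dot _))
    · exact Or.inr rfl
    · exact Or.inr hsq.symm
    · exact Or.inl (P.pair_self hneg)
  have hzz := P.pair_neg_sq hn (basisVec_dot ⟨0, hn0⟩)
  generalize P.pair (basisVec ⟨0, hn0⟩) (-basisVec ⟨0, hn0⟩) = z at *
  have hmul : ∀ x y : G, x = 1 ∨ x = z → y = 1 ∨ y = z → x * y = 1 ∨ x * y = z := by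
    rintro x y (rfl | rfl) (rfl | rfl) <;> simp [hzz]
  induction hg using Subgroup.closure_induction_left with
  | one => exact Or.inl rfl
  | mul_left x hx y _ ih =>
    obtain ⟨a, ha, b, hb, ha1, hb1, rfl⟩ := hx
    exact hmul _ _ (key a ha b hb ha1 hb1) ih
  | inv_mul_cancel x hx y _ ih =>
    obtain ⟨a, ha, b, hb, ha1, hb1, rfl⟩ := hx
    rw [P.pair_inv ha1 hb1]
    exact hmul _ _ (key b hb a ha hb1 ha1) ih

/-- `mem_subgroup_of_fix` strips off one coordinate at a time. -/
theorem mem_one_of_fix {g : G} (hm0 : 0 < m) (hm : m ≤ n) (hg : g ∈ P.subgroup m)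
    (h : mat r g = 1) : g ∈ P.subgroup 1 := by
  induction m, hm0 using Nat.le_induction with
  | base => exact hg
  | succ k hk ih =>
    exact ih (by omega) (P.mem_subgroup_of_fix hk hm hg (by rw [h, Matrix.one_mulVec]))

/-- The kernel of the covering is generated by the lift of `-1`. -/
theorem eq_or_eq_of_map_eq_one (hn : 2 ≤ n) {g : G} (hg : g ∈ P.subgroup n) (h : mat r g = 1) :
    g = 1 ∨ g = P.pair (basisVec ⟨0, by omega⟩) (-basisVec ⟨0, by omega⟩) :=
  P.eq_or_eq_of_mem_one hn (P.mem_one_of_fix (by omega) le_rfl hg h)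

/-- Halving the angle makes each generator a square, and an orthogonal matrix has determinant `±1`.
-/
theorem det_map {g : G} (hn : 2 ≤ n) (hg : g ∈ P.subgroup n) : (mat r g).det = 1 := by
  have hp := basisVec_orthoPair (zero_ne_of_pos one_pos (show 1 < n by omega))
  have key : ∀ a b : Fin n → ℝ, a ⬝ᵥ a = 1 → b ⬝ᵥ b = 1 → (mat r (P.pair a b)).det = 1 := by
    intro a b ha hb
    obtain ⟨w, -, hw, θ, rfl⟩ := exists_polar hp ⊤ trivial trivial ha hb trivial trivial
    have h1 := P.mul _ _ _ (hw.unit_circ 0) (hw.unit_circ (θ / 2)) (hw.unit_circ θ)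
    rw [P.pair_circ_eq hw (x := 0) (x' := θ / 2) (y' := θ) (by ring), circ_zero] at h1
    rw [← h1, mat_mul, Matrix.det_mul]
    have h2 := congrArg Matrix.det (mat_mul_transpose r (P.pair (circ a w (θ / 2)) (circ a w θ)))
    rwa [Matrix.det_mul, Matrix.det_transpose, Matrix.det_one] at h2
  induction hg using Subgroup.closure_induction_left with
  | one => rw [mat_one, Matrix.det_one]
  | mul_left x hx y _ ih =>
    obtain ⟨a, ha, b, hb, ha1, hb1, rfl⟩ := hx
    rw [mat_mul, Matrix.det_mul, ih, key a b ha1 hb1, one_mul]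
  | inv_mul_cancel x hx y _ ih =>
    obtain ⟨a, ha, b, hb, ha1, hb1, rfl⟩ := hx
    rw [mat_mul, Matrix.det_mul, ih, P.pair_inv ha1 hb1, key b a hb1 ha1, one_mul]

/-- Correct `A` by an element with the same effect on the last basis vector that need not be fixed,
and induct. At `m = 1` the matrix is diagonal, and the determinant fixes its remaining entry. -/
theorem exists_map_eq (hm0 : 0 < m) (hm : m ≤ n) (A : O n) (hA : A ∈ SO n)
    (hfix : ∀ i : Fin n, m ≤ i → (A : Matrix (Fin n) (Fin n) ℝ).mulVec (basisVec i) = basisVec i) :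
    ∃ g ∈ P.subgroup m, r g = A := by
  have hdot : ∀ (A : O n) (v w : Fin n → ℝ), (A : Matrix (Fin n) (Fin n) ℝ).mulVec v ⬝ᵥ
      (A : Matrix (Fin n) (Fin n) ℝ).mulVec w = v ⬝ᵥ w := fun A v w => mat_dot (ρ := MonoidHom.id (O n)) A v w
  induction m, hm0 using Nat.le_induction generalizing A with
  | base =>
    refine ⟨1, one_mem _, ?_⟩
    rw [map_one]
    have hoff : ∀ i j : Fin n, i ≠ j → (A : Matrix (Fin n) (Fin n) ℝ) i j = 0 := by
      intro i j hij
      rcases Nat.eq_zero_or_pos j with hj | hj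
      · have hi : 1 ≤ (i : ℕ) := by have := Fin.val_ne_of_ne hij; omega
        have := hdot A (basisVec j) (basisVec i)
        rw [hfix i hi] at this
        simpa [hij.symm, hij] using this
      · have := congrFun (hfix j hj) i
        simpa [hij] using this
    have hdiag : ∀ i : Fin n, 1 ≤ (i : ℕ) → (A : Matrix (Fin n) (Fin n) ℝ) i i = 1 := fun i hi => by
      have := congrFun (hfix i hi) i
      simpa using this
    have hAd : (A : Matrix (Fin n) (Fin n) ℝ) = Matrix.diagonal fun i => (A : Matrix (Fin n) (Fin n) ℝ) i i := by
      ext i j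
      rcases eq_or_ne i j with rfl | hij
      · simp
      · rw [hoff i j hij, Matrix.diagonal_apply_ne _ hij]
    have hn0 : 0 < n := by omega
    have hdet : (A : Matrix (Fin n) (Fin n) ℝ).det = 1 := hA
    rw [hAd, Matrix.det_diagonal, Finset.prod_eq_single ⟨0, hn0⟩ (fun i _ hi => hdiag i (by
      have := Fin.val_ne_of_ne hi; simp at this; omega)) (by simp)] at hdet
    apply Subtype.ext
    rw [hAd, OneMemClass.coe_one, ← Matrix.diagonal_one]
    congr 1
    ext i
    rcases Nat.eq_zero_or_pos i with hi | hi
    · rw [show i = ⟨0, hn0⟩ from Fin.ext hi, hdet]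
    · rw [hdiag i hi]
  | succ k hk ih =>
    have hkn : k < n := hm
    have hk0 : 0 < k := hk
    have hx : (A : Matrix (Fin n) (Fin n) ℝ).mulVec (basisVec ⟨k, hkn⟩) ∈ coordSpan n (k + 1) := by
      intro i hi
      have := hdot A (basisVec ⟨k, hkn⟩) (basisVec i)
      rw [hfix i hi, (basisVec_orthoPair (by rintro rfl; simp at hi)).orth] at this
      simpa using this
    obtain ⟨g, hg, θ, hgθ⟩ := P.exists_map_basisVec hk hkn hx (by rw [hdot, basisVec_dot])
    have h0 : basisVec (⟨0, hk0.trans hkn⟩ : Fin n) ∈ coordSpan n (k + 1) :=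
      basisVec_mem _ (by simp)
    have ht := mul_mem (P.subgroup_mono (Nat.le_succ k) hg) (P.pair_mem
      (circ_mem h0 (basisVec_mem ⟨k, hkn⟩ (by simp)) θ) h0
      ((basisVec_orthoPair (zero_ne_of_pos hk hkn)).unit_circ θ) (basisVec_dot _))
    generalize g * _ = t at *
    obtain ⟨s, hs, hrs⟩ := ih (by omega) ((r t)⁻¹ * A) (mul_mem (inv_mem
      (P.det_map (by omega) (P.subgroup_mono hm ht))) hA) (by
        intro i hi
        rw [← map_inv, Submonoid.coe_mul, ← Matrix.mulVec_mulVec]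
        change (mat r t⁻¹).mulVec _ = _
        rcases hi.eq_or_lt with h | h
        · rw [show i = ⟨k, hkn⟩ from Fin.ext h.symm, ← hgθ, Matrix.mulVec_mulVec, ← mat_mul,
            inv_mul_cancel, mat_one, Matrix.one_mulVec]
        · rw [hfix i h]
          exact P.map_mulVec_eq (inv_mem ht) fun a ha => dot_basisVec_eq_zero ha h)
    exact ⟨t * s, mul_mem ht (P.subgroup_mono (Nat.le_succ k) hs), by
      rw [map_mul, hrs, mul_inv_cancel_left]⟩

/-- By transitivity and `mem_subgroup_of_fix`, the subgroup for `k + 1` is the product `K A K`, with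
`K` the subgroup for `k` and `A` the image of a circle. At `m = 1` it has at most two elements. -/
theorem isCompact_subgroup [TopologicalSpace G] [ContinuousMul G] (hn : 2 ≤ n)
    (hcont : ∀ u v, IsOrthoPair u v → Continuous fun θ => P.pair (circ u v θ) u)
    (hm0 : 0 < m) (hm : m ≤ n) : IsCompact (P.subgroup m : Set G) := by
  induction m, hm0 using Nat.le_induction with
  | base =>
    exact (Set.toFinite ({1, P.pair (basisVec ⟨0, by omega⟩) (-basisVec ⟨0, by omega⟩)} :
      Set G)).subset (fun g hg => P.eq_or_eq_of_mem_one hn hg) |>.isCompact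
  | succ k hk ih =>
    have hkn : k < n := hm
    have hk0 : 0 < k := hk
    have hp := basisVec_orthoPair (zero_ne_of_pos hk hkn)
    have h0 : basisVec (⟨0, hk0.trans hkn⟩ : Fin n) ∈ coordSpan n (k + 1) :=
      basisVec_mem _ (by simp)
    have hem : basisVec (⟨k, hkn⟩ : Fin n) ∈ coordSpan n (k + 1) := basisVec_mem _ (by simp)
    set A : ℝ → G := fun θ => P.pair (circ (basisVec ⟨0, hk0.trans hkn⟩) (basisVec ⟨k, hkn⟩) θ)
      (basisVec ⟨0, hk0.trans hkn⟩) with hAdef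
    have hAmem : ∀ θ, A θ ∈ P.subgroup (k + 1) := fun θ =>
      P.pair_mem (circ_mem h0 hem θ) h0 (hp.unit_circ θ) hp.left
    have hA : IsCompact (Set.range A) := Function.Periodic.compact_of_continuous (c := 2 * π)
      (fun θ => by simp only [hAdef, circ, cos_add_two_pi, sin_add_two_pi]) two_pi_pos.ne'
      (hcont _ _ hp)
    have hk' := ih (by omega)
    have hle := P.subgroup_mono (Nat.le_succ k)
    convert (hk'.mul hA).mul hk' using 1
    ext t
    constructor
    · intro ht
      obtain ⟨g, hg, θ, hgθ⟩ := P.exists_map_basisVec hk hkn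
        (P.map_mulVec_mem ht _ hem) (by rw [mat_dot, basisVec_dot])
      refine ⟨g * A θ, ⟨g, hg, A θ, ⟨θ, rfl⟩, rfl⟩, (g * A θ)⁻¹ * t, ?_, mul_inv_cancel_left _ _⟩
      refine P.mem_subgroup_of_fix hk hkn (mul_mem (inv_mem (mul_mem (hle hg) (hAmem θ))) ht) ?_
      rw [mat_mul, ← Matrix.mulVec_mulVec, ← hgθ, Matrix.mulVec_mulVec, ← mat_mul, inv_mul_cancel,
        mat_one, Matrix.one_mulVec]
    · rintro ⟨_, ⟨g, hg, _, ⟨θ, rfl⟩, rfl⟩, s, hs, rfl⟩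
      exact mul_mem (mul_mem (hle hg) (hAmem θ)) (hle hs)

end
end ReflectionPairing
end CptExt

/-! ### The Clifford algebra, its topology, and generators of the spin group -/

namespace CptExt

variable {n : ℕ}

theorem vec_mul_self (a : Fin n → ℝ) : vec n a * vec n a = algebraMap ℝ (Cliff n) (a ⬝ᵥ a) := by
  rw [← stdForm_apply]
  exact CliffordAlgebra.ι_sq_scalar _ _

theorem vec_mul_add_swap (a b : Fin n → ℝ) :
    vec n a * vec n b + vec n b * vec n a = algebraMap ℝ (Cliff n) (2 * (a ⬝ᵥ b)) := by
  have h := vec_mul_self (a + b)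
  simp only [map_add, mul_add, add_mul, vec_mul_self, add_dotProduct, dotProduct_add,
    dotProduct_comm b a] at h
  rw [two_mul, map_add, ← sub_eq_zero]
  rw [← sub_eq_zero] at h
  rw [← h]
  abel

/-- The span of the products of the first `m` basis vectors in the Clifford algebra. -/
noncomputable def cliffSpan (n : ℕ) : ℕ → Submodule ℝ (Cliff n)
  | 0 => Submodule.span ℝ {1}
  | k + 1 => cliffSpan n k ⊔ (cliffSpan n k).map
      (LinearMap.mulRight ℝ (vec n fun i => if (i : ℕ) = k then 1 else 0))

theorem cliffSpan_fg (m : ℕ) : (cliffSpan n m).FG := by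
  induction m with
  | zero => exact Submodule.fg_span_singleton 1
  | succ k ih => exact ih.sup (ih.map _)

/-- A new factor anticommutes past later basis vectors and squares to a scalar when it meets itself.
Indexing by natural numbers costs nothing, since the vector is zero for `k ≥ n`. -/
theorem mul_mem_cliffSpan {m k : ℕ} (hk : k < m) {x : Cliff n} (hx : x ∈ cliffSpan n m) :
    x * vec n (fun i => if (i : ℕ) = k then 1 else 0) ∈ cliffSpan n m := by
  induction m generalizing x with
  | zero => omega
  | succ j ih =>
    obtain ⟨a, ha, _, ⟨b, hb, rfl⟩, rfl⟩ := Submodule.mem_sup.1 hx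
    rw [LinearMap.mulRight_apply, add_mul, mul_assoc]
    rcases eq_or_ne k j with rfl | hkj
    · refine add_mem (Submodule.mem_sup_right ⟨a, ha, rfl⟩) (Submodule.mem_sup_left ?_)
      rw [vec_mul_self, ← Algebra.commutes, ← Algebra.smul_def]
      exact Submodule.smul_mem _ _ hb
    · have hk' : k < j := by omega
      refine add_mem (Submodule.mem_sup_left (ih hk' ha)) (Submodule.mem_sup_right ?_)
      refine ⟨-(b * vec n fun i => if (i : ℕ) = k then 1 else 0), neg_mem (ih hk' hb), ?_⟩
      have h0 : (fun i : Fin n => if (i : ℕ) = j then (1 : ℝ) else 0) ⬝ᵥ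
          (fun i => if (i : ℕ) = k then 1 else 0) = 0 :=
        Finset.sum_eq_zero fun i _ => by
          dsimp only
          split_ifs with h1 h2
          · omega
          all_goals simp
      have := vec_mul_add_swap (fun i : Fin n => if (i : ℕ) = j then (1 : ℝ) else 0)
        (fun i => if (i : ℕ) = k then 1 else 0)
      rw [h0, mul_zero, map_zero] at this
      rw [LinearMap.mulRight_apply, eq_neg_of_add_eq_zero_left this, neg_mul, mul_neg, mul_assoc]

theorem cliffSpan_eq_top : cliffSpan n n = ⊤ := by
  have h1 : ∀ m, (1 : Cliff n) ∈ cliffSpan n m := fun m => by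
    induction m with
    | zero => exact Submodule.mem_span_singleton_self 1
    | succ k ih => exact Submodule.mem_sup_left ih
  rw [eq_top_iff]
  rintro x -
  induction x using CliffordAlgebra.right_induction with
  | algebraMap r =>
    rw [Algebra.algebraMap_eq_smul_one]
    exact Submodule.smul_mem _ _ (h1 n)
  | add x y hx hy => exact add_mem hx hy
  | mul_ι v x hx =>
    have hv : v = ∑ k : Fin n, v k • fun i : Fin n => if (i : ℕ) = k then (1 : ℝ) else 0 := by
      ext i
      simp [Fin.val_inj]
    rw [hv]
    change x * vec n _ ∈ _
    rw [map_sum, Finset.mul_sum]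
    refine Submodule.sum_mem _ fun k _ => ?_
    rw [map_smul, mul_smul_comm]
    exact Submodule.smul_mem _ _ (mul_mem_cliffSpan k.2 hx)

/-- Finite dimension makes the module topology a Hausdorff ring topology. -/
instance finite_cliff : Module.Finite ℝ (Cliff n) := ⟨cliffSpan_eq_top (n := n) ▸ cliffSpan_fg n⟩

instance isModuleTopology_cliff : IsModuleTopology ℝ (Cliff n) := ⟨rfl⟩

instance isTopologicalRing_cliff : IsTopologicalRing (Cliff n) :=
  IsModuleTopology.isTopologicalRing ℝ (Cliff n)

instance t2Space_cliff : T2Space (Cliff n) :=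
  T2Space.of_injective_continuous (Module.finBasis ℝ (Cliff n)).equivFun.injective
    (IsModuleTopology.continuous_of_linearMap
      (Module.finBasis ℝ (Cliff n)).equivFun.toLinearMap)

theorem continuous_vec : Continuous (vec n) := IsModuleTopology.continuous_of_linearMap (vec n)

theorem star_vec (a : Fin n → ℝ) : star (vec n a) = -vec n a := CliffordAlgebra.star_ι a

theorem vec_mul_mem {a b : Fin n → ℝ} (ha : a ⬝ᵥ a = 1) (hb : b ⬝ᵥ b = 1) :
    vec n a * vec n b ∈ spinGroup (stdForm n) := by
  have h1 : ∀ {a : Fin n → ℝ}, a ⬝ᵥ a = 1 → vec n a * vec n a = 1 := fun {a} ha => by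
    rw [vec_mul_self, ha, map_one]
  let u : ∀ a : Fin n → ℝ, a ⬝ᵥ a = 1 → (Cliff n)ˣ := fun a ha => ⟨vec n a, vec n a, h1 ha, h1 ha⟩
  refine ⟨⟨Submonoid.mem_map.2 ⟨u a ha * u b hb, mul_mem (Subgroup.subset_closure ⟨a, rfl⟩)
    (Subgroup.subset_closure ⟨b, rfl⟩), rfl⟩, ?_⟩, ?_⟩
  · rw [SetLike.mem_coe, Unitary.mem_iff, star_mul, star_vec, star_vec, neg_mul_neg]
    constructor
    · rw [mul_assoc, ← mul_assoc (vec n a), h1 ha, one_mul, h1 hb]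
    · rw [mul_assoc, ← mul_assoc (vec n b), h1 hb, one_mul, h1 ha]
  · exact CliffordAlgebra.ι_mul_ι_mem_evenOdd_zero _ _ _

/-- The product of two unit vectors as an element of the spin group. -/
noncomputable def vecPair (a b : Fin n → ℝ) : Spin n :=
  open Classical in
  if h : a ⬝ᵥ a = 1 ∧ b ⬝ᵥ b = 1 then ⟨vec n a * vec n b, vec_mul_mem h.1 h.2⟩ else 1

theorem coe_vecPair {a b : Fin n → ℝ} (ha : a ⬝ᵥ a = 1) (hb : b ⬝ᵥ b = 1) :
    (vecPair a b : Cliff n) = vec n a * vec n b := by rw [vecPair, dif_pos ⟨ha, hb⟩]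

theorem vec_mul_self_of_unit {a : Fin n → ℝ} (ha : a ⬝ᵥ a = 1) : vec n a * vec n a = 1 := by
  rw [vec_mul_self, ha, map_one]

theorem vecPair_mul {a b c : Fin n → ℝ} (ha : a ⬝ᵥ a = 1) (hb : b ⬝ᵥ b = 1) (hc : c ⬝ᵥ c = 1) :
    vecPair a b * vecPair b c = vecPair a c := by
  apply Subtype.ext
  rw [Submonoid.coe_mul, coe_vecPair ha hb, coe_vecPair hb hc, coe_vecPair ha hc, mul_assoc,
    ← mul_assoc (vec n b), vec_mul_self_of_unit hb, one_mul]

theorem vecPair_inv {a b : Fin n → ℝ} (ha : a ⬝ᵥ a = 1) (hb : b ⬝ᵥ b = 1) :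
    (vecPair a b)⁻¹ = vecPair b a := by
  rw [inv_eq_iff_mul_eq_one, vecPair_mul ha hb ha]
  apply Subtype.ext
  rw [coe_vecPair ha ha, vec_mul_self_of_unit ha, OneMemClass.coe_one]

theorem vec_hyperRefl {a : Fin n → ℝ} (ha : a ⬝ᵥ a = 1) (v : Fin n → ℝ) :
    vec n ((hyperRefl a).mulVec v) = -(vec n a * vec n v * vec n a) := by
  rw [hyperRefl_mulVec, map_sub, map_smul, eq_sub_of_add_eq (vec_mul_add_swap a v), sub_mul,
    mul_assoc, vec_mul_self_of_unit ha, mul_one, ← Algebra.smul_def, neg_sub]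

theorem spinCover_vecPair {a b : Fin n → ℝ} (ha : a ⬝ᵥ a = 1) (hb : b ⬝ᵥ b = 1) :
    mat (spinCover n) (vecPair a b) = hyperRefl a * hyperRefl b := by
  refine Matrix.mulVec_injective (funext fun v => vec_injective n ?_)
  rw [spinCover_spec, vecPair_inv ha hb, coe_vecPair ha hb, coe_vecPair hb ha,
    ← Matrix.mulVec_mulVec, vec_hyperRefl ha, vec_hyperRefl hb, mul_neg, neg_mul, neg_neg]
  simp only [mul_assoc]

/-- Only `y - x` enters, which is the field `rotate` of `spinPairing`. -/
theorem coe_vecPair_circ {u v : Fin n → ℝ} (h : IsOrthoPair u v) (x y : ℝ) :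
    (vecPair (circ u v x) (circ u v y) : Cliff n) =
      algebraMap ℝ _ (cos (y - x)) + sin (y - x) • (vec n u * vec n v) := by
  have hvu : vec n v * vec n u = -(vec n u * vec n v) := by
    have := vec_mul_add_swap u v
    rw [h.orth, mul_zero, map_zero] at this
    exact eq_neg_of_add_eq_zero_right this
  rw [coe_vecPair (h.unit_circ x) (h.unit_circ y)]
  simp only [circ, map_add, map_smul, mul_add, add_mul, smul_mul_assoc, mul_smul_comm, hvu,
    vec_mul_self_of_unit h.left, vec_mul_self_of_unit h.right, cos_sub, sin_sub,
    Algebra.algebraMap_eq_smul_one]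
  module

/-- The pairs of unit vectors in the spin group. -/
noncomputable def spinPairing (n : ℕ) : ReflectionPairing (spinCover n) where
  pair := vecPair
  mul _ _ _ := vecPair_mul
  map _ _ := spinCover_vecPair
  rotate u v h x y c := Subtype.ext (by
    rw [coe_vecPair_circ h, coe_vecPair_circ h, add_sub_add_right_eq_sub])

theorem continuous_vecPair {u v : Fin n → ℝ} (h : IsOrthoPair u v) :
    Continuous fun θ => vecPair (circ u v θ) u := by
  refine continuous_induced_rng.2 ?_
  have : ∀ θ, (vecPair (circ u v θ) u : Cliff n) = vec n (circ u v θ) * vec n u :=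
    fun θ => coe_vecPair (h.unit_circ θ) h.left
  simp only [Function.comp_def, this]
  refine (continuous_vec.comp ?_).mul continuous_const
  unfold circ
  fun_prop

theorem cliff_smul_one_injective {c d : ℝ} (h : c • (1 : Cliff n) = d • 1) : c = d := by
  rw [← Algebra.algebraMap_eq_smul_one, ← Algebra.algebraMap_eq_smul_one] at h
  exact FaithfulSMul.algebraMap_injective ℝ (Cliff n) h

/-- Right multiplication by a nonzero vector exchanges the two shapes and rescales, because `e² = 1`
lets `s v` be written as `(s v e) e`. The inverse of a generator is again a vector. -/
theorem exists_smul_of_mem_lipschitzGroup {e : Fin n → ℝ} (he : e ⬝ᵥ e = 1) {x : (Cliff n)ˣ}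
    (hx : x ∈ lipschitzGroup (stdForm n)) : ∃ c : ℝ, 0 < c ∧ ∃ s ∈ (spinPairing n).subgroup n,
      (x : Cliff n) = c • (s : Cliff n) ∨ (x : Cliff n) = c • ((s : Cliff n) * vec n e) := by
  have htop : ∀ v : Fin n → ℝ, v ∈ coordSpan n n := fun v i hi => absurd i.2 (by omega)
  have step : ∀ (y : Cliff n) (v : Fin n → ℝ), v ≠ 0 → (∃ c : ℝ, 0 < c ∧
      ∃ s ∈ (spinPairing n).subgroup n,
        y = c • (s : Cliff n) ∨ y = c • ((s : Cliff n) * vec n e)) → ∃ c : ℝ, 0 < c ∧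
      ∃ s ∈ (spinPairing n).subgroup n, y * vec n v = c • (s : Cliff n) ∨
        y * vec n v = c • ((s : Cliff n) * vec n e) := by
    rintro y v hv ⟨c, hc, s, hs, h⟩
    obtain ⟨b, hb, hb1, -⟩ := exists_unit_smul hv
    have hv' : vec n v = b⁻¹ • vec n (b • v) := by
      rw [map_smul, smul_smul, inv_mul_cancel₀ hb.ne', one_smul]
    refine ⟨c * b⁻¹, by positivity, ?_⟩
    rcases h with rfl | rfl
    · refine ⟨s * vecPair (b • v) e,
        mul_mem hs ((spinPairing n).pair_mem (htop _) (htop _) hb1 he), Or.inr ?_⟩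
      rw [Submonoid.coe_mul, coe_vecPair hb1 he, mul_assoc, mul_assoc (vec n (b • v)),
        vec_mul_self_of_unit he, mul_one, hv', smul_mul_smul_comm]
    · refine ⟨s * vecPair e (b • v),
        mul_mem hs ((spinPairing n).pair_mem (htop _) (htop _) he hb1), Or.inl ?_⟩
      rw [Submonoid.coe_mul, coe_vecPair he hb1, hv', smul_mul_smul_comm, mul_assoc]
  have hne : ∀ (u : (Cliff n)ˣ) (v : Fin n → ℝ), vec n v = u → v ≠ 0 := by
    rintro u v h rfl
    rw [map_zero] at h
    exact u.ne_zero h.symm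
  induction hx using Subgroup.closure_induction_right with
  | one => exact ⟨1, one_pos, 1, one_mem _, Or.inl (by simp)⟩
  | mul_right x _ y hy ih =>
    obtain ⟨v, hv⟩ := hy
    rw [Units.val_mul, ← hv]
    exact step _ v (hne y v hv) ih
  | mul_inv_cancel x _ y hy ih =>
    obtain ⟨v, hv⟩ := hy
    have hv0 : v ⬝ᵥ v ≠ 0 := fun h => hne y v hv (dotProduct_self_eq_zero.1 h)
    have hinv : ((y⁻¹ : (Cliff n)ˣ) : Cliff n) = vec n ((v ⬝ᵥ v)⁻¹ • v) := by
      refine Units.inv_eq_of_mul_eq_one_right ?_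
      rw [← hv, map_smul, mul_smul_comm]
      change _ • (vec n v * vec n v) = 1
      rw [vec_mul_self, Algebra.smul_def, ← map_mul, inv_mul_cancel₀ hv0, map_one]
    rw [Units.val_mul, hinv]
    exact step _ _ (hne _ _ hinv.symm) ih

/-- The condition `x * star x = 1` gives `c² = 1` for the even shape. For the odd shape it would
give `-c² = 1`, since `star` negates vectors. -/
theorem spinPairing_subgroup_eq_top (hn : 0 < n) : (spinPairing n).subgroup n = ⊤ := by
  rw [eq_top_iff]
  rintro s -
  have he : basisVec (⟨0, hn⟩ : Fin n) ⬝ᵥ basisVec ⟨0, hn⟩ = 1 := basisVec_dot _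
  obtain ⟨x, hx, hxs⟩ := Submonoid.mem_map.1 s.2.1.1
  obtain ⟨c, hc, t, ht, h⟩ := exists_smul_of_mem_lipschitzGroup he hx
  have h1 := spinGroup.mul_star_self_of_mem s.2
  have h2 := spinGroup.mul_star_self_of_mem t.2
  rw [← hxs] at h1
  change (x : Cliff n) * star (x : Cliff n) = 1 at h1
  rcases h with h | h
  · rw [h, CliffordAlgebra.star_smul, smul_mul_smul_comm, h2] at h1
    have hc1 : c = 1 := by
      have := cliff_smul_one_injective (h1.trans (one_smul ℝ 1).symm)
      nlinarith
    rw [hc1, one_smul] at h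
    rwa [show s = t from Subtype.ext (hxs.symm.trans h)]
  · rw [h, CliffordAlgebra.star_smul, star_mul, star_vec, smul_mul_smul_comm, mul_assoc,
      ← mul_assoc (vec n _), mul_neg, vec_mul_self_of_unit he, neg_one_mul, mul_neg, h2] at h1
    have := cliff_smul_one_injective (c := -(c * c)) (d := 1)
      (by rw [neg_smul, ← smul_neg, h1, one_smul])
    nlinarith

end CptExt

/-! ### The kernel of the spin covering and uniqueness of the lift -/

namespace CptExt

variable {n : ℕ}

theorem vecPair_neg (hn : 0 < n) :
    vecPair (basisVec ⟨0, hn⟩) (-basisVec ⟨0, hn⟩) = spinNegOne hn := by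
  apply Subtype.ext
  rw [coe_vecPair (basisVec_dot _) (by rw [neg_dotProduct_neg, basisVec_dot]), map_neg, mul_neg,
    vec_mul_self_of_unit (basisVec_dot _)]
  rfl

theorem spinNegOne_ne_one (hn : 0 < n) : spinNegOne hn ≠ 1 := by
  intro h
  have h1 : (-1 : Cliff n) = 1 := congrArg Subtype.val h
  have := cliff_smul_one_injective (n := n) (c := -1) (d := 1) (by rw [neg_one_smul, h1, one_smul])
  norm_num at this

theorem spinNegOne_sq (hn : 0 < n) : spinNegOne hn * spinNegOne hn = 1 := by
  apply Subtype.ext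
  change (-1 : Cliff n) * -1 = 1
  simp

theorem spinCover_spinNegOne (hn : 0 < n) : spinCover n (spinNegOne hn) = 1 := by
  refine O_ext fun v => ?_
  have h : (spinNegOne hn)⁻¹ = spinNegOne hn := by
    rw [inv_eq_iff_mul_eq_one, spinNegOne_sq]
  rw [spinCover_spec, h]
  change (-1 : Cliff n) * vec n v * -1 = _
  simp

theorem eq_or_eq_of_spinCover_eq_one (hn : 2 ≤ n) {s : Spin n} (h : spinCover n s = 1) :
    s = 1 ∨ s = spinNegOne (by omega) := by
  rw [← vecPair_neg]
  exact (spinPairing n).eq_or_eq_of_map_eq_one hn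
    (by rw [spinPairing_subgroup_eq_top (by omega)]; trivial) (congrArg Subtype.val h)

theorem exists_spinCover_eq (hn : 0 < n) {A : O n} (hA : A ∈ SO n) : ∃ s, spinCover n s = A := by
  obtain ⟨s, -, hs⟩ := (spinPairing n).exists_map_eq hn le_rfl A hA
    (fun i hi => absurd i.2 (by omega))
  exact ⟨s, hs⟩

theorem spinCover_mem_SO (hn : 2 ≤ n) (s : Spin n) : spinCover n s ∈ SO n :=
  (spinPairing n).det_map hn (by rw [spinPairing_subgroup_eq_top (by omega)]; trivial)

theorem compactSpace_spin (hn : 2 ≤ n) : CompactSpace (Spin n) := by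
  have := (spinPairing n).isCompact_subgroup hn (fun u v h => continuous_vecPair h) (by omega) le_rfl
  rw [spinPairing_subgroup_eq_top (by omega)] at this
  exact isCompact_univ_iff.1 this

/-- The spin group is perfect, in the form that its homomorphisms with commuting values are
trivial. -/
theorem spin_hom_trivial (hn : 3 ≤ n) {A : Type*} [Group A] (χ : Spin n →* A)
    (hχ : ∀ s t, Commute (χ s) (χ t)) (s : Spin n) : χ s = 1 := by
  have hs : s ∈ (spinPairing n).subgroup n := by
    rw [spinPairing_subgroup_eq_top (by omega)]; trivial
  have key : ∀ a b : Fin n → ℝ, a ⬝ᵥ a = 1 → b ⬝ᵥ b = 1 → χ (vecPair a b) = 1 := by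
    intro a b ha hb
    obtain ⟨w, θ, hw, rfl⟩ := exists_circ_eq hn ha hb
    set m := circ a w (θ / 2) with hm
    have hm1 : m ⬝ᵥ m = 1 := hw.unit_circ _
    -- With `m` halfway from `a` to `b`, the generator `a b` is the square of `a m`.
    have h1 : vecPair a (circ a w θ) = vecPair a m * vecPair a m := by
      have h := (spinPairing n).pair_circ_eq hw (x := 0) (y := θ / 2) (x' := θ / 2) (y' := θ)
        (by ring)
      rw [circ_zero] at h
      change vecPair _ _ = vecPair _ _ at h
      nth_rw 2 [h]
      rw [vecPair_mul ha hm1 hb]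
    obtain ⟨e, he, hae, hme⟩ := exists_unit_orth hn a m
    -- With `e` orthogonal to `a` and `m`, conjugation by `e a` inverts `a m`. So under `χ` it
    -- equals its own inverse, and its square is trivial.
    have h2 : vecPair e a * vecPair a m * (vecPair e a)⁻¹ = vecPair m a := by
      rw [vecPair_mul he ha hm1, vecPair_inv he ha]
      apply Subtype.ext
      rw [Submonoid.coe_mul, coe_vecPair he hm1, coe_vecPair ha he, coe_vecPair hm1 ha]
      have e1 := vec_mul_add_swap a e
      have e2 := vec_mul_add_swap m e
      rw [hae, mul_zero, map_zero] at e1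
      rw [hme, mul_zero, map_zero] at e2
      rw [eq_neg_of_add_eq_zero_left e1, mul_neg, mul_assoc, ← mul_assoc (vec n m),
        eq_neg_of_add_eq_zero_left e2, neg_mul, mul_neg, neg_neg, ← mul_assoc, ← mul_assoc,
        vec_mul_self_of_unit he, one_mul]
    have h3 := congrArg χ h2
    rw [map_mul, map_mul, map_inv, (hχ _ _).eq, mul_assoc, mul_inv_cancel, mul_one,
      ← vecPair_inv ha hm1, map_inv] at h3
    rw [h1, map_mul]
    nth_rw 1 [h3]
    rw [inv_mul_cancel]
  induction hs using Subgroup.closure_induction with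
  | mem x hx =>
    obtain ⟨a, ha, b, hb, ha1, hb1, rfl⟩ := hx
    exact key a b ha1 hb1
  | one => exact map_one χ
  | mul x y _ _ hx hy => rw [map_mul, hx, hy, one_mul]
  | inv x _ hx => rw [map_inv, hx, inv_one]

variable {H : Type*} [Group H] [TopologicalSpace H] {ρ : H →* O n}

/-- The quotient of two lifts takes values in the kernel of `ρ`, with which both lifts commute. So
it is a homomorphism with commuting values, hence trivial. -/
theorem IsCanonicalLift.unique (hn : 3 ≤ n) {φ φ' : Spin n →* H} (hφ : IsCanonicalLift ρ φ)
    (hφ' : IsCanonicalLift ρ φ') : φ' = φ := by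
  have hk : ∀ s, φ' s * (φ s)⁻¹ ∈ ρ.ker := fun s => by
    rw [MonoidHom.mem_ker, map_mul, map_inv, hφ.lift, hφ'.lift, mul_inv_cancel]
  have hc : ∀ s, ∀ k ∈ ρ.ker, Commute (φ s) k := hφ.commute
  have hc' : ∀ s, ∀ k ∈ ρ.ker, Commute (φ' s) k := hφ'.commute
  let χ : Spin n →* H :=
    { toFun := fun s => φ' s * (φ s)⁻¹
      map_one' := by simp
      map_mul' := fun s t => by
        rw [map_mul, map_mul, mul_inv_rev, mul_assoc, ← mul_assoc (φ' t),
          ((hc s _ (hk t)).inv_left.eq).symm]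
        simp only [mul_assoc] }
  ext s
  have := spin_hom_trivial hn χ (fun s t =>
    Commute.mul_left (hc' s _ (hk t)) (hc s _ (hk t)).inv_left) s
  exact mul_inv_eq_one.1 this

/-! ### Existence of the canonical lift, through its graph -/

namespace RotationLift

variable (L : RotationLift ρ)

/-- The pairs of unit vectors in the product of `H` with the spin group. -/
noncomputable def prodPairing (hn : 3 ≤ n) :
    ReflectionPairing (ρ.comp (MonoidHom.fst H (Spin n))) where
  pair a b := (L.pair hn a b, vecPair a b)
  mul _ _ _ ha hb hc := Prod.ext (L.pair_mul hn ha hb hc) (vecPair_mul ha hb hc)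
  map _ _ ha hb := L.mat_pair hn ha hb
  rotate u v h x y c := Prod.ext
    (by rw [L.pair_circ hn h, L.pair_circ hn h, add_sub_add_right_eq_sub])
    ((spinPairing n).rotate u v h x y c)

theorem map_eq_spinCover (hn : 3 ≤ n) {x : H × Spin n} (hx : x ∈ (L.prodPairing hn).subgroup n) :
    ρ x.1 = spinCover n x.2 := by
  have : (L.prodPairing hn).subgroup n ≤
      (ρ.comp (MonoidHom.fst H (Spin n))).eqLocus ((spinCover n).comp (MonoidHom.snd H (Spin n))) := by
    refine (Subgroup.closure_le _).2 ?_
    rintro _ ⟨a, -, b, -, ha, hb, rfl⟩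
    exact Subtype.ext ((L.mat_pair hn ha hb).trans (spinCover_vecPair ha hb).symm)
  exact this hx

theorem commute_of_mem (hn : 3 ≤ n) {x : H × Spin n} (hx : x ∈ (L.prodPairing hn).subgroup n) {k : H}
    (hk : k ∈ ρ.ker) : x.1 * k = k * x.1 := by
  have : (L.prodPairing hn).subgroup n ≤
      (Subgroup.centralizer {k}).comap (MonoidHom.fst H (Spin n)) := by
    refine (Subgroup.closure_le _).2 ?_
    rintro _ ⟨a, -, b, -, ha, hb, rfl⟩
    exact Subgroup.mem_centralizer_singleton_iff.2 (L.commute_pair hn ha hb hk).eq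
  exact Subgroup.mem_centralizer_singleton_iff.1 (this hx)

/-- The only possible nontrivial element of the graph over `1` in `O n` is the pair of `e, -e`,
whose spin component is `-1`. -/
theorem snd_injective (hn : 3 ≤ n) {x : H × Spin n} (hx : x ∈ (L.prodPairing hn).subgroup n) (h : x.2 = 1) :
    x = 1 := by
  have h1 : ρ x.1 = 1 := by rw [L.map_eq_spinCover hn hx, h, map_one]
  refine ((L.prodPairing hn).eq_or_eq_of_map_eq_one (by omega) hx
    (congrArg Subtype.val h1)).resolve_right ?_
  rintro rfl
  exact spinNegOne_ne_one (by omega) ((vecPair_neg _).symm.trans h)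

theorem snd_surjective (hn : 3 ≤ n) (s : Spin n) : ∃ x ∈ (L.prodPairing hn).subgroup n, x.2 = s := by
  have h : (spinPairing n).subgroup n ≤
      ((L.prodPairing hn).subgroup n).map (MonoidHom.snd H (Spin n)) := by
    refine (Subgroup.closure_le _).2 ?_
    rintro _ ⟨a, ha, b, hb, ha1, hb1, rfl⟩
    exact ⟨_, (L.prodPairing hn).pair_mem ha hb ha1 hb1, rfl⟩
  rw [spinPairing_subgroup_eq_top (by omega)] at h
  obtain ⟨x, hx, hs⟩ := h (show s ∈ (⊤ : Subgroup (Spin n)) from trivial)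
  exact ⟨x, hx, hs⟩

variable [IsTopologicalGroup H]

theorem isCompact_prodPairing (hn : 3 ≤ n) : IsCompact ((L.prodPairing hn).subgroup n : Set (H × Spin n)) := by
  refine (L.prodPairing hn).isCompact_subgroup (by omega) (fun u v h => ?_) (by omega) le_rfl
  refine Continuous.prodMk ?_ (continuous_vecPair h)
  have : ∀ θ, L.pair hn (circ u v θ) u = L.rot u v (2 * (0 - θ)) := fun θ => by
    rw [← L.pair_circ hn h, circ_zero]
  simp only [this]
  exact (L.continuous_rot u v).comp (by fun_prop)

/-- The graph is compact and projects bijectively to the Hausdorff group `Spin n`, so the inverse of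
the projection is continuous; `φ` is that inverse followed by the other projection. -/
theorem exists_isCanonicalLift (L : RotationLift ρ) (hn : 3 ≤ n) : ∃ φ : Spin n →* H, IsCanonicalLift ρ φ := by
  set T := (L.prodPairing hn).subgroup n
  let e : T ≃* Spin n := MulEquiv.ofBijective ((MonoidHom.snd H (Spin n)).comp T.subtype)
    ⟨(injective_iff_map_eq_one _).2 fun x hx => Subtype.ext (L.snd_injective hn x.2 hx),
      fun s => by
        obtain ⟨x, hx, hs⟩ := L.snd_surjective hn s
        exact ⟨⟨x, hx⟩, hs⟩⟩
  have hsnd : ∀ s, (e.symm s).1.2 = s := fun s => e.apply_symm_apply s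
  have : CompactSpace T := isCompact_iff_compactSpace.1 (L.isCompact_prodPairing hn)
  have he : Continuous e.toEquiv := continuous_snd.comp continuous_subtype_val
  have he' : Continuous e.symm := he.continuous_symm_of_equiv_compact_to_t2
  refine ⟨((MonoidHom.fst H (Spin n)).comp T.subtype).comp e.symm.toMonoidHom,
    (continuous_fst.comp continuous_subtype_val).comp he', fun s => ?_,
    fun s k hk => L.commute_of_mem hn (e.symm s).2 hk⟩
  exact (L.map_eq_spinCover hn (e.symm s).2).trans (by rw [hsnd])

end RotationLift

/-! ### The double cover and the special part of `H` as products -/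

namespace IsCanonicalLift

variable {φ : Spin n →* H}

/-- The inverse sends `(h, s)` to `(s, φ(s)⁻¹ h)`; multiplicativity is the commutation of `φ` with
the kernel. -/
theorem exists_coverEquiv [IsTopologicalGroup H] (hn : 2 ≤ n) (hφ : IsCanonicalLift ρ φ) :
    ∃ Φ : Spin n × ρ.ker ≃ₜ* SHCover ρ,
      ∀ s k, ((Φ (s, k)).1.1 : H) = φ s * k ∧ (Φ (s, k)).1.2 = s := by
  have hρk : ∀ (s : Spin n) (k : ρ.ker), ρ (φ s * k) = spinCover n s := fun s k => by
    rw [map_mul, hφ.lift, MonoidHom.mem_ker.1 k.2, mul_one]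
  refine ⟨{
    toFun := fun x => ⟨(⟨φ x.1 * x.2, by
      change ρ _ ∈ SO n
      rw [hρk]
      exact spinCover_mem_SO hn _⟩, x.1), hρk x.1 x.2⟩
    invFun := fun y => (y.1.2, ⟨(φ y.1.2)⁻¹ * y.1.1, by
      have := y.2
      change ρ (y.1.1 : H) = spinCover n y.1.2 at this
      rw [MonoidHom.mem_ker, map_mul, map_inv, hφ.lift, this, inv_mul_cancel]⟩)
    left_inv := fun x => Prod.ext rfl (Subtype.ext (inv_mul_cancel_left _ _))
    right_inv := fun y => Subtype.ext (Prod.ext (Subtype.ext (mul_inv_cancel_left _ _)) rfl)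
    map_mul' := fun x y => Subtype.ext (Prod.ext (Subtype.ext (by
      change φ (x.1 * y.1) * (x.2 * y.2) = φ x.1 * x.2 * (φ y.1 * y.2)
      rw [map_mul, mul_assoc, mul_assoc, ← mul_assoc (φ y.1), hφ.commute _ _ x.2.2,
        mul_assoc]) ) rfl)
    continuous_toFun := by
      refine Continuous.subtype_mk (Continuous.prodMk (Continuous.subtype_mk ?_ _) continuous_fst) _
      exact (hφ.continuous.comp continuous_fst).mul (continuous_subtype_val.comp continuous_snd)
    continuous_invFun := by
      refine Continuous.prodMk (continuous_snd.comp continuous_subtype_val)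
        (Continuous.subtype_mk ?_ _)
      exact (hφ.continuous.comp (continuous_snd.comp continuous_subtype_val)).inv.mul
        (continuous_subtype_val.comp (continuous_fst.comp continuous_subtype_val)) },
    fun s k => ⟨rfl, rfl⟩⟩

/-- If `φ(s) k = 1` then `s` covers the identity, so `s = ±1` and `k` is determined. Since `k₀` is
its own inverse, this kernel is the cyclic group generated by `(-1, k₀)`. -/
theorem exists_quotientEquiv [IsTopologicalGroup H] [CompactSpace H] [T2Space H] (hn : 2 ≤ n)
    (hρ : Continuous ρ) (hφ : IsCanonicalLift ρ φ) :
    ∃ k₀ : Subgroup.center ρ.ker, k₀ ^ 2 = 1 ∧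
      φ (spinNegOne (by omega)) = ((k₀ : ρ.ker) : H) ∧
      ∃ Ψ : (Spin n × ρ.ker) ⧸ diagSubgroup (by omega) k₀ ≃ₜ* SH ρ,
        ∀ s k, (Ψ (QuotientGroup.mk (s, k)) : H) = φ s * k := by
  have hn0 : 0 < n := by omega
  let z : ρ.ker := ⟨φ (spinNegOne hn0), by
    rw [MonoidHom.mem_ker, hφ.lift, spinCover_spinNegOne]⟩
  have hzz : z * z = 1 := Subtype.ext (by
    change φ _ * φ _ = 1
    rw [← map_mul, spinNegOne_sq, map_one])
  let k₀ : Subgroup.center ρ.ker := ⟨z, Subgroup.mem_center_iff.2 fun k =>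
    Subtype.ext (hφ.commute _ _ k.2).symm⟩
  have hρk : ∀ (s : Spin n) (k : ρ.ker), ρ (φ s * k) = spinCover n s := fun s k => by
    rw [map_mul, hφ.lift, MonoidHom.mem_ker.1 k.2, mul_one]
  let F : Spin n × ρ.ker →* SH ρ :=
    { toFun := fun x => ⟨φ x.1 * x.2, by
        change ρ _ ∈ SO n
        rw [hρk]
        exact spinCover_mem_SO hn _⟩
      map_one' := Subtype.ext (by simp)
      map_mul' := fun x y => Subtype.ext (by
        change φ (x.1 * y.1) * (x.2 * y.2) = φ x.1 * x.2 * (φ y.1 * y.2)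
        rw [map_mul, mul_assoc, mul_assoc, ← mul_assoc (φ y.1), hφ.commute _ _ x.2.2,
          mul_assoc]) }
  have hFc : Continuous F := Continuous.subtype_mk ((hφ.continuous.comp continuous_fst).mul
    (continuous_subtype_val.comp continuous_snd)) _
  have hle : diagSubgroup hn0 k₀ ≤ F.ker := by
    rw [diagSubgroup, Subgroup.zpowers_le, MonoidHom.mem_ker]
    exact Subtype.ext (show φ (spinNegOne hn0) * φ (spinNegOne hn0) = 1 from
      congrArg Subtype.val hzz)
  have hker : ∀ x, F x = 1 → x ∈ diagSubgroup hn0 k₀ := by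
    rintro ⟨s, k⟩ hx
    have hx' : φ s * k = 1 := congrArg Subtype.val hx
    have hs : spinCover n s = 1 := by rw [← hρk s k, hx', map_one]
    rcases eq_or_eq_of_spinCover_eq_one hn hs with rfl | rfl
    · have : k = 1 := Subtype.ext (by rwa [map_one, one_mul] at hx')
      rw [this]
      exact one_mem _
    · have : k = z := by
        have h1 : z * k = 1 := Subtype.ext hx'
        exact mul_left_cancel (h1.trans hzz.symm)
      rw [this]
      exact Subgroup.mem_zpowers _
  let Ψ₀ : (Spin n × ρ.ker) ⧸ diagSubgroup hn0 k₀ ≃* SH ρ :=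
    MulEquiv.ofBijective (QuotientGroup.lift _ F hle) ⟨by
      rw [injective_iff_map_eq_one]
      intro q
      induction q using QuotientGroup.induction_on with
      | H x =>
        intro hx
        exact (QuotientGroup.eq_one_iff x).2 (hker x hx), fun h => by
      obtain ⟨s, hs⟩ := exists_spinCover_eq hn0 h.2
      refine ⟨QuotientGroup.mk (s, ⟨(φ s)⁻¹ * h, ?_⟩), Subtype.ext (mul_inv_cancel_left _ _)⟩
      rw [MonoidHom.mem_ker, map_mul, map_inv, hφ.lift, hs, inv_mul_cancel]⟩
  have hΨ : Continuous Ψ₀.toEquiv := continuous_quot_lift _ hFc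
  -- The quotient is compact and the target Hausdorff, so the continuous bijection is a
  -- homeomorphism.
  have := compactSpace_spin hn
  have : CompactSpace ρ.ker := isCompact_iff_compactSpace.1
    ((isClosed_singleton.preimage hρ).isCompact : IsCompact (ρ ⁻¹' {1}))
  refine ⟨k₀, Subtype.ext (by rw [sq]; exact hzz), rfl, { Ψ₀ with
    continuous_toFun := hΨ
    continuous_invFun := hΨ.continuous_symm_of_equiv_compact_to_t2 }, fun s k => rfl⟩

end IsCanonicalLift
end CptExt

/-! ### The theorem -/

theorem mainTheorem10 {d n : ℕ} {H : Type*} [TopologicalSpace H]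
    [ChartedSpace (EuclideanSpace ℝ (Fin d)) H] [Group H] [LieGroup (𝓡 d) ∞ H]
    [CompactSpace H] [T2Space H]
    (ρ : H →* CptExt.O n) (hρ : CptExt.IsSmoothHom d ρ)
    (himage : ρ.range = ⊤ ∨ ρ.range = CptExt.SO n) :
    (∃ 𝔬' 𝔨 : LieIdeal ℝ (GroupLieAlgebra (𝓡 d) H),
      (𝔨 : Set (GroupLieAlgebra (𝓡 d) H)) = CptExt.subgroupLieAlgebra d ρ.ker ∧
      IsCompl 𝔬' 𝔨 ∧
      ∃ e : 𝔬' ≃ₗ⁅ℝ⁆ LieAlgebra.Orthogonal.so (Fin n) ℝ,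
        ∀ v : 𝔬', (e v : Matrix (Fin n) (Fin n) ℝ) =
          CptExt.differential ρ (v : GroupLieAlgebra (𝓡 d) H)) ∧
    (∀ hn : 3 ≤ n, ∃ φ : CptExt.Spin n →* H,
      CptExt.IsCanonicalLift ρ φ ∧ (∀ φ', CptExt.IsCanonicalLift ρ φ' → φ' = φ) ∧
      (∃ Φ : CptExt.Spin n × ρ.ker ≃ₜ* CptExt.SHCover ρ,
        ∀ s k, ((Φ (s, k)).1.1 : H) = φ s * k ∧ (Φ (s, k)).1.2 = s) ∧
      ∃ k₀ : Subgroup.center ρ.ker, k₀ ^ 2 = 1 ∧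
        φ (CptExt.spinNegOne (by omega)) = ((k₀ : ρ.ker) : H) ∧
        ∃ Ψ : (CptExt.Spin n × ρ.ker) ⧸ CptExt.diagSubgroup (by omega) k₀ ≃ₜ* CptExt.SH ρ,
          ∀ s k, (Ψ (QuotientGroup.mk (s, k)) : H) = φ s * k) := by
  have hSO := CptExt.SO_le_range himage
  refine ⟨CptExt.exists_ideal_decomposition hρ hSO, fun hn => ?_⟩
  have := topologicalGroup_of_lieGroup (𝓡 d) ∞ (G := H)
  obtain ⟨L⟩ := CptExt.exists_rotationLift hρ hSO
  obtain ⟨φ, hφ⟩ := L.exists_isCanonicalLift hn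
  exact ⟨φ, hφ, fun φ' hφ' => hφ.unique hn hφ', hφ.exists_coverEquiv (by omega),
    hφ.exists_quotientEquiv (by omega) hρ.continuous⟩
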